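/- **Setting.** Let $\mathcal A$ be a timed automaton with one clock $x$: finite sets of locations $L$ and edges $E$, where each edge $e$ has a source, a target, a guard and possibly a reset of $x$, and an invariant $\mathcal I(\ell)$ for each location $\ell$; guards and invariants are finite conjunctions of constraints $x\sim c$ with $c\in\mathbb N$ and ${\sim}\in\{<,\le,=,\ge,>\}$. A state is a pair $s=(\ell,v)$ with $v\in\mathbb R_+$ satisfying $\mathcal I(\ell)$; write $s+t=(\ell,v+t)$. There is a transition $(\ell,v)\xrightarrow{\tau,e}(\ell',v')$ if $e$ goes from $\ell$ to $\ell'$, $v+\tau'$ satisfies $\mathcal I(\ell)$ for all $0\le\tau'\le\tau$, $v+\tau$ satisfies the guard of $e$, $v'=0$ if $e$ resets the clock and $v'=v+\tau$ otherwise, and $v'$ satisfies $\mathcal I(\ell')$. Let $I(s,e)$ be the set of delays $\tau$ with $s\xrightarrow{\tau,e}s'$ for some $s'$, and $I(s)=\bigcup_e I(s,e)$; $\mathcal A$ is non-blocking, i.e. $I(s)\neq\emptyset$ for every state $s$. Each state $s$ carries a probability measure $\mu_s$ on $\mathbb R_+$, depending measurably on $s$, with $\mu_s(I(s))=1$, equivalent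 to Lebesgue measure on $I(s)$ if $I(s)$ has positive Lebesgue measure, and equivalent to the uniform distribution on the finite set $I(s)$ otherwise. Each edge has a weight $w(e)>0$. From $s$ a delay $t$ is drawn according to $\mu_s$, then an edge $e$ among those that can be taken from $s+t$ without delay, with probability proportional to $w(e)$; iterating this from the state reached gives a probability measure $\mathbb P_s$ on the infinite runs $s\xrightarrow{\tau_1,e_1}s_1\xrightarrow{\tau_2,e_2}\cdots$ from $s$. A run is *Zeno* if $\sum_i\tau_i<\infty$. Assume condition $(\dagger)$: (i) for every $\ell$ and $0\le a<b$, the map $v\mapsto\mu_{(\ell,v)}([a,b])$ is continuous on the states of $\ell$; (ii) if $s$ and $s'=s+t$ ($t\ge0$) are states and $e$ is an edge with $0\notin I(s+t',e)$ for all $0\le t'\le t$, then $\mu_s(I(s,e))\le\mu_{s'}(I(s',e))$; (iii) there is $0<\lambda_0<1$ such that $\mu_s([0,1/2])\le\lambda_0$ for every state $s$ with $I(s)$ unbounded. **Topology.** For edges $e_1,\dots,e_n$ and $C\subseteq\mathbb R_+^n$, let $\mathrm{Pol}_C(s,e_1\dots e_n)$ be the set of $(\tau_i)\in C$ such that $s\xrightarrow{\tau_1,e_1}\cdots\xrightarrow{\tau_n,e_n}s_n$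 for some $s_1,\dots,s_n$, and let $C_i$ be its projection to the first $i$ coordinates ($C_0$ being no constraint). The constrained path is *thin* if $\dim\mathrm{Pol}_{C_i}(s,e_1\dots e_i)<\dim\bigcup_e\mathrm{Pol}_{C_{i-1}}(s,e_1\dots e_{i-1}e)$ for some $1\le i\le n$, and *thick* otherwise. The runs from $s$ carry the topology whose basic open sets are the cylinders $\{\text{runs from } s \text{ whose first } n \text{ edges are } e_1,\dots,e_n \text{ and whose first } n \text{ delays lie in } C\}$ with $C$ Borel, the constrained path thick, and $\mathrm{Pol}_C(s,e_1\dots e_n)$ open in $\mathrm{Pol}_{\mathbb R_+^n}(s,e_1\dots e_n)$. A set is *large* if its complement is meagre. **Thick graph.** Let $0=c_0<c_1<\dots<c_k$ be $0$ and the constants occurring in $\mathcal A$; the regions are $\{c_i\}$, $(c_i,c_{i+1})$ and $(c_k,\infty)$, and $[v]$ is the region of $v$. The region automaton has vertices $(\ell,r)$ and an edge $f=\big((\ell,r)\xrightarrow{r'',e}(\ell',r')\big)$, guarded by the region $r''$, whenever $(\ell,v)\xrightarrow{\tau,e}(\ell',v')$ for some $v\in r$ and $\tau$ with $v+\tau\in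 r''$, $v'\in r'$. For $s=(\ell,v)$ with $v\in r$ let $I(s,f)$ be the set of delays after which $f$ can be taken from $s$. The edge $f$ is thin if $\dim I(s,f)<\dim I(s)$ for some such $s$. The *thick graph* is the region automaton without its thin edges, and $\iota(s)=(\ell,[v])$ for $s=(\ell,v)$. A bottom strongly connected component (BSCC) of the thick graph is a *Zeno BSCC* if all its regions are bounded and none of its edges resets the clock, where resets on edges guarded by the region $\{0\}$, which have no effect, are not counted. **Theorem.** Under these assumptions, for every state $s$ of $\mathcal A$ the following are equivalent: (a) $\mathbb P_s$-almost every run from $s$ is non-Zeno; (b) the set of non-Zeno runs from $s$ is large; (c) no Zeno BSCC is reachable from $\iota(s)$ in the thick graph. -/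

import Mathlib

open MeasureTheory ProbabilityTheory
open scoped NNReal ENNReal

/-! ### Single-clock timed automata -/

/-- The comparison symbols `<`, `≤`, `=`, `≥`, `>` of atomic clock constraints. -/
inductive Cmp where
  | lt | le | eq | ge | gt

/-- `r.Holds v c` is the constraint `v ∼ c`. -/
def Cmp.Holds : Cmp → ℝ≥0 → ℕ → Prop
  | .lt, v, c => v < c
  | .le, v, c => v ≤ c
  | .eq, v, c => v = c
  | .ge, v, c => (c : ℝ≥0) ≤ v
  | .gt, v, c => (c : ℝ≥0) < v

/-- A guard over a single clock `x`: a finite conjunction of constraints `x ∼ c`, `c ∈ ℕ`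
(the empty conjunction is `true`). -/
abbrev Guard := List (Cmp × ℕ)

/-- The clock value `v` satisfies the guard `g`. -/
def Guard.Sat (g : Guard) (v : ℝ≥0) : Prop := ∀ a ∈ g, a.1.Holds v a.2

/-- A timed automaton with a single clock, with set of locations `L` and set of edges `E`
(both are taken finite below).  `reset e` says that the edge `e` resets the clock. -/
structure TimedAutomaton (L E : Type*) where
  source : E → L
  target : E → L
  guard : E → Guard
  reset : E → Prop
  inv : L → Guard

namespace TimedAutomaton

variable {L E : Type*}

/-- `(ℓ, v)` is a state when `v` satisfies the invariant of `ℓ`. -/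
def IsState (A : TimedAutomaton L E) (s : L × ℝ≥0) : Prop := (A.inv s.1).Sat s.2

open Classical in
/-- The clock value after taking the edge `e` with clock value `v`. -/
noncomputable def clockAfter (A : TimedAutomaton L E) (e : E) (v : ℝ≥0) : ℝ≥0 :=
  if A.reset e then 0 else v

/-- The transition relation `s —(τ, e)→ s'`. -/
structure Step (A : TimedAutomaton L E) (s : L × ℝ≥0) (τ : ℝ≥0) (e : E) (s' : L × ℝ≥0) :
    Prop where
  source_eq : A.source e = s.1
  inv_source : ∀ τ' ≤ τ, (A.inv s.1).Sat (s.2 + τ')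
  guard_sat : (A.guard e).Sat (s.2 + τ)
  target_eq : s'.1 = A.target e
  clock_eq : s'.2 = A.clockAfter e (s.2 + τ)
  inv_target : (A.inv s'.1).Sat s'.2

/-- `I(s, e)`: the delays after which `e` can be taken from `s`. -/
def delaysOf (A : TimedAutomaton L E) (s : L × ℝ≥0) (e : E) : Set ℝ≥0 :=
  {τ | ∃ s', A.Step s τ e s'}

/-- `I(s)`: the delays after which some edge can be taken from `s`. -/
def delays (A : TimedAutomaton L E) (s : L × ℝ≥0) : Set ℝ≥0 := ⋃ e, A.delaysOf s e

/-- `e` can be taken from `s` immediately. -/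
def Enabled (A : TimedAutomaton L E) (s : L × ℝ≥0) (e : E) : Prop := 0 ∈ A.delaysOf s e

/-- From every state some edge can be taken after some delay. -/
def NonBlocking (A : TimedAutomaton L E) : Prop := ∀ s, A.IsState s → (A.delays s).Nonempty

/-- An infinite run `s = s₀ —(τ₁, e₁)→ s₁ —(τ₂, e₂)→ s₂ ⋯`; `delay n` is `τₙ₊₁` and `edge n` is
`eₙ₊₁`. -/
structure Run (A : TimedAutomaton L E) (s : L × ℝ≥0) where
  state : ℕ → L × ℝ≥0
  delay : ℕ → ℝ≥0
  edge : ℕ → E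
  start : state 0 = s
  step : ∀ n, A.Step (state n) (delay n) (edge n) (state (n + 1))

/-- A run is Zeno when its delays have a finite sum. -/
def Run.Zeno {A : TimedAutomaton L E} {s : L × ℝ≥0} (ρ : A.Run s) : Prop := Summable ρ.delay

/-! ### The topology on runs and large satisfaction -/

/-- The set `Pol(π_C(s, e₁ … eₙ))` of delay sequences satisfying the constraint `C` along which the
edges `e₁, …, eₙ` can be taken from `s`. -/
def pol (A : TimedAutomaton L E) (s : L × ℝ≥0) {n : ℕ} (e : Fin n → E)
    (C : Set (Fin n → ℝ≥0)) : Set (Fin n → ℝ≥0) :=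
  {τ | τ ∈ C ∧ ∃ σ : Fin (n + 1) → L × ℝ≥0, σ 0 = s ∧
    ∀ i : Fin n, A.Step (σ i.castSucc) (τ i) (e i) (σ i.succ)}

/-- The constraint `C_k` induced by `Pol(π_C(s, e₁ … eₙ))` on the first `k ≤ n` delays. -/
def projPol (A : TimedAutomaton L E) (s : L × ℝ≥0) {n : ℕ} (e : Fin n → E)
    (C : Set (Fin n → ℝ≥0)) (k : ℕ) (hk : k ≤ n) : Set (Fin k → ℝ≥0) :=
  (fun τ (i : Fin k) => τ (Fin.castLE hk i)) '' A.pol s e C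

/-- The constrained symbolic path `π_C(s, e₁ … eₙ)` is thin when for some `1 ≤ k + 1 ≤ n` the
dimension of `Pol(π_{C_{k+1}}(s, e₁ … e_k e_{k+1}))` is smaller than that of
`⋃ e', Pol(π_{C_k}(s, e₁ … e_k e'))`.  The sets that matter are countable unions of convex sets,
whose dimension is their Hausdorff dimension. -/
def PathThin (A : TimedAutomaton L E) (s : L × ℝ≥0) {n : ℕ} (e : Fin n → E)
    (C : Set (Fin n → ℝ≥0)) : Prop :=
  ∃ (k : ℕ) (hk : k + 1 ≤ n),
    dimH (A.pol s (fun i : Fin (k + 1) => e (Fin.castLE hk i)) (A.projPol s e C (k + 1) hk)) <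
      dimH (⋃ e' : E, A.pol s
        (Fin.snoc (α := fun _ => E) (fun i : Fin k => e (Fin.castLE (Nat.le_of_succ_le hk) i)) e')
        {τ : Fin (k + 1) → ℝ≥0 |
          (fun i : Fin k => τ i.castSucc) ∈ A.projPol s e C k (Nat.le_of_succ_le hk)})

/-- The cylinder `Cyl(π_C(s, e₁ … eₙ))` of infinite runs. -/
def cyl (A : TimedAutomaton L E) (s : L × ℝ≥0) {n : ℕ} (e : Fin n → E)
    (C : Set (Fin n → ℝ≥0)) : Set (A.Run s) :=
  {ρ | (∀ i : Fin n, ρ.edge i = e i) ∧ (fun i : Fin n => ρ.delay i) ∈ C}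

/-- The topology on the runs from `s`: its basic open sets are the cylinders over thick constrained
symbolic paths `π_C`, with `C` a Borel constraint, such that `Pol(π_C)` is open in `Pol(π)`. -/
instance runTopology (A : TimedAutomaton L E) (s : L × ℝ≥0) : TopologicalSpace (A.Run s) :=
  TopologicalSpace.generateFrom
    {U | ∃ (n : ℕ) (e : Fin n → E) (C : Set (Fin n → ℝ≥0)),
      ¬ A.PathThin s e C ∧ MeasurableSet C ∧
      (∃ O : Set (Fin n → ℝ≥0), IsOpen O ∧ A.pol s e C = O ∩ A.pol s e Set.univ) ∧
      U = A.cyl s e C}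

/-- `A` largely satisfies `P` from `s`: the complement of the set of runs satisfying `P` is
meagre. -/
def LargelySatisfies (A : TimedAutomaton L E) (s : L × ℝ≥0) (P : A.Run s → Prop) : Prop :=
  IsMeagre {ρ : A.Run s | P ρ}ᶜ

/-! ### The region automaton and the thick graph -/

/-- The constants of `A`: `0` and all constants of its guards and invariants. -/
def consts (A : TimedAutomaton L E) : Set ℕ :=
  {0} ∪ {c | ∃ e, ∃ a ∈ A.guard e, a.2 = c} ∪ {c | ∃ l, ∃ a ∈ A.inv l, a.2 = c}

/-- The region of the clock value `v`: the clock values that compare to all constants as `v` does.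
If the constants are `0 = c₀ < ⋯ < c_k`, these are the sets `{cᵢ}`, `(cᵢ, cᵢ₊₁)` and
`(c_k, +∞)`. -/
def region (A : TimedAutomaton L E) (v : ℝ≥0) : Set ℝ≥0 :=
  {v' | ∀ c ∈ A.consts, (v' < (c : ℝ≥0) ↔ v < (c : ℝ≥0)) ∧ (v' = (c : ℝ≥0) ↔ v = (c : ℝ≥0))}

/-- `ι(s)`, more precisely its location `(ℓ, [v])` in the region automaton, for `s = (ℓ, v)`. -/
def toRegion (A : TimedAutomaton L E) (s : L × ℝ≥0) : L × Set ℝ≥0 := (s.1, A.region s.2)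

/-- The edges of the region automaton: `(ℓ, r) —(r'', e)→ (ℓ', r')` where for some `v ∈ r` and some
delay `τ` one has `(ℓ, v) —(τ, e)→ (ℓ', v')` with `v + τ ∈ r''` and `v' ∈ r'`. The region `r''` is
the guard of this edge. -/
structure RegionEdge (A : TimedAutomaton L E) where
  src : L × Set ℝ≥0
  guardRegion : Set ℝ≥0
  edge : E
  tgt : L × Set ℝ≥0
  valid : ∃ (v τ v' : ℝ≥0), A.Step (src.1, v) τ edge (tgt.1, v') ∧
    src.2 = A.region v ∧ guardRegion = A.region (v + τ) ∧ tgt.2 = A.region v'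

/-- `I(s, f)` for an edge `f` of the region automaton and its state `s = (f.src, v)`. -/
def RegionEdge.delaysOf {A : TimedAutomaton L E} (f : A.RegionEdge) (v : ℝ≥0) : Set ℝ≥0 :=
  {τ | v + τ ∈ f.guardRegion ∧ ∃ v' ∈ f.tgt.2, A.Step (f.src.1, v) τ f.edge (f.tgt.1, v')}

/-- `I(s)` in the region automaton, for its state `s = (q, v)`. -/
def regionDelays (A : TimedAutomaton L E) (q : L × Set ℝ≥0) (v : ℝ≥0) : Set ℝ≥0 :=
  ⋃ (f : A.RegionEdge) (_ : f.src = q), f.delaysOf v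

/-- An edge `f` of the region automaton is thin when `dim I(s, f) < dim I(s)` for some state `s` of
its source. -/
def RegionEdge.Thin {A : TimedAutomaton L E} (f : A.RegionEdge) : Prop :=
  ∃ v ∈ f.src.2, dimH (f.delaysOf v) < dimH (A.regionDelays f.src v)

/-- The thick graph: the region automaton without its thin edges. -/
def ThickAdj (A : TimedAutomaton L E) (q q' : L × Set ℝ≥0) : Prop :=
  ∃ f : A.RegionEdge, ¬ f.Thin ∧ f.src = q ∧ f.tgt = q'

/-- `q'` is reachable from `q` in the thick graph. -/
def ThickReach (A : TimedAutomaton L E) : L × Set ℝ≥0 → L × Set ℝ≥0 → Prop :=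
  Relation.ReflTransGen A.ThickAdj

/-- `B` is a bottom strongly connected component of the thick graph. -/
structure IsBSCC (A : TimedAutomaton L E) (B : Set (L × Set ℝ≥0)) : Prop where
  nonempty : B.Nonempty
  connected : ∀ q ∈ B, ∀ q' ∈ B, A.ThickReach q q'
  bottom : ∀ q ∈ B, ∀ q', A.ThickAdj q q' → q' ∈ B

/-- A Zeno BSCC: it lies in bounded regions and none of its edges resets the clock. Resets on edges
guarded by `x = 0` have no effect and do not count. -/
structure IsZenoBSCC (A : TimedAutomaton L E) (B : Set (L × Set ℝ≥0)) : Prop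
    extends A.IsBSCC B where
  bounded : ∀ q ∈ B, BddAbove q.2
  no_reset : ∀ f : A.RegionEdge, ¬ f.Thin → f.src ∈ B → A.reset f.edge → f.guardRegion = {0}

end TimedAutomaton

/-! ### Stochastic timed automata -/

/-- Lebesgue measure on `ℝ≥0`. -/
noncomputable def lebesgue : Measure ℝ≥0 := Measure.comap ((↑) : ℝ≥0 → ℝ) volume

/-- A single-clock stochastic timed automaton: a non-blocking timed automaton with a (measurable)
family of probability measures `μ s` over delays and positive edge weights. The measures are
constrained only at states. -/
structure StochasticTimedAutomaton (L E : Type*) [MeasurableSpace L]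
    extends TimedAutomaton L E where
  nonBlocking : toTimedAutomaton.NonBlocking
  μ : Kernel (L × ℝ≥0) ℝ≥0
  isMarkov : IsMarkovKernel μ
  weight : E → ℝ≥0
  weight_pos : ∀ e, 0 < weight e
  /-- `μ s` is concentrated on `I(s)`. -/
  μ_delays : ∀ s, toTimedAutomaton.IsState s → μ s (toTimedAutomaton.delays s) = 1
  /-- If `I(s)` has positive Lebesgue measure, `μ s` is equivalent to the Lebesgue measure on `I(s)`. -/
  μ_equiv_volume : ∀ s, toTimedAutomaton.IsState s →
    0 < lebesgue (toTimedAutomaton.delays s) →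
      μ s ≪ lebesgue.restrict (toTimedAutomaton.delays s) ∧
      lebesgue.restrict (toTimedAutomaton.delays s) ≪ μ s
  /-- Otherwise `μ s` is equivalent to the uniform distribution on the finite set
  `I(s)`. -/
  μ_equiv_uniform : ∀ s, toTimedAutomaton.IsState s →
    lebesgue (toTimedAutomaton.delays s) = 0 →
      μ s ≪ uniformOn (toTimedAutomaton.delays s) ∧
      uniformOn (toTimedAutomaton.delays s) ≪ μ s

namespace TimedAutomaton

variable {L E : Type*}

theorem measurableSet_holds (r : Cmp) (c : ℕ) : MeasurableSet {v : ℝ≥0 | r.Holds v c} := by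
  cases r
  · exact measurableSet_Iio
  · exact measurableSet_Iic
  · exact measurableSet_singleton (c : ℝ≥0)
  · exact measurableSet_Ici
  · exact measurableSet_Ioi

theorem measurableSet_sat (g : Guard) : MeasurableSet {v : ℝ≥0 | g.Sat v} := by
  induction g with
  | nil => simp [Guard.Sat]
  | cons a g ih =>
    have h : {v : ℝ≥0 | Guard.Sat (a :: g) v} = {v | a.1.Holds v a.2} ∩ {v | Guard.Sat g v} := by
      ext v; simp [Guard.Sat]
    rw [h]
    exact (measurableSet_holds _ _).inter ih

theorem measurable_clockAfter (A : TimedAutomaton L E) (e : E) : Measurable (A.clockAfter e) := by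
  by_cases h : A.reset e
  · have h2 : A.clockAfter e = fun _ => 0 := by funext v; simp [clockAfter, h]
    rw [h2]; exact measurable_const
  · have h2 : A.clockAfter e = id := by funext v; simp [clockAfter, h]
    rw [h2]; exact measurable_id

theorem enabled_iff (A : TimedAutomaton L E) (s : L × ℝ≥0) (e : E) :
    A.Enabled s e ↔ A.source e = s.1 ∧ (A.inv s.1).Sat s.2 ∧ (A.guard e).Sat s.2 ∧
      (A.inv (A.target e)).Sat (A.clockAfter e s.2) := by
  constructor
  · rintro ⟨s', h1, h2, h3, h4, h5, h6⟩
    rw [h4, h5] at h6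
    exact ⟨h1, by simpa using h2 0 le_rfl, by simpa using h3, by simpa using h6⟩
  · rintro ⟨h1, h2, h3, h4⟩
    refine ⟨(A.target e, A.clockAfter e s.2), h1, ?_, by simpa using h3, rfl, by simp, h4⟩
    intro τ' hτ'
    have : τ' = 0 := le_antisymm hτ' zero_le
    simpa [this] using h2

theorem measurableSet_enabled [MeasurableSpace L] [DiscreteMeasurableSpace L] [Countable L]
    (A : TimedAutomaton L E) (e : E) : MeasurableSet {s : L × ℝ≥0 | A.Enabled s e} := by
  have h : {s : L × ℝ≥0 | A.Enabled s e} = ⋃ l : L, ({l} : Set L) ×ˢ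
      {v : ℝ≥0 | A.source e = l ∧ (A.inv l).Sat v ∧ (A.guard e).Sat v ∧
        (A.inv (A.target e)).Sat (A.clockAfter e v)} := by
    ext ⟨l, v⟩
    simp [enabled_iff]
  rw [h]
  refine MeasurableSet.iUnion fun l => (MeasurableSet.of_discrete).prod ?_
  exact (MeasurableSet.const _).inter ((measurableSet_sat _).inter ((measurableSet_sat _).inter
    (measurable_clockAfter A e (measurableSet_sat _))))

end TimedAutomaton

namespace StochasticTimedAutomaton

variable {L E : Type*} [Fintype E] [MeasurableSpace L] [MeasurableSpace E]

open Classical in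
/-- The total weight of the edges enabled in `s`. -/
noncomputable def enabledWeight (M : StochasticTimedAutomaton L E) (s : L × ℝ≥0) : ℝ≥0∞ :=
  ∑ e, if M.Enabled s e then (M.weight e : ℝ≥0∞) else 0

open Classical in
/-- The probability `p_s(e)` of choosing the edge `e` in `s`. -/
noncomputable def edgeProb (M : StochasticTimedAutomaton L E) (s : L × ℝ≥0) (e : E) : ℝ≥0∞ :=
  if M.Enabled s e then M.weight e / M.enabledWeight s else 0

open Classical in
/-- The distribution `p_s` over edges. If no edge is enabled in `s`, which happens only with
probability `0` after the random delay, the arbitrary edge `e₀` is chosen. -/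
noncomputable def edgeLaw (M : StochasticTimedAutomaton L E) (e₀ : E) (s : L × ℝ≥0) : Measure E :=
  if ∃ e, M.Enabled s e then ∑ e, M.edgeProb s e • Measure.dirac e else Measure.dirac e₀

theorem sum_edgeProb (M : StochasticTimedAutomaton L E) (s : L × ℝ≥0) (h : ∃ e, M.Enabled s e) :
    ∑ e, M.edgeProb s e = 1 := by
  classical
  have h1 : ∀ e, M.edgeProb s e =
      (if M.Enabled s e then (M.weight e : ℝ≥0∞) else 0) / M.enabledWeight s := by
    intro e
    unfold edgeProb
    split_ifs <;> simp
  simp only [h1, div_eq_mul_inv]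
  rw [← Finset.sum_mul]
  change M.enabledWeight s * (M.enabledWeight s)⁻¹ = 1
  refine ENNReal.mul_inv_cancel ?_ ?_
  · obtain ⟨e, he⟩ := h
    unfold enabledWeight
    intro h0
    rw [Finset.sum_eq_zero_iff] at h0
    have h2 := h0 e (Finset.mem_univ e)
    have h3 := M.weight_pos e
    simp [he, h3.ne'] at h2
  · unfold enabledWeight
    refine ENNReal.sum_ne_top.2 fun e _ => ?_
    split_ifs <;> simp

theorem isProbabilityMeasure_edgeLaw (M : StochasticTimedAutomaton L E) (e₀ : E) (s : L × ℝ≥0) :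
    IsProbabilityMeasure (M.edgeLaw e₀ s) := by
  constructor
  unfold edgeLaw
  split_ifs with h
  · simpa [Measure.finsetSum_apply] using M.sum_edgeProb s h
  · simp

variable [Countable L] [DiscreteMeasurableSpace L]

theorem measurable_edgeProb (M : StochasticTimedAutomaton L E) (e : E) :
    Measurable fun s => M.edgeProb s e := by
  classical
  unfold edgeProb enabledWeight
  refine Measurable.ite (M.measurableSet_enabled e) ?_ measurable_const
  refine measurable_const.div (Finset.measurable_sum _ fun e' _ => ?_)
  exact Measurable.ite (M.measurableSet_enabled e') measurable_const measurable_const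

theorem measurable_edgeLaw (M : StochasticTimedAutomaton L E) (e₀ : E) :
    Measurable (M.edgeLaw e₀) := by
  classical
  unfold edgeLaw
  refine Measurable.ite ?_ ?_ measurable_const
  · have h : {s : L × ℝ≥0 | ∃ e, M.Enabled s e} = ⋃ e, {s | M.Enabled s e} := by ext; simp
    rw [h]
    exact MeasurableSet.iUnion fun e => M.measurableSet_enabled e
  · refine Measure.measurable_of_measurable_coe _ fun B hB => ?_
    simp only [Measure.finsetSum_apply, Measure.smul_apply, smul_eq_mul]
    exact Finset.measurable_sum _ fun e _ => (M.measurable_edgeProb e).mul_const _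

/-- The law of the edge chosen from `s` after the delay `t`, namely `p_{s + t}`. -/
noncomputable def edgeKernel (M : StochasticTimedAutomaton L E) (e₀ : E) :
    Kernel ((L × ℝ≥0) × ℝ≥0) E where
  toFun x := M.edgeLaw e₀ (x.1.1, x.1.2 + x.2)
  measurable' := (M.measurable_edgeLaw e₀).comp (by fun_prop)

instance (M : StochasticTimedAutomaton L E) (e₀ : E) : IsMarkovKernel (M.edgeKernel e₀) :=
  ⟨fun _ => M.isProbabilityMeasure_edgeLaw e₀ _⟩

instance (M : StochasticTimedAutomaton L E) : IsMarkovKernel M.μ := M.isMarkov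

/-- The law of the delay and the edge chosen from `s`: first a delay `t` is drawn according to
`μ s`, then an edge according to `p_{s + t}`. The state `s` is kept in the first component. -/
noncomputable def moveKernel (M : StochasticTimedAutomaton L E) (e₀ : E) :
    Kernel (L × ℝ≥0) ((L × ℝ≥0) × (ℝ≥0 × E)) :=
  Kernel.id ×ₖ (M.μ ⊗ₖ M.edgeKernel e₀)

instance (M : StochasticTimedAutomaton L E) (e₀ : E) : IsMarkovKernel (M.moveKernel e₀) := by
  unfold moveKernel; infer_instance

/-- The state reached from `s` by the delay `τ` and the edge `e`, where `x = (s, (τ, e))`. -/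
noncomputable def next (M : StochasticTimedAutomaton L E) (x : (L × ℝ≥0) × (ℝ≥0 × E)) : L × ℝ≥0 :=
  (M.target x.2.2, M.clockAfter x.2.2 (x.1.2 + x.2.1))

theorem measurable_next [DiscreteMeasurableSpace E] (M : StochasticTimedAutomaton L E) :
    Measurable M.next := by
  refine Measurable.prodMk ?_ ?_
  · exact (Measurable.of_discrete (f := M.target)).comp (by fun_prop)
  · have h : Measurable fun y : ℝ≥0 × E => M.clockAfter y.2 y.1 :=
      measurable_from_prod_countable_left fun e => M.measurable_clockAfter e
    exact h.comp (g := fun y : ℝ≥0 × E => M.clockAfter y.2 y.1)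
      (f := fun x : (L × ℝ≥0) × (ℝ≥0 × E) => (x.1.2 + x.2.1, x.2.2)) (by fun_prop)

variable [DiscreteMeasurableSpace E]

open Classical in
/-- The law of the random sequence `(s₀, (τ₁, e₁)), (s₁, (τ₂, e₂)), …` with `s₀ = s`: the Markov
chain in which `(τₙ₊₁, eₙ₊₁)` is drawn from `sₙ` by `moveKernel` and `sₙ₊₁` is the state reached.
(Without edges there is no run, and the value is irrelevant.) -/
noncomputable def runLaw (M : StochasticTimedAutomaton L E) (s : L × ℝ≥0) :
    Measure (ℕ → (L × ℝ≥0) × (ℝ≥0 × E)) :=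
  if h : Nonempty E then
    Kernel.trajMeasure (X := fun _ => (L × ℝ≥0) × (ℝ≥0 × E)) (M.moveKernel h.some s)
      (fun n => (M.moveKernel h.some).comap
        (fun x : (i : Finset.Iic n) → (L × ℝ≥0) × (ℝ≥0 × E) =>
          M.next (x ⟨n, Finset.mem_Iic.2 le_rfl⟩))
        (M.measurable_next.comp (measurable_pi_apply _)))
  else 0

/-- A run as a sequence of states with the delay and edge chosen there. -/
def runSeq (M : StochasticTimedAutomaton L E) {s : L × ℝ≥0} (ρ : M.Run s) :
    ℕ → (L × ℝ≥0) × (ℝ≥0 × E) :=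
  fun n => (ρ.state n, (ρ.delay n, ρ.edge n))

/-- The probability that a run from `s` satisfies `P`. -/
noncomputable def prob (M : StochasticTimedAutomaton L E) (s : L × ℝ≥0) (P : M.Run s → Prop) :
    ℝ≥0∞ :=
  M.runLaw s (M.runSeq '' {ρ : M.Run s | P ρ})

/-- `M` almost surely satisfies `P` from `s`. -/
def AlmostSurelySatisfies (M : StochasticTimedAutomaton L E) (s : L × ℝ≥0) (P : M.Run s → Prop) :
    Prop :=
  M.prob s P = 1

end StochasticTimedAutomaton

/-- The additional condition (†) on the delay distributions. -/
structure StochasticTimedAutomaton.Dagger {L E : Type*} [MeasurableSpace L]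
    (M : StochasticTimedAutomaton L E) : Prop where
  /-- `v ↦ μ (ℓ, v) [a, b]` is continuous on the states of location `ℓ`, for every nondegenerate
  interval `[a, b]`. -/
  continuous_μ : ∀ (l : L) (a b : ℝ≥0), a < b →
    ContinuousOn (fun v => M.μ (l, v) (Set.Icc a b)) {v | M.IsState (l, v)}
  /-- While `e` is not enabled, letting time pass does not decrease the probability of `I(s, e)`. -/
  mono_μ : ∀ (l : L) (v t : ℝ≥0) (e : E), M.IsState (l, v) → M.IsState (l, v + t) →
    (∀ t' ≤ t, 0 ∉ M.delaysOf (l, v + t') e) →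
      M.μ (l, v) (M.delaysOf (l, v) e) ≤ M.μ (l, v + t) (M.delaysOf (l, v + t) e)
  /-- Short delays have probability bounded away from `1` where `I(s)` is unbounded. -/
  unbounded_μ : ∃ c : ℝ≥0, 0 < c ∧ c < 1 ∧ ∀ s, M.IsState s → ¬ BddAbove (M.delays s) →
    M.μ s (Set.Icc 0 (1 / 2)) ≤ c

/-! The measure, the topology and the thick graph all ignore the same steps: those that fire at a
constant although some delay leads to a non-constant value. The remaining steps are called thick
(`ThickStep`). Non-thin region edges are exactly those coming from thick steps
(`RegionEdge.not_thin_iff`), almost every run has only thick steps (`ae_runLaw`), and every nonempty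
open set of runs contains a neighbourhood of a thick run (`exists_nbhd_subset`). So each of the
three conditions is decided by thick runs.

A thick run that enters a Zeno BSCC never leaves it. There the clock is bounded and never
effectively reset, so the run is Zeno (`IsZenoBSCC.summable`). Reachable vertices are visited with
positive probability (`exists_runLaw_pos`), which gives (a) → (c). A Baire argument carried out on
thick runs (`exists_thick_mem_iInter`) gives (b) → (c).

For (c) → (a), the conditional Borel–Cantelli lemma makes almost every run fair: a move whose
probability is infinitely often bounded below occurs infinitely often. The clock along a Zeno run
converges to some `u`. By continuity of the delay measures, fairness forbids every positive delay
from a limit state `(l, u)` (`FairRun.delays_subset`). Hence the locations visited infinitely often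
are closed under thick edges inside one bounded region, which is `{u}` or the region just below `u`,
and no edge there has an effective reset. Such a set contains a Zeno BSCC (`exists_isZenoBSCC`).

For (c) → (b), the probabilistic result supplies a thick non-Zeno continuation after any prefix of a
thick run. Therefore the runs of duration greater than `N` contain a dense open set for every `N`.

The dimensions are computed by using as coordinates the clock values at which edges are taken. These
depend on the delays in a bi-Lipschitz way, so the dimension is the number of values that are free
to move. Values at constants are pinned, the others fill a box (`Admissible.exists_box`,
`card_le_dimH`, `dimH_le_card`). -/

set_option linter.unusedSectionVars false

/-! ### Regions, windows and thick steps -/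

namespace TimedAutomaton

variable {L E : Type*} (A : TimedAutomaton L E)

/-- The constants of `A` as clock values. -/
def constPoints : Set ℝ≥0 := (fun c : ℕ => (c : ℝ≥0)) '' A.consts

theorem finite_constPoints [Finite L] [Finite E] : A.constPoints.Finite := by
  have h (g : Guard) : {c : ℕ | ∃ a ∈ g, a.2 = c}.Finite := by
    refine (List.finite_toSet (g.map Prod.snd)).subset ?_
    rintro c ⟨a, ha, rfl⟩
    exact List.mem_map_of_mem ha
  have h1 : {c : ℕ | ∃ e, ∃ a ∈ A.guard e, a.2 = c}.Finite := by
    have : {c : ℕ | ∃ e, ∃ a ∈ A.guard e, a.2 = c} = ⋃ e, {c | ∃ a ∈ A.guard e, a.2 = c} := by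
      ext; simp
    rw [this]
    exact Set.finite_iUnion fun e => h _
  have h2 : {c : ℕ | ∃ l, ∃ a ∈ A.inv l, a.2 = c}.Finite := by
    have : {c : ℕ | ∃ l, ∃ a ∈ A.inv l, a.2 = c} = ⋃ l, {c | ∃ a ∈ A.inv l, a.2 = c} := by
      ext; simp
    rw [this]
    exact Set.finite_iUnion fun e => h _
  exact (((Set.finite_singleton 0).union h1).union h2).image _

theorem zero_mem_consts : 0 ∈ A.consts := Or.inl (Or.inl rfl)

theorem zero_mem_constPoints : 0 ∈ A.constPoints := ⟨0, A.zero_mem_consts, by simp⟩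

theorem mem_region_self (v : ℝ≥0) : v ∈ A.region v := fun _ _ => ⟨Iff.rfl, Iff.rfl⟩

variable {A}

theorem region_eq_of_mem {u v : ℝ≥0} (h : u ∈ A.region v) : A.region u = A.region v := by
  ext w
  constructor
  · intro hw c hc
    exact ⟨(hw c hc).1.trans (h c hc).1, (hw c hc).2.trans (h c hc).2⟩
  · intro hw c hc
    exact ⟨(hw c hc).1.trans (h c hc).1.symm, (hw c hc).2.trans (h c hc).2.symm⟩

theorem mem_region_of_eq {u v : ℝ≥0} (h : A.region u = A.region v) : u ∈ A.region v :=
  h ▸ A.mem_region_self u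

theorem mem_region_symm {u v : ℝ≥0} (h : u ∈ A.region v) : v ∈ A.region u :=
  mem_region_of_eq (region_eq_of_mem h).symm

theorem mem_region_trans {u v w : ℝ≥0} (h : u ∈ A.region v) (h' : v ∈ A.region w) :
    u ∈ A.region w := region_eq_of_mem h' ▸ h

theorem eq_of_mem_region {c v : ℝ≥0} (hc : c ∈ A.constPoints) (h : v ∈ A.region c) : v = c := by
  obtain ⟨n, hn, rfl⟩ := hc
  exact (h n hn).2.2 rfl

theorem region_of_mem_constPoints {c : ℝ≥0} (hc : c ∈ A.constPoints) : A.region c = {c} := by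
  ext v
  exact ⟨fun h => eq_of_mem_region hc h, fun h => h ▸ A.mem_region_self c⟩

theorem mem_constPoints_of_mem_region {c v : ℝ≥0} (h : v ∈ A.region c) :
    v ∈ A.constPoints ↔ c ∈ A.constPoints := by
  constructor
  · intro hv; rwa [eq_of_mem_region hv (mem_region_symm h)]
  · intro hc; rwa [eq_of_mem_region hc h]

/-- Clock values that are not separated by a constant lie in the same region. -/
theorem mem_region_of_forall_notMem {u v : ℝ≥0} (huv : u ≤ v)
    (h : ∀ c ∈ A.constPoints, u ≤ c → c ≤ v → False) : v ∈ A.region u := by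
  intro c hc
  have h' := h c ⟨c, hc, rfl⟩
  refine ⟨⟨fun h1 => huv.trans_lt h1, fun h1 => ?_⟩, ⟨fun h1 => ?_, fun h1 => ?_⟩⟩
  · by_contra h2
    exact h' h1.le (not_lt.1 h2)
  · exact (h' (h1 ▸ huv) h1.ge).elim
  · exact (h' h1.le (h1 ▸ huv)).elim

theorem ordConnected_region (v : ℝ≥0) : (A.region v).OrdConnected := by
  refine ⟨fun x hx y hy z hz => ?_⟩
  intro c hc
  have h1 := hx c hc
  have h2 := hy c hc
  refine ⟨⟨fun h => h1.1.1 (hz.1.trans_lt h), fun h => hz.2.trans_lt (h2.1.2 h)⟩,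
    ⟨fun h => ?_, fun h => ?_⟩⟩
  · by_contra h3
    rcases lt_or_gt_of_ne h3 with h4 | h4
    · have := h2.1.2 h4
      exact (this.trans_le (h ▸ le_rfl)).not_ge hz.2
    · have h5 := mt h1.1.1 h4.not_gt
      have h6 : x = c := le_antisymm (hz.1.trans h.le) (not_lt.1 h5)
      exact h3 (h1.2.1 h6)
  · have h3 := h1.2.2 h
    have h4 := h2.2.2 h
    exact le_antisymm (hz.2.trans h4.le) (h3 ▸ hz.1)

theorem isOpen_region [Finite L] [Finite E] {v : ℝ≥0} (hv : v ∉ A.constPoints) :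
    IsOpen (A.region v) := by
  have h : A.region v = ⋂ c ∈ A.constPoints, {u | (u < c ↔ v < c) ∧ (u = c ↔ v = c)} := by
    ext u
    simp [region, constPoints]
  rw [h]
  refine A.finite_constPoints.isOpen_biInter fun c hc => ?_
  have hvc : v ≠ c := fun h => hv (h ▸ hc)
  rcases lt_or_gt_of_ne hvc with h1 | h1
  · convert! isOpen_Iio (a := c) using 1
    ext u
    simp only [h1, hvc, Set.mem_ofPred_eq, Set.mem_Iio, iff_true, iff_false]
    exact ⟨fun h => h.1, fun h => ⟨h, h.ne⟩⟩
  · convert! isOpen_Ioi (a := c) using 1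
    ext u
    simp only [h1.not_gt, hvc, Set.mem_ofPred_eq, Set.mem_Ioi, iff_false]
    exact ⟨fun h => lt_of_le_of_ne (not_lt.1 h.1) (Ne.symm h.2), fun h => ⟨h.not_gt, h.ne'⟩⟩

theorem measurableSet_region (A : TimedAutomaton L E) [Finite L] [Finite E] (v : ℝ≥0) :
    MeasurableSet (A.region v) := by
  by_cases hv : v ∈ A.constPoints
  · rw [region_of_mem_constPoints hv]; exact measurableSet_singleton _
  · exact (isOpen_region hv).measurableSet

theorem holds_congr {r : Cmp} {c : ℕ} (hc : c ∈ A.consts) {u v : ℝ≥0} (h : u ∈ A.region v) :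
    r.Holds u c ↔ r.Holds v c := by
  have h1 := h c hc
  cases r <;> simp only [Cmp.Holds]
  · exact h1.1
  · rw [le_iff_lt_or_eq, le_iff_lt_or_eq, h1.1, h1.2]
  · exact h1.2
  · rw [← not_lt, ← not_lt, h1.1]
  · rw [← not_le, ← not_le, le_iff_lt_or_eq, le_iff_lt_or_eq, h1.1, h1.2]

theorem inv_sat_congr (l : L) {u v : ℝ≥0} (h : u ∈ A.region v) :
    (A.inv l).Sat u ↔ (A.inv l).Sat v :=
  forall₂_congr fun a ha => holds_congr (Or.inr ⟨l, a, ha, rfl⟩) h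

theorem guard_sat_congr (e : E) {u v : ℝ≥0} (h : u ∈ A.region v) :
    (A.guard e).Sat u ↔ (A.guard e).Sat v :=
  forall₂_congr fun a ha => holds_congr (Or.inl (Or.inr ⟨e, a, ha, rfl⟩)) h

theorem clockAfter_mem_region (e : E) {u v : ℝ≥0} (h : u ∈ A.region v) :
    A.clockAfter e u ∈ A.region (A.clockAfter e v) := by
  unfold clockAfter
  split_ifs
  · exact A.mem_region_self 0
  · exact h

theorem isState_congr (l : L) {u v : ℝ≥0} (h : u ∈ A.region v) :
    A.IsState (l, u) ↔ A.IsState (l, v) := inv_sat_congr l h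

theorem _root_.Cmp.ordConnected_holds (r : Cmp) (c : ℕ) :
    {v : ℝ≥0 | r.Holds v c}.OrdConnected := by
  cases r
  · exact Set.ordConnected_Iio
  · exact Set.ordConnected_Iic
  · exact Set.ordConnected_singleton
  · exact Set.ordConnected_Ici
  · exact Set.ordConnected_Ioi

theorem _root_.Guard.ordConnected_sat (g : Guard) : {v : ℝ≥0 | g.Sat v}.OrdConnected := by
  refine ⟨fun x hx y hy z hz a ha => ?_⟩
  exact (Cmp.ordConnected_holds a.1 a.2).out (hx a ha) (hy a ha) hz

variable (A)

/-- The clock values at which the edge `e` can be taken. -/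
def window (e : E) : Set ℝ≥0 :=
  {u | (A.inv (A.source e)).Sat u ∧ (A.guard e).Sat u ∧ (A.inv (A.target e)).Sat (A.clockAfter e u)}

/-- The state reached from `s` by the delay `τ` and the edge `e`. -/
noncomputable def nextState (s : L × ℝ≥0) (τ : ℝ≥0) (e : E) : L × ℝ≥0 :=
  (A.target e, A.clockAfter e (s.2 + τ))

variable {A}

theorem window_congr (e : E) {u v : ℝ≥0} (h : u ∈ A.region v) :
    u ∈ A.window e ↔ v ∈ A.window e :=
  and_congr (inv_sat_congr _ h) (and_congr (guard_sat_congr e h)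
    (inv_sat_congr _ (clockAfter_mem_region e h)))

theorem ordConnected_window (e : E) : (A.window e).OrdConnected := by
  refine ⟨fun x hx y hy z hz => ⟨?_, ?_, ?_⟩⟩
  · exact (Guard.ordConnected_sat _).out hx.1 hy.1 hz
  · exact (Guard.ordConnected_sat _).out hx.2.1 hy.2.1 hz
  · have h1 := hx.2.2
    have h2 := hy.2.2
    unfold clockAfter at *
    split_ifs at *
    · exact h1
    · exact (Guard.ordConnected_sat _).out h1 h2 hz

/-- Invariants define order-connected sets, so holding at both ends of the delay suffices.
Everything else depends only on the clock value at which the edge is taken, which is why windows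
replace steps from here on. -/
theorem step_iff {s s' : L × ℝ≥0} (hs : A.IsState s) {τ : ℝ≥0} {e : E} :
    A.Step s τ e s' ↔ A.source e = s.1 ∧ s.2 + τ ∈ A.window e ∧ s' = A.nextState s τ e := by
  constructor
  · rintro ⟨h1, h2, h3, h4, h5, h6⟩
    refine ⟨h1, ⟨?_, h3, ?_⟩, Prod.ext h4 h5⟩
    · rw [h1]; exact h2 τ le_rfl
    · rw [← h4, ← h5]; exact h6
  · rintro ⟨h1, ⟨h2, h3, h4⟩, rfl⟩
    refine ⟨h1, fun τ' hτ' => ?_, h3, rfl, rfl, h4⟩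
    rw [h1] at h2
    exact (Guard.ordConnected_sat _).out hs h2 ⟨le_self_add, by gcongr⟩

theorem Step.isState {s s' : L × ℝ≥0} {τ : ℝ≥0} {e : E} (h : A.Step s τ e s') : A.IsState s := by
  simpa [IsState] using h.inv_source 0 zero_le

theorem Step.isState_target {s s' : L × ℝ≥0} {τ : ℝ≥0} {e : E} (h : A.Step s τ e s') :
    A.IsState s' := h.inv_target

theorem mem_delaysOf {s : L × ℝ≥0} (hs : A.IsState s) {τ : ℝ≥0} {e : E} :
    τ ∈ A.delaysOf s e ↔ A.source e = s.1 ∧ s.2 + τ ∈ A.window e := by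
  simp [delaysOf, step_iff hs]

theorem mem_delays {s : L × ℝ≥0} (hs : A.IsState s) {τ : ℝ≥0} :
    τ ∈ A.delays s ↔ ∃ e, A.source e = s.1 ∧ s.2 + τ ∈ A.window e := by
  simp [delays, mem_delaysOf hs]

theorem mem_delays_congr {l : L} {v v' : ℝ≥0} (hs : A.IsState (l, v)) (hs' : A.IsState (l, v'))
    {τ τ' : ℝ≥0} (h : v' + τ' ∈ A.region (v + τ)) :
    τ' ∈ A.delays (l, v') ↔ τ ∈ A.delays (l, v) := by
  rw [mem_delays hs, mem_delays hs']
  exact exists_congr fun e => and_congr Iff.rfl (window_congr e h)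

variable (A)

/-- The delay `τ` from `s` leads to a constant only if this is so for all delays from `s`. -/
def ThickStep (s : L × ℝ≥0) (τ : ℝ≥0) : Prop :=
  s.2 + τ ∈ A.constPoints → ∀ τ' ∈ A.delays s, s.2 + τ' ∈ A.constPoints

variable {A}

/-- From states of the same region, the same regions can be reached by delays. -/
theorem exists_delay_mem_region [Finite L] [Finite E] {v v' u : ℝ≥0} (hv : v' ∈ A.region v)
    (hu : v ≤ u) : ∃ u' ∈ A.region u, v' ≤ u' := by
  by_cases h : v' ≤ u
  · exact ⟨u, A.mem_region_self u, h⟩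
  · refine ⟨v', ?_, le_rfl⟩
    have := (ordConnected_region v).out (A.mem_region_self v) hv ⟨hu, (not_le.1 h).le⟩
    exact mem_region_trans hv (mem_region_symm this)

/-- Any delay from `v'` can be matched by a delay from `v` into the same region, and conversely. A
non-constant alternative thus exists from both states or from neither. -/
theorem thickStep_congr [Finite L] [Finite E] {l : L} {v v' τ τ' : ℝ≥0} (hs : A.IsState (l, v))
    (hv : v' ∈ A.region v) (h : v' + τ' ∈ A.region (v + τ)) :
    A.ThickStep (l, v') τ' ↔ A.ThickStep (l, v) τ := by
  have key : ∀ {v v' τ τ' : ℝ≥0}, A.IsState (l, v) → v' ∈ A.region v →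
      v' + τ' ∈ A.region (v + τ) → A.ThickStep (l, v) τ → A.ThickStep (l, v') τ' := by
    intro v v' τ τ' hs hv h ht hc t ht'
    have hs' := (isState_congr l hv).2 hs
    obtain ⟨u', hu', hle⟩ := exists_delay_mem_region (mem_region_symm hv) (le_add_right (le_refl v') (c := t))
    have h1 := ht ((mem_constPoints_of_mem_region h).1 hc) (u' - v)
      ((mem_delays_congr hs' hs (τ := t) (τ' := u' - v)
        (by rwa [add_tsub_cancel_of_le hle])).2 ht')
    simp only [add_tsub_cancel_of_le hle] at h1
    exact (mem_constPoints_of_mem_region hu').1 h1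
  exact ⟨key ((isState_congr l hv).2 hs) (mem_region_symm hv) (mem_region_symm h), key hs hv h⟩

/-! ### Thin edges of the region automaton -/

theorem dimH_eq_one_of_Ioo_subset {S : Set ℝ≥0} {a b : ℝ≥0} (hab : a < b)
    (h : Set.Ioo a b ⊆ S) : dimH S = 1 := by
  rw [← (NNReal.isometry_coe).dimH_image]
  refine le_antisymm ((dimH_mono (Set.subset_univ _)).trans Real.dimH_univ.le) ?_
  have hab' : (a : ℝ) < b := hab
  have h1 : dimH (Set.Ioo (a : ℝ) b) = 1 := by
    rw [Real.dimH_of_nonempty_interior (by simpa using hab')]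
    simp
  rw [← h1]
  refine dimH_mono fun x hx => ?_
  have hx0 : 0 ≤ x := a.2.trans hx.1.le
  exact ⟨⟨x, hx0⟩, h ⟨hx.1, hx.2⟩, rfl⟩

/-- The delays from a state either contain an interval or lead only to constants. -/
theorem exists_Ico_subset_delays [Finite L] [Finite E] {s : L × ℝ≥0} (hs : A.IsState s) {τ : ℝ≥0}
    (hτ : τ ∈ A.delays s) (hK : s.2 + τ ∉ A.constPoints) :
    ∃ b, τ < b ∧ Set.Ico τ b ⊆ A.delays s := by
  have h1 : {t | s.2 + t ∈ A.region (s.2 + τ)} ∈ nhds τ :=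
    ((isOpen_region hK).preimage (by fun_prop : Continuous fun t => s.2 + t)).mem_nhds
      (A.mem_region_self _)
  obtain ⟨b, hb, h2⟩ := exists_Ico_subset_of_mem_nhds h1 ⟨τ + 1, by simp⟩
  exact ⟨b, hb, fun t ht => (mem_delays_congr (l := s.1) hs hs (h2 ht)).2 hτ⟩

theorem finite_setOf_add_mem_constPoints (A : TimedAutomaton L E) [Finite L] [Finite E] (v : ℝ≥0) :
    {τ : ℝ≥0 | v + τ ∈ A.constPoints}.Finite :=
  A.finite_constPoints.preimage (add_right_injective v).injOn

theorem RegionEdge.delaysOf_eq {f : A.RegionEdge} {v τ v' w : ℝ≥0}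
    (hstep : A.Step (f.src.1, v) τ f.edge (f.tgt.1, v'))
    (hguard : f.guardRegion = A.region (v + τ)) (htgt : f.tgt.2 = A.region v')
    (hw : w ∈ A.region v) : f.delaysOf w = {t | w + t ∈ A.region (v + τ)} := by
  have hs := hstep.isState
  have hs' := (isState_congr f.src.1 hw).2 hs
  obtain ⟨h1, h2, h3⟩ := (step_iff hs).1 hstep
  ext t
  simp only [RegionEdge.delaysOf, hguard, htgt, Set.mem_ofPred_eq]
  refine ⟨fun h => h.1, fun h => ⟨h, A.clockAfter f.edge (w + t), ?_, ?_⟩⟩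
  · have : v' = A.clockAfter f.edge (v + τ) := congrArg Prod.snd h3
    rw [this]
    exact clockAfter_mem_region _ h
  · rw [step_iff hs']
    refine ⟨h1, (window_congr _ h).2 h2, Prod.ext ?_ rfl⟩
    exact (congrArg Prod.fst h3 :)

theorem regionDelays_eq {l : L} {v w : ℝ≥0} (hw : w ∈ A.region v) :
    A.regionDelays (l, A.region v) w = A.delays (l, w) := by
  ext t
  simp only [regionDelays, Set.mem_iUnion, delays, RegionEdge.delaysOf, delaysOf, Set.mem_ofPred_eq]
  constructor
  · rintro ⟨f, hf, -, v', -, hstep⟩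
    rw [hf] at hstep
    exact ⟨f.edge, _, hstep⟩
  · rintro ⟨e, s', hstep⟩
    refine ⟨⟨(l, A.region v), A.region (w + t), e, (s'.1, A.region s'.2), w, t, s'.2, hstep,
      (region_eq_of_mem hw).symm, rfl, rfl⟩, rfl, A.mem_region_self _, s'.2,
      A.mem_region_self _, hstep⟩

/-- A delay set has dimension 1 once it contains an interval and 0 when it is finite. The delays of
`f` are those into its guard region: at most one if that is a constant, otherwise they contain an
interval. So `f` can be thin only at a constant guard with a non-constant alternative. By
`thickStep_congr` a single representative decides this for all states of the source. -/
theorem RegionEdge.not_thin_iff [Finite L] [Finite E] {f : A.RegionEdge} {v τ v' : ℝ≥0}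
    (hstep : A.Step (f.src.1, v) τ f.edge (f.tgt.1, v')) (hsrc : f.src.2 = A.region v)
    (hguard : f.guardRegion = A.region (v + τ)) (htgt : f.tgt.2 = A.region v') :
    ¬ f.Thin ↔ A.ThickStep (f.src.1, v) τ := by
  have hs := hstep.isState
  have hsrc' : f.src = (f.src.1, A.region v) := by rw [← hsrc]
  have hRD {w : ℝ≥0} (hw : w ∈ A.region v) :
      A.regionDelays f.src w = A.delays (f.src.1, w) := by
    rw [hsrc']; exact regionDelays_eq hw
  rw [not_iff_comm]
  constructor
  · intro h
    simp only [ThickStep, not_forall] at h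
    obtain ⟨hK, t, ht, htK⟩ := h
    refine ⟨v, hsrc ▸ A.mem_region_self v, ?_⟩
    rw [RegionEdge.delaysOf_eq hstep hguard htgt (A.mem_region_self v), hRD (A.mem_region_self v)]
    obtain ⟨b, hb, hsub⟩ := exists_Ico_subset_delays hs ht htK
    rw [dimH_eq_one_of_Ioo_subset hb (Set.Ioo_subset_Ico_self.trans hsub),
      region_of_mem_constPoints hK, dimH_subsingleton]
    · exact one_pos
    · intro x hx y hy
      exact add_left_cancel (hx.trans hy.symm)
  · rintro ⟨w, hw, hlt⟩ hthick
    rw [hsrc] at hw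
    rw [RegionEdge.delaysOf_eq hstep hguard htgt hw, hRD hw] at hlt
    obtain ⟨u, hu, hle⟩ := exists_delay_mem_region hw (le_add_right (le_refl v) (c := τ))
    have hwu : w + (u - w) = u := add_tsub_cancel_of_le hle
    by_cases hK : v + τ ∈ A.constPoints
    · have h2 := (thickStep_congr (τ := τ) (τ' := u - w) hs hw (by rwa [hwu])).2 hthick
        (by rw [hwu]; exact (mem_constPoints_of_mem_region hu).2 hK)
      rw [dimH_finite ((A.finite_setOf_add_mem_constPoints w).subset h2)] at hlt
      exact not_lt_zero hlt
    · have h1 : {t | w + t ∈ A.region (v + τ)} ∈ nhds (u - w) :=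
        ((isOpen_region hK).preimage (by fun_prop : Continuous fun t => w + t)).mem_nhds
          (by simpa [hwu] using hu)
      obtain ⟨b, hb, h2⟩ := exists_Ico_subset_of_mem_nhds h1 ⟨u - w + 1, by simp⟩
      rw [dimH_eq_one_of_Ioo_subset hb (Set.Ioo_subset_Ico_self.trans h2)] at hlt
      refine hlt.not_ge ?_
      rw [← (NNReal.isometry_coe).dimH_image]
      exact (dimH_mono (Set.subset_univ _)).trans Real.dimH_univ.le

/-- Adjacency in the thick graph in terms of steps of the automaton. -/
theorem thickAdj_of_step [Finite L] [Finite E] {s s' : L × ℝ≥0} {τ : ℝ≥0} {e : E}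
    (h : A.Step s τ e s') (ht : A.ThickStep s τ) : A.ThickAdj (A.toRegion s) (A.toRegion s') := by
  refine ⟨⟨A.toRegion s, A.region (s.2 + τ), e, A.toRegion s', s.2, τ, s'.2, h, rfl, rfl, rfl⟩,
    ?_, rfl, rfl⟩
  rwa [RegionEdge.not_thin_iff (v := s.2) (τ := τ) (v' := s'.2) h rfl rfl rfl]

/-- Every thick edge of the region automaton arises from a thick step. -/
theorem RegionEdge.exists_thickStep [Finite L] [Finite E] {f : A.RegionEdge} (hf : ¬ f.Thin) :
    ∃ (v τ v' : ℝ≥0), A.Step (f.src.1, v) τ f.edge (f.tgt.1, v') ∧ A.ThickStep (f.src.1, v) τ ∧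
      f.src = A.toRegion (f.src.1, v) ∧ f.guardRegion = A.region (v + τ) ∧
      f.tgt = A.toRegion (f.tgt.1, v') := by
  obtain ⟨v, τ, v', h1, h2, h3, h4⟩ := f.valid
  refine ⟨v, τ, v', h1, (RegionEdge.not_thin_iff h1 h2 h3 h4).1 hf, ?_, h3, ?_⟩
  · exact Prod.ext rfl h2
  · exact Prod.ext rfl h4

/-! ### Zeno components -/

/-- The bottom strongly connected component below a vertex with finitely many successors. -/
theorem exists_isBSCC (q : L × Set ℝ≥0) (hfin : {q' | A.ThickReach q q'}.Finite) :
    ∃ B, A.IsBSCC B ∧ ∃ q' ∈ B, A.ThickReach q q' := by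
  -- Take a reachable vertex whose own reachable set is smallest. Every vertex below it then reaches
  -- exactly the same set, which is therefore strongly connected and bottom.
  obtain ⟨q', hq', hmin⟩ := Set.exists_min_image {q' | A.ThickReach q q'}
    (fun q' => {q'' | A.ThickReach q' q''}.ncard) hfin ⟨q, Relation.ReflTransGen.refl⟩
  refine ⟨{q'' | A.ThickReach q' q''}, ⟨⟨q', Relation.ReflTransGen.refl⟩, ?_, ?_⟩, q',
    Relation.ReflTransGen.refl, hq'⟩
  · intro a ha b hb
    have hsub : {x | A.ThickReach a x} ⊆ {x | A.ThickReach q' x} := fun x hx => ha.trans hx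
    have hfin' : {x | A.ThickReach q' x}.Finite := hfin.subset fun x hx => hq'.trans hx
    have h := Set.eq_of_subset_of_ncard_le hsub (hmin a (hq'.trans ha)) hfin'
    exact (h.symm ▸ hb : b ∈ {x | A.ThickReach a x})
  · intro a ha b hb
    exact ha.tail hb

/-- A set of locations that in the region `r` of `v` is closed under thick edges without effective
reset gives rise to a Zeno component. -/
theorem exists_isZenoBSCC [Finite L] [Finite E] {v₀ : ℝ≥0} (S : Set L) {l₀ : L} (hl₀ : l₀ ∈ S)
    (hb : BddAbove (A.region v₀))
    (hcl : ∀ l ∈ S, ∀ v ∈ A.region v₀, ∀ τ e s', A.Step (l, v) τ e s' → A.ThickStep (l, v) τ →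
      s'.1 ∈ S ∧ s'.2 ∈ A.region v₀ ∧ (A.reset e → v + τ = 0)) :
    ∃ B, A.IsZenoBSCC B ∧ ∃ q ∈ B, A.ThickReach (l₀, A.region v₀) q := by
  have hreach : ∀ q, A.ThickReach (l₀, A.region v₀) q → q.1 ∈ S ∧ q.2 = A.region v₀ := by
    intro q hq
    induction hq with
    | refl => exact ⟨hl₀, rfl⟩
    | tail _ h ih =>
      obtain ⟨f, hf, rfl, rfl⟩ := h
      obtain ⟨v, τ, v', h1, h2, h3, h4, h5⟩ := RegionEdge.exists_thickStep hf
      have hv : v ∈ A.region v₀ := by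
        rw [← ih.2, h3]; exact A.mem_region_self v
      obtain ⟨h6, h7, -⟩ := hcl _ ih.1 v hv τ _ _ h1 h2
      refine ⟨h6, ?_⟩
      rw [h5]
      exact region_eq_of_mem h7
  obtain ⟨B, hB, q, hq, hq'⟩ := exists_isBSCC (A := A) (l₀, A.region v₀) (by
    -- The region component never changes along thick edges, so finiteness of the set of locations
    -- suffices.
    refine ((Set.toFinite (Set.univ : Set L)).prod (Set.finite_singleton (A.region v₀))).subset ?_
    exact fun q hq => ⟨trivial, (hreach q hq).2⟩)
  have hBr : ∀ q' ∈ B, A.ThickReach (l₀, A.region v₀) q' :=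
    fun q' h => hq'.trans (hB.connected q hq q' h)
  refine ⟨B, ⟨hB, fun q' h => (hreach q' (hBr q' h)).2 ▸ hb, ?_⟩, q, hq, hq'⟩
  intro f hf hfB hreset
  obtain ⟨v, τ, v', h1, h2, h3, h4, h5⟩ := RegionEdge.exists_thickStep hf
  have h6 := hreach _ (hBr _ hfB)
  have hv : v ∈ A.region v₀ := by
    rw [← h6.2, h3]; exact A.mem_region_self v
  rw [h4, (hcl _ h6.1 v hv τ _ _ h1 h2).2.2 hreset,
    region_of_mem_constPoints A.zero_mem_constPoints]

/-- Above all constants there is only the last region, which is unbounded. -/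
theorem exists_le_const_of_bddAbove_region {v : ℝ≥0} (h : BddAbove (A.region v)) :
    ∃ c ∈ A.constPoints, v ≤ c := by
  by_contra! hc
  obtain ⟨b, hb⟩ := h
  have h1 : v + b + 1 ∈ A.region v := by
    refine mem_region_of_forall_notMem (by rw [add_assoc]; exact le_self_add) ?_
    intro c hcc h1 _
    exact (hc c hcc).not_ge h1
  have h2 := hb h1
  have h3 : b < v + b + 1 := by
    have : b ≤ v + b := le_add_self
    exact this.trans_lt (lt_add_one _)
  exact h2.not_gt h3

/-- A sequence of thick steps inside a Zeno component has bounded total duration. -/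
theorem IsZenoBSCC.summable [Finite L] [Finite E] {B : Set (L × Set ℝ≥0)} (hB : A.IsZenoBSCC B)
    {σ : ℕ → L × ℝ≥0} {τ : ℕ → ℝ≥0} {e : ℕ → E}
    (hstep : ∀ n, A.Step (σ n) (τ n) (e n) (σ (n + 1))) (ht : ∀ n, A.ThickStep (σ n) (τ n))
    {m : ℕ} (hm : A.toRegion (σ m) ∈ B) : Summable τ := by
  have hmem : ∀ n, A.toRegion (σ (m + n)) ∈ B := by
    intro n
    induction n with
    | zero => exact hm
    | succ n ih => exact hB.bottom _ ih _ (thickAdj_of_step (hstep _) (ht _))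
  -- Inside the component a reset can occur only with guard region `{0}`, that is, when the clock is
  -- already `0`. So the clock always just accumulates the delays, and the partial sums of the
  -- delays are bounded by the largest constant.
  have hclock : ∀ n, (σ (m + n + 1)).2 = (σ (m + n)).2 + τ (m + n) := by
    intro n
    have h := hstep (m + n)
    rw [h.clock_eq, clockAfter]
    split_ifs with hr
    · have h2 := hB.no_reset ⟨A.toRegion (σ (m + n)), A.region ((σ (m + n)).2 + τ (m + n)), e (m + n),
        A.toRegion (σ (m + n + 1)), _, _, _, h, rfl, rfl, rfl⟩
        ((RegionEdge.not_thin_iff (v := (σ (m + n)).2) (τ := τ (m + n))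
          (v' := (σ (m + n + 1)).2) h rfl rfl rfl).2 (ht _)) (hmem n) hr
      have h3 := A.mem_region_self ((σ (m + n)).2 + τ (m + n))
      simp only at h2
      rw [h2] at h3
      exact h3.symm
    · rfl
  obtain ⟨b, hb⟩ := A.finite_constPoints.bddAbove
  have hle : ∀ n, (σ (m + n)).2 ≤ b := by
    intro n
    obtain ⟨c, hc, h⟩ := exists_le_const_of_bddAbove_region (hB.bounded _ (hmem n))
    exact h.trans (hb hc)
  have hsum : ∀ n, ∑ i ∈ Finset.range n, τ (i + m) + (σ m).2 = (σ (m + n)).2 := by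
    intro n
    induction n with
    | zero => simp
    | succ n ih =>
      rw [Finset.sum_range_succ, add_right_comm, ih, ← add_assoc, hclock, add_comm m n]
  rw [← NNReal.summable_nat_add_iff m]
  rw [← NNReal.summable_coe]
  refine summable_of_sum_range_le (c := b) (fun _ => NNReal.coe_nonneg _) fun n => ?_
  have := hsum n
  exact_mod_cast (le_self_add.trans (hsum n).le).trans (hle n)

end TimedAutomaton

/-! ### The law of the runs -/

theorem TimedAutomaton.measurableSet_delaysOf {L E : Type*} {A : TimedAutomaton L E} {s : L × ℝ≥0}
    (hs : A.IsState s) (e : E) : MeasurableSet (A.delaysOf s e) := by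
  have h : A.delaysOf s e = {t | A.source e = s.1 ∧ s.2 + t ∈ A.window e} := by
    ext t; exact mem_delaysOf hs
  rw [h]
  exact (MeasurableSet.const _).inter
    ((ordConnected_window e).measurableSet.preimage (by fun_prop : Measurable fun t => s.2 + t))

theorem TimedAutomaton.measurableSet_delays {L E : Type*} [Countable E] {A : TimedAutomaton L E}
    {s : L × ℝ≥0} (hs : A.IsState s) : MeasurableSet (A.delays s) :=
  MeasurableSet.iUnion fun e => measurableSet_delaysOf hs e

namespace StochasticTimedAutomaton

variable {L E : Type*} [Fintype L] [MeasurableSpace L] [DiscreteMeasurableSpace L]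
  [Fintype E] [MeasurableSpace E] [DiscreteMeasurableSpace E]
  (M : StochasticTimedAutomaton L E) (e₀ : E)

theorem moveKernel_apply (s : L × ℝ≥0) {G : Set ((L × ℝ≥0) × (ℝ≥0 × E))} (hG : MeasurableSet G) :
    M.moveKernel e₀ s G =
      ∫⁻ t, M.edgeLaw e₀ (s.1, s.2 + t) {e | (s, (t, e)) ∈ G} ∂(M.μ s) := by
  have h : MeasurableSet (Prod.mk s ⁻¹' G) := measurable_prodMk_left hG
  rw [moveKernel, Kernel.prod_apply, Kernel.id_apply, Measure.prod_apply hG]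
  rw [lintegral_dirac' _ (measurable_measure_prodMk_left hG), Kernel.compProd_apply h]
  rfl

theorem moveKernel_delay (s : L × ℝ≥0) {D : Set ℝ≥0} (hD : MeasurableSet D) :
    M.moveKernel e₀ s {x | x.2.1 ∈ D} = M.μ s D := by
  have hm : MeasurableSet {x : (L × ℝ≥0) × (ℝ≥0 × E) | x.2.1 ∈ D} :=
    hD.preimage (by fun_prop : Measurable fun x : (L × ℝ≥0) × (ℝ≥0 × E) => x.2.1)
  rw [moveKernel_apply _ _ _ hm, ← lintegral_indicator_one hD]
  refine lintegral_congr fun t => ?_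
  have := M.isProbabilityMeasure_edgeLaw e₀ (s.1, s.2 + t)
  by_cases ht : t ∈ D <;> simp [ht]

theorem enabled_iff_window {s : L × ℝ≥0} {t : ℝ≥0} {e : E} :
    M.Enabled (s.1, s.2 + t) e ↔ M.source e = s.1 ∧ s.2 + t ∈ M.window e := by
  rw [TimedAutomaton.enabled_iff]
  constructor
  · rintro ⟨h1, h2, h3, h4⟩
    exact ⟨h1, by rwa [h1], h3, h4⟩
  · rintro ⟨h1, h2, h3, h4⟩
    exact ⟨h1, by rwa [h1] at h2, h3, h4⟩

theorem edgeLaw_ne_enabled {s : L × ℝ≥0} (h : ∃ e, M.Enabled s e) :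
    M.edgeLaw e₀ s {e | ¬ M.Enabled s e} = 0 := by
  classical
  simp only [edgeLaw, h, if_true, Measure.finsetSum_apply, Measure.smul_apply, smul_eq_mul]
  refine Finset.sum_eq_zero fun e _ => ?_
  by_cases he : M.Enabled s e
  · simp [he]
  · simp [edgeProb, he]

theorem ae_mem_delays {s : L × ℝ≥0} (hs : M.IsState s) : ∀ᵐ t ∂(M.μ s), t ∈ M.delays s := by
  exact (prob_compl_eq_zero_iff (TimedAutomaton.measurableSet_delays hs)).2 (M.μ_delays s hs)

/-- A lower bound for the probability of choosing an enabled edge `e`. -/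
noncomputable def minProb (e : E) : ℝ≥0∞ := M.weight e / ∑ e', (M.weight e' : ℝ≥0∞)

theorem minProb_pos (e : E) : 0 < M.minProb e := by
  refine ENNReal.div_pos ?_ ?_
  · simpa using (M.weight_pos e).ne'
  · exact ENNReal.sum_ne_top.2 fun e _ => ENNReal.coe_ne_top

theorem minProb_le_edgeLaw {s : L × ℝ≥0} {e : E} (h : M.Enabled s e) :
    M.minProb e ≤ M.edgeLaw e₀ s {e} := by
  classical
  have h' : ∃ e, M.Enabled s e := ⟨e, h⟩
  simp only [edgeLaw, h', if_true, Measure.finsetSum_apply, Measure.smul_apply, smul_eq_mul]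
  refine le_trans ?_ (Finset.single_le_sum (f := fun i => M.edgeProb s i * Measure.dirac i {e})
    (fun _ _ => zero_le) (Finset.mem_univ e))
  simp only [edgeProb, h, if_true, minProb, enabledWeight, Measure.dirac_apply', 
    MeasurableSet.of_discrete, Set.indicator_of_mem, Set.mem_singleton, Pi.one_apply, mul_one]
  gcongr
  split_ifs
  · exact le_rfl
  · exact zero_le

/-- After each delay at which `e` can be taken, its conditional probability is at least its weight
divided by the total weight of all edges, whichever other edges are enabled. The bound is uniform in
the state, as fairness requires. -/
theorem minProb_mul_le_moveKernel {s : L × ℝ≥0} (hs : M.IsState s) {e : E}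
    {G : Set ((L × ℝ≥0) × (ℝ≥0 × E))} (hG : MeasurableSet G) :
    M.minProb e * M.μ s {t | t ∈ M.delaysOf s e ∧ (s, (t, e)) ∈ G} ≤ M.moveKernel e₀ s G := by
  rw [moveKernel_apply _ _ _ hG]
  have hm : MeasurableSet {t | t ∈ M.delaysOf s e ∧ (s, (t, e)) ∈ G} := by
    exact (TimedAutomaton.measurableSet_delaysOf hs e).inter
      (hG.preimage (by fun_prop : Measurable fun t : ℝ≥0 => (s, (t, e))))
  rw [← lintegral_indicator_const hm]
  refine lintegral_mono (Set.indicator_le fun t ht => ?_)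
  refine (M.minProb_le_edgeLaw e₀ (M.enabled_iff_window.2
    ((TimedAutomaton.mem_delaysOf hs).1 ht.1))).trans (measure_mono ?_)
  simpa using ht.2

theorem _root_.lebesgue_apply (S : Set ℝ≥0) : lebesgue S = volume ((↑) '' S : Set ℝ) :=
  (MeasurableEmbedding.subtype_coe measurableSet_Ici).comap_apply volume S

theorem _root_.lebesgue_finite {S : Set ℝ≥0} (hS : S.Finite) : lebesgue S = 0 := by
  rw [lebesgue_apply]
  exact (hS.image _).measure_zero _

theorem _root_.lebesgue_Ico_pos {a b : ℝ≥0} (h : a < b) : 0 < lebesgue (Set.Ico a b) := by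
  rw [lebesgue_apply]
  have hab : (a : ℝ) < b := h
  refine lt_of_lt_of_le ?_ (measure_mono (s := Set.Ico (a : ℝ) b) fun x hx => ?_)
  · simpa using hab
  · exact ⟨⟨x, a.2.trans hx.1⟩, ⟨hx.1, hx.2⟩, rfl⟩

theorem lebesgue_delays_pos {s : L × ℝ≥0} (hs : M.IsState s) {t : ℝ≥0} (ht : t ∈ M.delays s)
    (hK : s.2 + t ∉ M.constPoints) : 0 < lebesgue (M.delays s) := by
  obtain ⟨b, hb, hsub⟩ := TimedAutomaton.exists_Ico_subset_delays hs ht hK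
  exact (lebesgue_Ico_pos hb).trans_le (measure_mono hsub)

/-- If a delay leads to a non-constant, almost surely no constant is reached. -/
theorem ae_notMem_constPoints {s : L × ℝ≥0} (hs : M.IsState s) {t : ℝ≥0} (ht : t ∈ M.delays s)
    (hK : s.2 + t ∉ M.constPoints) : ∀ᵐ τ ∂(M.μ s), s.2 + τ ∉ M.constPoints := by
  have h1 := (M.μ_equiv_volume s hs (M.lebesgue_delays_pos hs ht hK)).1
  have h2 : lebesgue {τ | s.2 + τ ∈ M.constPoints} = 0 :=
    lebesgue_finite (M.finite_setOf_add_mem_constPoints s.2)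
  have h3 : M.μ s {τ | s.2 + τ ∈ M.constPoints} = 0 :=
    h1 (nonpos_iff_eq_zero.1 ((Measure.restrict_apply_le _ _).trans h2.le))
  rw [ae_iff]
  simpa using h3

/-- Almost surely a delay to a constant is drawn only if there is no other choice. -/
theorem ae_thickStep {s : L × ℝ≥0} (hs : M.IsState s) : ∀ᵐ t ∂(M.μ s), M.ThickStep s t := by
  by_cases h : ∀ t ∈ M.delays s, s.2 + t ∈ M.constPoints
  · exact Filter.Eventually.of_forall fun t _ => h
  · push Not at h
    obtain ⟨t, ht, hK⟩ := h
    filter_upwards [M.ae_notMem_constPoints hs ht hK] with t ht hK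
    exact absurd hK ht

/-- The delays that leave no alternative to constants or lead into the region of `u` have positive
probability. -/
theorem measure_region_pos {s : L × ℝ≥0} (hs : M.IsState s) {t : ℝ≥0} (ht : t ∈ M.delays s)
    (hthick : M.ThickStep s t) : 0 < M.μ s {τ | s.2 + τ ∈ M.region (s.2 + t)} := by
  by_cases hK : s.2 + t ∈ M.constPoints
  · have h0 : lebesgue (M.delays s) = 0 :=
      lebesgue_finite ((M.finite_setOf_add_mem_constPoints s.2).subset (hthick hK))
    have h1 := (M.μ_equiv_uniform s hs h0).2
    refine pos_iff_ne_zero.2 fun h => ?_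
    have h2 : uniformOn (M.delays s) {t} = 0 := 
      nonpos_iff_eq_zero.1 ((measure_mono (by simp [TimedAutomaton.mem_region_self])).trans (h1 h).le)
    rw [uniformOn_eq_zero_iff ((M.finite_setOf_add_mem_constPoints s.2).subset (hthick hK))] at h2
    have h3 : t ∈ M.delays s ∩ {t} := ⟨ht, rfl⟩
    rw [h2] at h3
    exact h3
  · have h1 := (M.μ_equiv_volume s hs (M.lebesgue_delays_pos hs ht hK)).2
    refine pos_iff_ne_zero.2 fun h => ?_
    have h2 := h1 h
    rw [Measure.restrict_apply' (TimedAutomaton.measurableSet_delays hs)] at h2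
    have hU : IsOpen {τ | s.2 + τ ∈ M.region (s.2 + t)} :=
      (TimedAutomaton.isOpen_region hK).preimage (by fun_prop : Continuous fun t => s.2 + t)
    obtain ⟨b, hb, h3⟩ := exists_Ico_subset_of_mem_nhds (hU.mem_nhds (M.mem_region_self _))
      ⟨t + 1, by simp⟩
    refine ((lebesgue_Ico_pos hb).trans_le (measure_mono (Set.subset_inter h3 ?_))).ne' h2
    intro x hx
    exact (TimedAutomaton.mem_delays_congr (l := s.1) hs hs (h3 hx)).2 ht

/-- Almost every delay is thick and leads to a value where some edge is enabled, and the edge law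
then charges only enabled edges. -/
theorem ae_moveKernel {s : L × ℝ≥0} (hs : M.IsState s) :
    ∀ᵐ x ∂(M.moveKernel e₀ s),
      x.1 = s ∧ M.Step s x.2.1 x.2.2 (M.next x) ∧ M.ThickStep s x.2.1 := by
  have hT : MeasurableSet {t : ℝ≥0 | M.ThickStep s t} := by
    have : MeasurableSet {t : ℝ≥0 | s.2 + t ∈ M.constPoints} :=
      (M.finite_setOf_add_mem_constPoints s.2).measurableSet
    exact this.imp (MeasurableSet.const _)
  have hG : MeasurableSet {x : (L × ℝ≥0) × (ℝ≥0 × E) |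
      x.1 = s ∧ x.2.1 ∈ M.delaysOf s x.2.2 ∧ M.ThickStep s x.2.1} := by
    refine ((measurableSet_singleton s).preimage measurable_fst).inter (.inter ?_
      (hT.preimage (by fun_prop)))
    have : {x : (L × ℝ≥0) × (ℝ≥0 × E) | x.2.1 ∈ M.delaysOf s x.2.2} =
        ⋃ e, {x | x.2.2 = e} ∩ {x | x.2.1 ∈ M.delaysOf s e} := by
      ext x; simp
    change MeasurableSet {x : (L × ℝ≥0) × (ℝ≥0 × E) | x.2.1 ∈ M.delaysOf s x.2.2}
    rw [this]
    exact MeasurableSet.iUnion fun e =>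
      ((MeasurableSet.of_discrete (s := {e})).preimage (by fun_prop)).inter
        ((TimedAutomaton.measurableSet_delaysOf hs e).preimage (by fun_prop))
  have h0 : M.moveKernel e₀ s {x | x.1 = s ∧ x.2.1 ∈ M.delaysOf s x.2.2 ∧
      M.ThickStep s x.2.1}ᶜ = 0 := by
    rw [moveKernel_apply _ _ _ hG.compl]
    rw [lintegral_eq_zero_iff' ?_]
    · filter_upwards [M.ae_mem_delays hs, M.ae_thickStep hs] with t ht ht'
      obtain ⟨e, he⟩ := (TimedAutomaton.mem_delays hs).1 ht
      refine measure_mono_null ?_ (M.edgeLaw_ne_enabled e₀ ⟨e, M.enabled_iff_window.2 he⟩)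
      intro e' he' hen
      exact he' ⟨rfl, (TimedAutomaton.mem_delaysOf hs).2 (M.enabled_iff_window.1 hen), ht'⟩
    · have := Kernel.measurable_kernel_prodMk_left' (η := M.edgeKernel e₀)
        (hG.compl.preimage (measurable_prodMk_left (x := s))) s
      exact this.aemeasurable
  filter_upwards [show _ ∈ ae _ from h0] with x hx
  obtain ⟨h1, ⟨s', h2⟩, h3⟩ := hx
  refine ⟨h1, ?_, h3⟩
  obtain ⟨ha, hb, hc⟩ := (TimedAutomaton.step_iff hs).1 h2
  refine (TimedAutomaton.step_iff hs).2 ⟨ha, hb, ?_⟩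
  rw [← h1]; rfl

/-! ### The Markov property -/

section law

variable [hE : Nonempty E] (s : L × ℝ≥0)

theorem runLaw_eq : M.runLaw s =
    Kernel.trajMeasure (X := fun _ => (L × ℝ≥0) × (ℝ≥0 × E)) (M.moveKernel hE.some s)
      (fun n => (M.moveKernel hE.some).comap
        (fun x : (i : Finset.Iic n) → (L × ℝ≥0) × (ℝ≥0 × E) =>
          M.next (x ⟨n, Finset.mem_Iic.2 le_rfl⟩))
        (M.measurable_next.comp (measurable_pi_apply _))) := dif_pos hE

instance : IsProbabilityMeasure (M.runLaw s) := by
  rw [runLaw_eq]; infer_instance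

theorem map_runLaw_zero : (M.runLaw s).map (fun x => x 0) = M.moveKernel hE.some s := by
  have h : (fun x : ℕ → (L × ℝ≥0) × (ℝ≥0 × E) => x 0) =
      (MeasurableEquiv.piUnique (fun _ : Finset.Iic 0 => (L × ℝ≥0) × (ℝ≥0 × E))) ∘
        Preorder.frestrictLe 0 := rfl
  rw [h, ← Measure.map_map (by fun_prop) (by fun_prop), runLaw_eq, Kernel.trajMeasure,
    Measure.map_comp _ _ (by fun_prop), Kernel.traj_map_frestrictLe, Kernel.partialTraj_self,
    Measure.id_comp, Measure.map_map (by fun_prop) (by fun_prop),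
    MeasurableEquiv.self_comp_symm, Measure.map_id]

/-- The law of the move at time `n + 1`, given the past. -/
theorem map_runLaw_succ (n : ℕ) :
    (M.runLaw s).map (fun x => (Preorder.frestrictLe (π := fun _ => (L × ℝ≥0) × (ℝ≥0 × E)) n x,
      x (n + 1))) =
    (M.runLaw s).map (Preorder.frestrictLe n) ⊗ₘ (M.moveKernel hE.some).comap
        (fun x : (i : Finset.Iic n) → (L × ℝ≥0) × (ℝ≥0 × E) =>
          M.next (x ⟨n, Finset.mem_Iic.2 le_rfl⟩))
        (M.measurable_next.comp (measurable_pi_apply _)) := by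
  rw [runLaw_eq]
  exact (Kernel.map_frestrictLe_trajMeasure_compProd_eq_map_trajMeasure
    (X := fun _ => (L × ℝ≥0) × (ℝ≥0 × E)) (a := n)).symm

/-- The Markov property tested on an event `T` of the past. It is the identity that characterises
the conditional expectations in `ae_frequently_mem`. -/
theorem runLaw_inter (n : ℕ) {T : Set (Finset.Iic n → (L × ℝ≥0) × (ℝ≥0 × E))}
    (hT : MeasurableSet T) {G : Set ((L × ℝ≥0) × (ℝ≥0 × E))} (hG : MeasurableSet G) :
    M.runLaw s (Preorder.frestrictLe n ⁻¹' T ∩ {x | x (n + 1) ∈ G}) =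
      ∫⁻ x in Preorder.frestrictLe n ⁻¹' T, M.moveKernel hE.some (M.next (x n)) G ∂(M.runLaw s) := by
  have h' := DFunLike.congr_fun (M.map_runLaw_succ s n) (T ×ˢ G)
  rw [Measure.map_apply (by fun_prop) (hT.prod hG), Measure.compProd_apply_prod hT hG,
    setLIntegral_map hT (Kernel.measurable_coe _ hG) (by fun_prop)] at h'
  exact h'

theorem runLaw_succ (n : ℕ) {G : Set ((L × ℝ≥0) × (ℝ≥0 × E))} (hG : MeasurableSet G) :
    M.runLaw s {x | x (n + 1) ∈ G} =
      ∫⁻ x, M.moveKernel hE.some (M.next (x n)) G ∂(M.runLaw s) := by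
  simpa using M.runLaw_inter s n MeasurableSet.univ hG

theorem ae_runLaw_succ (n : ℕ) {U : Set (((L × ℝ≥0) × (ℝ≥0 × E)) × ((L × ℝ≥0) × (ℝ≥0 × E)))}
    (hU : MeasurableSet U)
    (h : ∀ᵐ x ∂(M.runLaw s), ∀ᵐ z ∂(M.moveKernel hE.some (M.next (x n))), (x n, z) ∈ U) :
    ∀ᵐ x ∂(M.runLaw s), (x n, x (n + 1)) ∈ U := by
  let g : (Finset.Iic n → (L × ℝ≥0) × (ℝ≥0 × E)) × ((L × ℝ≥0) × (ℝ≥0 × E)) →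
    ((L × ℝ≥0) × (ℝ≥0 × E)) × ((L × ℝ≥0) × (ℝ≥0 × E)) :=
      fun y => (y.1 ⟨n, Finset.mem_Iic.2 le_rfl⟩, y.2)
  have hg : Measurable g := by fun_prop
  have h1 : ∀ᵐ y ∂((M.runLaw s).map (fun x => (Preorder.frestrictLe
      (π := fun _ => (L × ℝ≥0) × (ℝ≥0 × E)) n x, x (n + 1)))), g y ∈ U := by
    rw [map_runLaw_succ, Measure.ae_compProd_iff (hU.preimage hg)]
    refine (ae_map_iff (by fun_prop) ?_).2 h
    exact Kernel.measurable_kernel_prodMk_left (hU.preimage hg).compl (measurableSet_singleton 0)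
  have h2 := ae_of_ae_map (by fun_prop) h1
  exact h2

/-- The moves that are thick steps of the automaton. -/
def thickMoves : Set ((L × ℝ≥0) × (ℝ≥0 × E)) :=
  {x | M.Step x.1 x.2.1 x.2.2 (M.next x) ∧ M.ThickStep x.1 x.2.1}

/-- Only the thickness condition needs an argument. A move to a constant is thick iff no
non-constant `u ≥ v` lies in the window of an edge with the same source. The `v` admitting such a
`u` form a lower set, hence a measurable one. -/
theorem measurableSet_thickMoves : MeasurableSet M.thickMoves := by
  have h : M.thickMoves = ⋃ e, {x | x.2.2 = e} ∩ ({x | x.1.1 = M.source e} ∩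
      ({x | x.1.2 ∈ {v | (M.inv (M.source e)).Sat v}} ∩ ({x | x.1.2 + x.2.1 ∈ M.window e} ∩
      ({x | x.1.2 + x.2.1 ∈ M.constPoints}ᶜ ∪ {x | x.1.2 ∈ {v | ∃ u, v ≤ u ∧ u ∉ M.constPoints ∧
        ∃ e', M.source e' = M.source e ∧ u ∈ M.window e'}ᶜ})))) := by
    ext ⟨⟨l, v⟩, t, e⟩
    simp only [Set.mem_iUnion, Set.mem_inter_iff, Set.mem_ofPred_eq, Set.mem_union,
      Set.mem_compl_iff, exists_eq_left', thickMoves]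
    constructor
    · rintro ⟨h1, h2⟩
      have hs := h1.isState
      obtain ⟨h3, h4, -⟩ := (TimedAutomaton.step_iff hs).1 h1
      simp only at h3 h4
      refine ⟨h3.symm, ?_, h4, ?_⟩
      · rw [h3]; exact hs
      · by_cases hK : v + t ∈ M.constPoints
        · right
          rintro ⟨u, hvu, huK, e', he', hu⟩
          have h5 := h2 hK (u - v) ((TimedAutomaton.mem_delays hs).2
            ⟨e', he'.trans h3, by rwa [add_tsub_cancel_of_le hvu]⟩)
          rw [add_tsub_cancel_of_le hvu] at h5
          exact huK h5
        · exact Or.inl hK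
    · rintro ⟨rfl, h2, h3, h4⟩
      have hs : M.IsState (M.source e, v) := h2
      refine ⟨(TimedAutomaton.step_iff hs).2 ⟨rfl, h3, rfl⟩, fun hK t' ht' => ?_⟩
      obtain ⟨e', he', hu⟩ := (TimedAutomaton.mem_delays hs).1 ht'
      by_contra hK'
      exact (h4.resolve_left (not_not.2 hK)) ⟨_, le_self_add, hK', e', he', hu⟩
  rw [h]
  refine MeasurableSet.iUnion fun e => .inter ?_ (.inter ?_ (.inter ?_ (.inter ?_ (.union ?_ ?_))))
  · exact (MeasurableSet.of_discrete (s := {e})).preimage (by fun_prop)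
  · exact (MeasurableSet.of_discrete (s := {M.source e})).preimage (by fun_prop)
  · exact (TimedAutomaton.measurableSet_sat _).preimage (by fun_prop)
  · exact ((TimedAutomaton.ordConnected_window e).measurableSet).preimage (by fun_prop)
  · exact (M.finite_constPoints.measurableSet.preimage (by fun_prop)).compl
  · refine MeasurableSet.preimage (MeasurableSet.compl (Set.OrdConnected.measurableSet ?_))
      (by fun_prop)
    refine IsLowerSet.ordConnected ?_
    rintro a b hba ⟨u, hu, h⟩
    exact ⟨u, hba.trans hu, h⟩

variable {s}

/-- Almost every sequence of moves is a run with thick steps. -/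
theorem ae_runLaw (hs : M.IsState s) : ∀ᵐ x ∂(M.runLaw s),
    (x 0).1 = s ∧ ∀ n, (x (n + 1)).1 = M.next (x n) ∧ x n ∈ M.thickMoves := by
  have h0 : ∀ᵐ x ∂(M.runLaw s), (x 0).1 = s ∧ x 0 ∈ M.thickMoves := by
    have h : ∀ᵐ z ∂((M.runLaw s).map (fun x => x 0)), z.1 = s ∧ z ∈ M.thickMoves := by
      rw [map_runLaw_zero]
      filter_upwards [M.ae_moveKernel hE.some hs] with z hz
      obtain ⟨rfl, h1, h2⟩ := hz
      exact ⟨rfl, h1, h2⟩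
    exact ae_of_ae_map (f := fun x : ℕ → (L × ℝ≥0) × (ℝ≥0 × E) => x 0)
      (measurable_pi_apply 0).aemeasurable h
  have hstep : ∀ n, (∀ᵐ x ∂(M.runLaw s), x n ∈ M.thickMoves) →
      ∀ᵐ x ∂(M.runLaw s), (x (n + 1)).1 = M.next (x n) ∧ x (n + 1) ∈ M.thickMoves := by
    intro n hn
    refine M.ae_runLaw_succ s n (U := {y | y.2.1 = M.next y.1 ∧ y.2 ∈ M.thickMoves}) ?_ ?_
    · refine .inter ?_ (M.measurableSet_thickMoves.preimage (by fun_prop))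
      exact measurableSet_eq_fun (by fun_prop) (M.measurable_next.comp measurable_fst)
    · filter_upwards [hn] with x hx
      filter_upwards [M.ae_moveKernel hE.some hx.1.isState_target] with z hz
      obtain ⟨h1, h2, h3⟩ := hz
      exact ⟨h1, by rw [← h1] at h2 h3; exact ⟨h2, h3⟩⟩
  have hall : ∀ n, ∀ᵐ x ∂(M.runLaw s), x n ∈ M.thickMoves := by
    intro n
    induction n with
    | zero => exact h0.mono fun x hx => hx.2
    | succ n ih => exact (hstep n ih).mono fun x hx => hx.2
  filter_upwards [h0, ae_all_iff.2 hall, ae_all_iff.2 fun n => hstep n (hall n)] with x h1 h2 h3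
  exact ⟨h1.1, fun n => ⟨(h3 n).1, h2 n⟩⟩

/-- The law of the move at time `n` given the state at time `n`. -/
theorem runLaw_apply_eq_lintegral (hs : M.IsState s) (n : ℕ) {G : Set ((L × ℝ≥0) × (ℝ≥0 × E))}
    (hG : MeasurableSet G) : M.runLaw s {x | x n ∈ G} =
      ∫⁻ x, M.moveKernel hE.some (x n).1 G ∂(M.runLaw s) := by
  cases n with
  | zero =>
    have h : M.runLaw s {x | x 0 ∈ G} = (M.runLaw s).map (fun x => x 0) G :=
      (Measure.map_apply (measurable_pi_apply 0) hG).symm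
    rw [h, map_runLaw_zero, lintegral_congr_ae (g := fun _ => M.moveKernel hE.some s G)]
    · simp
    · filter_upwards [M.ae_runLaw hs] with x hx
      rw [hx.1]
  | succ n =>
    rw [runLaw_succ _ _ _ hG]
    refine lintegral_congr_ae ?_
    filter_upwards [M.ae_runLaw hs] with x hx
    rw [(hx.2 n).1]

/-- The conditional Borel–Cantelli lemma: a set of moves that infinitely often has a probability
bounded from below is hit infinitely often. -/
theorem ae_frequently_mem (hs : M.IsState s) {G : Set ((L × ℝ≥0) × (ℝ≥0 × E))}
    (hG : MeasurableSet G) : ∀ᵐ x ∂(M.runLaw s),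
      (∃ δ : ℝ≥0∞, 0 < δ ∧ ∃ᶠ n in Filter.atTop, δ ≤ M.moveKernel hE.some (x n).1 G) →
        ∃ᶠ n in Filter.atTop, x n ∈ G := by
  let ℱ : Filtration ℕ (inferInstance : MeasurableSpace (ℕ → (L × ℝ≥0) × (ℝ≥0 × E))) :=
    Filtration.piLE (X := fun _ => (L × ℝ≥0) × (ℝ≥0 × E))
  have hmeas : ∀ n, MeasurableSet[ℱ n] {x : ℕ → (L × ℝ≥0) × (ℝ≥0 × E) | x n ∈ G} := by
    intro n
    rw [Filtration.piLE_eq_comap_frestrictLe]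
    exact ⟨{y | y ⟨n, Finset.mem_Iic.2 le_rfl⟩ ∈ G}, hG.preimage (measurable_pi_apply _), rfl⟩
  -- Lévy's form of the lemma: up to a null set, the events happen infinitely often exactly when the
  -- sum of their conditional probabilities given the past diverges. By the Markov property the
  -- latter are values of `moveKernel`.
  have h1 := ae_mem_limsup_atTop_iff (ℱ := ℱ) (M.runLaw s) hmeas
  have h2 : ∀ n, (M.runLaw s)[({x : ℕ → (L × ℝ≥0) × (ℝ≥0 × E) | x (n + 1) ∈ G}.indicator 1 :
      _ → ℝ) | ℱ n] =ᵐ[M.runLaw s] fun x => (M.moveKernel hE.some (M.next (x n)) G).toReal := by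
    intro n
    have hev : Measurable[ℱ n] fun x : ℕ → (L × ℝ≥0) × (ℝ≥0 × E) => x n := by
      rw [Filtration.piLE_eq_comap_frestrictLe]
      exact (measurable_pi_apply (X := fun _ : Finset.Iic n => (L × ℝ≥0) × (ℝ≥0 × E))
        ⟨n, Finset.mem_Iic.2 le_rfl⟩).comp (comap_measurable _)
    have hm : Measurable[ℱ n] fun x : ℕ → (L × ℝ≥0) × (ℝ≥0 × E) =>
        (M.moveKernel hE.some (M.next (x n)) G).toReal :=
      ((Kernel.measurable_coe _ hG).comp (M.measurable_next.comp hev)).ennreal_toReal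
    have hle := ℱ.le n
    have hset : MeasurableSet {x : ℕ → (L × ℝ≥0) × (ℝ≥0 × E) | x (n + 1) ∈ G} :=
      hG.preimage (measurable_pi_apply _)
    refine (ae_eq_condExp_of_forall_setIntegral_eq hle ?_ ?_ ?_ ?_).symm
    · exact (integrable_const (1 : ℝ)).indicator hset
    · intro A _ _
      refine Integrable.integrableOn (Integrable.of_bound (C := 1)
        (hm.mono hle le_rfl).aestronglyMeasurable (Filter.Eventually.of_forall fun x => ?_))
      rw [Real.norm_of_nonneg ENNReal.toReal_nonneg]
      exact ENNReal.toReal_le_of_le_ofReal zero_le_one (by simpa using prob_le_one)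
    · intro A hA _
      rw [Filtration.piLE_eq_comap_frestrictLe] at hA
      obtain ⟨T, hT, rfl⟩ := hA
      have hT' : MeasurableSet (Preorder.frestrictLe
          (π := fun _ => (L × ℝ≥0) × (ℝ≥0 × E)) n ⁻¹' T) := hT.preimage (by fun_prop)
      have hm' : Measurable fun x : ℕ → (L × ℝ≥0) × (ℝ≥0 × E) =>
          M.moveKernel hE.some (M.next (x n)) G :=
        (Kernel.measurable_coe _ hG).comp (M.measurable_next.comp (hev.mono hle le_rfl))
      rw [integral_toReal hm'.aemeasurable
        (Filter.Eventually.of_forall fun x => measure_lt_top _ _), ← runLaw_inter M s n hT hG,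
        setIntegral_indicator hset]
      simp [Measure.real]
    · exact hm.aestronglyMeasurable
  filter_upwards [h1, ae_all_iff.2 h2, M.ae_runLaw hs] with x hx1 hx2 hx3
  rintro ⟨δ, hδ, hfreq⟩
  refine Filter.mem_limsup_iff_frequently_mem.1 (hx1.2 ?_)
  simp only [hx2]
  by_contra hcon
  have hsum : Summable fun k => (M.moveKernel hE.some (M.next (x k)) G).toReal := by
    by_contra h
    exact hcon ((not_summable_iff_tendsto_nat_atTop_of_nonneg fun _ => ENNReal.toReal_nonneg).1 h)
  -- `δ` may be `∞`, which `toReal` sends to `0`; truncating at `1` keeps the real bound positive.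
  have hδ' : 0 < (min δ 1).toReal := ENNReal.toReal_pos (by simp [hδ.ne']) (by simp)
  have hev := hsum.tendsto_atTop_zero.eventually_lt_const hδ'
  -- Lévy's lemma speaks of the move at time `n + 1` given time `n`. Since the state at `n + 1` is
  -- `M.next (x n)`, the hypothesis is shifted by one.
  have hfreq' : ∃ᶠ n in Filter.atTop, δ ≤ M.moveKernel hE.some (M.next (x n)) G := by
    rw [Filter.frequently_atTop] at hfreq ⊢
    intro a
    obtain ⟨b, hb, hb'⟩ := hfreq (a + 1)
    obtain ⟨c, rfl⟩ : ∃ c, b = c + 1 := ⟨b - 1, by omega⟩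
    exact ⟨c, by omega, by rwa [(hx3.2 c).1] at hb'⟩
  obtain ⟨n, hn1, hn2⟩ := (hfreq'.and_eventually hev).exists
  refine hn2.not_ge (ENNReal.toReal_mono (measure_ne_top _ _) ((min_le_left _ _).trans hn1))

end law

end StochasticTimedAutomaton

/-! ### Zeno runs have converging clock values -/

-- With `v` the clock and `R` the resets: if the clock vanishes infinitely often, it is bounded
-- afterwards by a tail of the convergent sum and tends to `0`. Otherwise there are no resets from
-- some point on, and the clock increases to its limit, which it either attains infinitely often or
-- stays strictly below.
open Filter Topology in
theorem exists_limit_of_summable {v τ : ℕ → ℝ≥0} {R : ℕ → Prop} (h0 : ∀ n, R n → v (n + 1) = 0)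
    (h1 : ∀ n, ¬ R n → v (n + 1) = v n + τ n) (hτ : Summable τ) :
    ∃ u, Tendsto v atTop (𝓝 u) ∧
      ((∃ᶠ n in atTop, v n = u) ∨ ∀ᶠ n in atTop, v n < u ∧ ¬ R n) := by
  have hle : ∀ m n, v (m + n) ≤ v m + ∑ i ∈ Finset.range n, τ (i + m) := by
    intro m n
    induction n with
    | zero => simp
    | succ n ih =>
      rw [Finset.sum_range_succ, ← add_assoc, ← add_assoc]
      by_cases hR : R (m + n)
      · rw [h0 _ hR]; exact zero_le
      · rw [h1 _ hR, add_comm n m]; gcongr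
  by_cases hz : ∃ᶠ n in atTop, v n = 0
  · refine ⟨0, ?_, Or.inl hz⟩
    have htail := NNReal.tendsto_sum_nat_add τ
    refine tendsto_order.2 ⟨fun a ha => absurd ha not_lt_zero, fun a ha => ?_⟩
    obtain ⟨m, hm, hm0⟩ := (hz.and_eventually (htail.eventually_lt_const ha)).exists
    filter_upwards [eventually_ge_atTop m] with n hn
    obtain ⟨k, rfl⟩ := Nat.exists_eq_add_of_le hn
    refine ((hle m k).trans ?_).trans_lt hm0
    rw [hm, zero_add]
    exact ((NNReal.summable_nat_add_iff m).2 hτ).sum_le_tsum _ fun _ _ => zero_le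
  · rw [not_frequently, eventually_atTop] at hz
    obtain ⟨N, hN⟩ := hz
    have hR : ∀ n ≥ N, ¬ R n := fun n hn h => hN (n + 1) (by omega) (h0 n h)
    have heq : ∀ n, v (n + N) = v N + ∑ i ∈ Finset.range n, τ (i + N) := by
      intro n
      induction n with
      | zero => simp
      | succ n ih =>
        rw [Finset.sum_range_succ, ← add_assoc, ← ih, add_right_comm, h1 _ (hR _ (by omega))]
    have hlim : Tendsto v atTop (𝓝 (v N + ∑' i, τ (i + N))) := by
      rw [← tendsto_add_atTop_iff_nat N]
      simp only [heq]
      exact ((NNReal.summable_nat_add_iff N).2 hτ).hasSum.tendsto_sum_nat.const_add _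
    refine ⟨_, hlim, or_iff_not_imp_left.2 fun hne => ?_⟩
    rw [not_frequently] at hne
    filter_upwards [hne, eventually_ge_atTop N] with n hn hnN
    refine ⟨lt_of_le_of_ne ?_ hn, hR n hnN⟩
    obtain ⟨k, rfl⟩ := Nat.exists_eq_add_of_le' hnN
    rw [heq]
    gcongr
    exact ((NNReal.summable_nat_add_iff N).2 hτ).sum_le_tsum _ fun _ _ => zero_le

theorem Filter.Frequently.exists_of_finite {α ι : Type*} [Finite ι] {l : Filter α}
    {p : α → ι → Prop} (h : ∃ᶠ a in l, ∃ i, p a i) : ∃ i, ∃ᶠ a in l, p a i := by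
  by_contra! hc
  refine h ?_
  filter_upwards [Filter.eventually_all.2 hc] with a ha ⟨i, hi⟩
  exact ha i hi

/-! ### Fair runs: a fair thick Zeno run reaches a Zeno component -/

namespace StochasticTimedAutomaton

open Filter Topology

variable {L E : Type*} [Fintype L] [MeasurableSpace L] [DiscreteMeasurableSpace L]
  [Fintype E] [MeasurableSpace E] [DiscreteMeasurableSpace E]
  {M : StochasticTimedAutomaton L E} [hE : Nonempty E] {s : L × ℝ≥0}

/-- A run along which every set `G` of moves from a suitable countable family is hit infinitely
often if its probability is infinitely often bounded from below. -/
structure FairRun (ρ : M.Run s) : Prop where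
  delay_mem (k : ℕ) : (∃ δ : ℝ≥0∞, 0 < δ ∧ ∃ᶠ n in atTop,
      δ ≤ M.moveKernel hE.some (ρ.state n) {x | x.2.1 ∈ Set.Icc ((k : ℝ≥0) + 1)⁻¹ (k + 2)}) →
    ∃ᶠ n in atTop, ρ.delay n ∈ Set.Icc ((k : ℝ≥0) + 1)⁻¹ (k + 2)
  edge_mem (e : E) : (∃ δ : ℝ≥0∞, 0 < δ ∧ ∃ᶠ n in atTop,
      δ ≤ M.moveKernel hE.some (ρ.state n) {x | x.2.2 = e}) → ∃ᶠ n in atTop, ρ.edge n = e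
  edge_mem_const (c : ℕ) (e : E) : (∃ δ : ℝ≥0∞, 0 < δ ∧ ∃ᶠ n in atTop,
      δ ≤ M.moveKernel hE.some (ρ.state n) {x | x.1.2 = c ∧ x.2.2 = e}) →
    ∃ᶠ n in atTop, (ρ.state n).2 = c ∧ ρ.edge n = e

/-- Almost every sequence of moves comes from a fair run with thick steps. -/
theorem ae_exists_fairRun (hs : M.IsState s) : ∀ᵐ x ∂(M.runLaw s),
    ∃ ρ : M.Run s, M.runSeq ρ = x ∧ (∀ n, M.ThickStep (ρ.state n) (ρ.delay n)) ∧ FairRun ρ := by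
  have hm1 (k : ℕ) : MeasurableSet {x : (L × ℝ≥0) × (ℝ≥0 × E) |
      x.2.1 ∈ Set.Icc ((k : ℝ≥0) + 1)⁻¹ (k + 2)} :=
    measurableSet_Icc.preimage (by fun_prop)
  have hm2 (e : E) : MeasurableSet {x : (L × ℝ≥0) × (ℝ≥0 × E) | x.2.2 = e} :=
    (MeasurableSet.of_discrete (s := {e})).preimage (by fun_prop)
  have hm3 (c : ℕ) (e : E) : MeasurableSet {x : (L × ℝ≥0) × (ℝ≥0 × E) | x.1.2 = c ∧ x.2.2 = e} :=
    ((measurableSet_singleton (c : ℝ≥0)).preimage (by fun_prop)).inter (hm2 e)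
  filter_upwards [M.ae_runLaw hs, ae_all_iff.2 fun k => M.ae_frequently_mem hs (hm1 k),
    ae_all_iff.2 fun e => M.ae_frequently_mem hs (hm2 e),
    ae_all_iff.2 fun c => ae_all_iff.2 fun e => M.ae_frequently_mem hs (hm3 c e)] with x h1 h2 h3 h4
  refine ⟨⟨fun n => (x n).1, fun n => (x n).2.1, fun n => (x n).2.2, h1.1, fun n => ?_⟩, rfl,
    fun n => (h1.2 n).2.2, h2, h3, h4⟩
  rw [(h1.2 n).1]
  exact (h1.2 n).2.1

/-- A thick run, as exists from every state. -/
theorem exists_thick_run (hs : M.IsState s) :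
    ∃ ρ : M.Run s, ∀ n, M.ThickStep (ρ.state n) (ρ.delay n) := by
  obtain ⟨x, ρ, -, h, -⟩ := (ae_exists_fairRun hs).exists
  exact ⟨ρ, h⟩

variable {ρ : M.Run s}

theorem thickReach_state (hthick : ∀ n, M.ThickStep (ρ.state n) (ρ.delay n)) (n : ℕ) :
    M.ThickReach (M.toRegion s) (M.toRegion (ρ.state n)) := by
  induction n with
  | zero => rw [ρ.start]; exact Relation.ReflTransGen.refl
  | succ n ih => exact ih.tail (TimedAutomaton.thickAdj_of_step (ρ.step n) (hthick n))

/-- If `I(s)` is null, it is finite and `t` is an atom of the uniform law. Otherwise removing the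
single delay `0` leaves positive Lebesgue measure. -/
theorem measure_Ioi_zero_pos {s : L × ℝ≥0} (hs : M.IsState s) {t : ℝ≥0} (ht : t ∈ M.delays s)
    (ht0 : t ≠ 0) : 0 < M.μ s (Set.Ioi 0) := by
  refine pos_iff_ne_zero.2 fun h => ?_
  rcases eq_or_ne (lebesgue (M.delays s)) 0 with h0 | h0
  · have hfin : (M.delays s).Finite := by
      refine (M.finite_setOf_add_mem_constPoints s.2).subset fun t ht => ?_
      by_contra hK
      exact (M.lebesgue_delays_pos hs ht hK).ne' h0
    have h1 := (M.μ_equiv_uniform s hs h0).2 h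
    rw [uniformOn_eq_zero_iff hfin] at h1
    have h2 : t ∈ M.delays s ∩ Set.Ioi 0 := ⟨ht, pos_iff_ne_zero.2 ht0⟩
    rw [h1] at h2
    exact h2
  · have h1 := (M.μ_equiv_volume s hs (pos_iff_ne_zero.2 h0)).2 h
    rw [Measure.restrict_apply' (TimedAutomaton.measurableSet_delays hs)] at h1
    refine h0 (nonpos_iff_eq_zero.1 ?_)
    calc lebesgue (M.delays s) ≤ lebesgue ((Set.Ioi 0 ∩ M.delays s) ∪ {0}) := by
          refine measure_mono fun x hx => ?_
          rcases eq_or_ne x 0 with rfl | hx0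
          · exact Or.inr rfl
          · exact Or.inl ⟨pos_iff_ne_zero.2 hx0, hx⟩
      _ ≤ lebesgue (Set.Ioi 0 ∩ M.delays s) + lebesgue {0} := measure_union_le _ _
      _ = 0 := by rw [h1, lebesgue_finite (Set.finite_singleton _), add_zero]

/-- If the clock converges to `u` along a fair Zeno run, then no time can pass in the limit states
of the run. -/
theorem FairRun.delays_subset (hM : M.Dagger) (hf : FairRun ρ) {u : ℝ≥0}
    (hv : Tendsto (fun n => (ρ.state n).2) atTop (𝓝 u)) (hτ : Tendsto ρ.delay atTop (𝓝 0))
    {l : L} (hl : ∃ᶠ n in atTop, (ρ.state n).1 = l) (hlu : M.IsState (l, u)) :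
    M.delays (l, u) ⊆ {0} := by
  intro t ht
  by_contra ht0
  have hpos := measure_Ioi_zero_pos hlu ht ht0
  -- Countably many nondegenerate compact intervals exhaust the positive delays, so one of them has
  -- positive mass at `(l, u)`. Continuity of its measure bounds it below along the visits to `l`,
  -- and fairness then yields infinitely many delays at least `1 / (k + 1)`, contradicting
  -- convergence of the delays to `0`.
  have hU : Set.Ioi (0 : ℝ≥0) = ⋃ k : ℕ, Set.Icc ((k : ℝ≥0) + 1)⁻¹ (k + 2) := by
    ext x
    simp only [Set.mem_Ioi, Set.mem_iUnion, Set.mem_Icc]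
    constructor
    · intro hx
      obtain ⟨k, hk⟩ := exists_nat_ge (max x x⁻¹)
      refine ⟨k, ?_, (le_max_left _ _).trans (hk.trans le_self_add)⟩
      rw [inv_le_comm₀ (by positivity) hx]
      exact (le_max_right _ _).trans (hk.trans le_self_add)
    · rintro ⟨k, hk, -⟩
      exact lt_of_lt_of_le (by positivity) hk
  rw [hU] at hpos
  obtain ⟨k, hk⟩ : ∃ k : ℕ, 0 < M.μ (l, u) (Set.Icc ((k : ℝ≥0) + 1)⁻¹ (k + 2)) := by
    by_contra! h
    exact hpos.ne' (measure_iUnion_null fun k => nonpos_iff_eq_zero.1 (h k))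
  obtain ⟨δ, hδ, hδk⟩ := exists_between hk
  have hlt : ((k : ℝ≥0) + 1)⁻¹ < k + 2 := by
    refine (inv_le_one_of_one_le₀ (by simp)).trans_lt ?_
    have : (0 : ℝ≥0) ≤ k := zero_le
    calc (1 : ℝ≥0) < 2 := by norm_num
      _ ≤ k + 2 := le_add_self
  have hcont := ((hM.continuous_μ l _ _ hlt) u hlu).eventually (lt_mem_nhds hδk)
  have hev : ∀ᶠ n in atTop, (ρ.state n).1 = l →
      δ ≤ M.μ (ρ.state n) (Set.Icc ((k : ℝ≥0) + 1)⁻¹ (k + 2)) := by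
    filter_upwards [hv.eventually (eventually_nhdsWithin_iff.1 hcont)] with n hn hnl
    have heq : ρ.state n = (l, (ρ.state n).2) := Prod.ext hnl rfl
    have h1 := hn (heq ▸ (ρ.step n).isState)
    rw [heq]
    exact h1.le
  have hfreq := hf.delay_mem k ⟨δ, hδ, (hl.and_eventually hev).mono fun n hn => by
    rw [moveKernel_delay _ _ _ measurableSet_Icc]
    exact hn.2 hn.1⟩
  have hsmall : ∀ᶠ n in atTop, ρ.delay n < ((k : ℝ≥0) + 1)⁻¹ :=
    hτ.eventually_lt_const (by positivity)
  obtain ⟨n, hn1, hn2⟩ := (hfreq.and_eventually hsmall).exists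
  exact hn2.not_ge hn1.1

/-- Non-blocking makes `0` a delay; at a non-constant value it would come with a whole interval of
delays. -/
theorem mem_constPoints_of_delays_subset {s : L × ℝ≥0} (hs : M.IsState s)
    (h : M.delays s ⊆ {0}) : s.2 ∈ M.constPoints ∧ 0 ∈ M.delays s := by
  obtain ⟨t, ht⟩ := M.nonBlocking s hs
  obtain rfl : t = 0 := h ht
  refine ⟨?_, ht⟩
  by_contra hK
  obtain ⟨b, hb, hsub⟩ := TimedAutomaton.exists_Ico_subset_delays hs ht (by simpa using hK)
  obtain ⟨c, hc0, hcb⟩ := exists_between hb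
  exact hc0.ne' (h (hsub ⟨hc0.le, hcb⟩))

/-- A fair Zeno run whose clock attains its limit infinitely often reaches a Zeno component. -/
theorem FairRun.exists_isZenoBSCC_of_frequently (hM : M.Dagger) (hf : FairRun ρ) {u : ℝ≥0}
    (hv : Tendsto (fun n => (ρ.state n).2) atTop (𝓝 u)) (hτ : Tendsto ρ.delay atTop (𝓝 0))
    (hu : ∃ᶠ n in atTop, (ρ.state n).2 = u) :
    ∃ B, M.IsZenoBSCC B ∧ ∃ q ∈ B, ∃ n, M.ThickReach (M.toRegion (ρ.state n)) q := by
  obtain ⟨l₀, hl₀⟩ : ∃ l, ∃ᶠ n in atTop, ρ.state n = (l, u) :=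
    Filter.Frequently.exists_of_finite (hu.mono fun n hn => ⟨_, Prod.ext rfl hn⟩)
  have hdel : ∀ l, (∃ᶠ n in atTop, ρ.state n = (l, u)) →
      M.IsState (l, u) ∧ M.delays (l, u) ⊆ {0} := by
    intro l hl
    obtain ⟨n, hn⟩ := hl.exists
    have hs : M.IsState (l, u) := hn ▸ (ρ.step n).isState
    exact ⟨hs, hf.delays_subset hM hv hτ (hl.mono fun n hn => by rw [hn]) hs⟩
  have huK : u ∈ M.constPoints :=
    (mem_constPoints_of_delays_subset (hdel l₀ hl₀).1 (hdel l₀ hl₀).2).1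
  have hreg : M.region u = {u} := TimedAutomaton.region_of_mem_constPoints huK
  -- The region is `{u}`, and the closed set consists of the locations visited infinitely often with
  -- clock value exactly `u`.
  obtain ⟨B, hB, q, hq, hq'⟩ := TimedAutomaton.exists_isZenoBSCC (A := M.toTimedAutomaton)
    (v₀ := u) {l | ∃ᶠ n in atTop, ρ.state n = (l, u)} hl₀ (hreg ▸ bddAbove_singleton) (by
      intro l hl v hv' τ e s' hstep _
      rw [hreg] at hv' ⊢
      obtain rfl : v = u := hv'
      obtain ⟨hs, hsub⟩ := hdel l hl
      obtain rfl : τ = 0 := hsub (Set.mem_iUnion.2 ⟨e, s', hstep⟩)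
      -- The only possible delay is `0` and `e` is enabled after it, so each visit chooses `e` with
      -- probability at least `M.minProb e`.
      have hμ : M.μ (l, v) {t | t ∈ M.delaysOf (l, v) e ∧ ((l, v), (t, e)) ∈
          {x : (L × ℝ≥0) × (ℝ≥0 × E) | x.1.2 = v ∧ x.2.2 = e}} = 1 := by
        refine le_antisymm prob_le_one ((M.μ_delays _ hs).symm.le.trans (measure_mono ?_))
        intro t ht
        obtain rfl : t = 0 := hsub ht
        exact ⟨⟨s', hstep⟩, rfl, rfl⟩
      have hG : MeasurableSet {x : (L × ℝ≥0) × (ℝ≥0 × E) | x.1.2 = v ∧ x.2.2 = e} :=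
        ((measurableSet_singleton v).preimage (by fun_prop)).inter
          ((MeasurableSet.of_discrete (s := {e})).preimage (by fun_prop))
      have hle := M.minProb_mul_le_moveKernel hE.some hs (e := e) hG
      rw [hμ, mul_one] at hle
      -- As `u` is a natural number, the event "`e` is taken with clock value `u`" belongs to the
      -- countable family of `FairRun`.
      obtain ⟨c, -, rfl⟩ := huK
      have hfe := hf.edge_mem_const c e ⟨_, M.minProb_pos e, hl.mono fun n hn => by
        rw [hn]; exact hle⟩
      have hsrc : M.source e = l := hstep.source_eq
      have hnext : ∃ᶠ n in atTop, ρ.state (n + 1) = s' := by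
        refine hfe.mono fun n hn => ?_
        have hst := ρ.step n
        have heq : ρ.state n = (l, (c : ℝ≥0)) := by
          refine Prod.ext ?_ hn.1
          rw [← hst.source_eq, hn.2, hsrc]
        rw [heq, hn.2] at hst
        have h0 : ρ.delay n = 0 := hsub (Set.mem_iUnion.2 ⟨e, _, hst⟩)
        rw [h0] at hst
        rw [((TimedAutomaton.step_iff hs).1 hst).2.2, ((TimedAutomaton.step_iff hs).1 hstep).2.2]
      -- The target is visited infinitely often and the clock converges, so its clock value must be
      -- the limit. In particular a reset is possible only if the limit is `0`.
      have hs'u : s'.2 = c := by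
        by_contra hne
        have h1 := ((tendsto_add_atTop_iff_nat 1).2 hv).eventually_ne (Ne.symm hne)
        obtain ⟨n, hn1, hn2⟩ := (hnext.and_eventually h1).exists
        exact hn2 (by rw [hn1])
      refine ⟨?_, hs'u, fun hr => ?_⟩
      · have h1 : ∃ᶠ n in atTop, ρ.state (n + 1) = (s'.1, (c : ℝ≥0)) := by
          rw [← hs'u]; exact hnext
        change ∃ᶠ n in atTop, ρ.state n = (s'.1, (c : ℝ≥0))
        rw [Filter.frequently_atTop] at h1 ⊢
        intro a
        obtain ⟨b, hb, hb'⟩ := h1 a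
        exact ⟨b + 1, by omega, hb'⟩
      · have h1 := hstep.clock_eq
        rw [hs'u, TimedAutomaton.clockAfter, if_pos hr] at h1
        change (c : ℝ≥0) + 0 = 0
        rw [h1, add_zero])
  obtain ⟨n, hn⟩ := hl₀.exists
  exact ⟨B, hB, q, hq, n, by rw [hn]; exact hq'⟩

/-- A fair Zeno run whose clock stays below its limit reaches a Zeno component. -/
theorem FairRun.exists_isZenoBSCC_of_eventually (hM : M.Dagger) (hf : FairRun ρ) {u : ℝ≥0}
    (hv : Tendsto (fun n => (ρ.state n).2) atTop (𝓝 u)) (hτ : Tendsto ρ.delay atTop (𝓝 0))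
    (hu : ∀ᶠ n in atTop, (ρ.state n).2 < u ∧ ¬ M.reset (ρ.edge n)) :
    ∃ B, M.IsZenoBSCC B ∧ ∃ q ∈ B, ∃ n, M.ThickReach (M.toRegion (ρ.state n)) q := by
  -- No constant lies in `[w, u)`. From some time `N` on, the clock stays in this interval and is
  -- not reset, hence stays in one region.
  obtain ⟨w, hwu, hw⟩ : ∃ w < u, ∀ c ∈ M.constPoints, w ≤ c → c < u → False := by
    have hu0 : 0 < u := by
      obtain ⟨n, hn⟩ := hu.exists
      exact zero_le.trans_lt hn.1
    obtain ⟨m, hm, hmax⟩ := Set.exists_max_image (M.constPoints ∩ Set.Iio u) id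
      (M.finite_constPoints.inter_of_left _) ⟨0, M.zero_mem_constPoints, hu0⟩
    obtain ⟨w, hmw, hwu⟩ := exists_between (show m < u from hm.2)
    exact ⟨w, hwu, fun c hc h1 h2 => (hmw.trans_le h1).not_ge (hmax c ⟨hc, h2⟩)⟩
  obtain ⟨N, hN⟩ := eventually_atTop.1 (hu.and (hv.eventually_const_lt hwu))
  have hclock : ∀ n ≥ N, (ρ.state (n + 1)).2 = (ρ.state n).2 + ρ.delay n := by
    intro n hn
    rw [(ρ.step n).clock_eq, TimedAutomaton.clockAfter, if_neg (hN n hn).1.2]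
  set v₀ := (ρ.state N).2 with hv₀
  have hreg : ∀ v, v₀ ≤ v → v < u → v ∈ M.region v₀ := by
    intro v h1 h2
    refine TimedAutomaton.mem_region_of_forall_notMem h1 fun c hc h3 h4 => ?_
    exact hw c hc ((hN N le_rfl).2.le.trans h3) (h4.trans_lt h2)
  have hv₀K : v₀ ∉ M.constPoints := fun h => hw _ h (hN N le_rfl).2.le (hN N le_rfl).1.1
  have hmono : ∀ n ≥ N, v₀ ≤ (ρ.state n).2 := by
    intro n hn
    induction n, hn using Nat.le_induction with
    | base => exact le_rfl
    | succ n hn ih => rw [hclock n hn]; exact ih.trans le_self_add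
  have hmem : ∀ n ≥ N, (ρ.state n).2 ∈ M.region v₀ := fun n hn =>
    hreg _ (hmono n hn) (hN n hn).1.1
  -- A window reaching beyond `u` would allow a positive delay from the limit state `(l, u)`, which
  -- fairness forbids. That `(l, u)` is a state follows because the invariant holds on both sides of
  -- `u`.
  have hwin : ∀ l, (∃ᶠ n in atTop, (ρ.state n).1 = l) → ∀ e, M.source e = l →
      ∀ x ∈ M.window e, x ≤ u := by
    intro l hl e he x hx
    by_contra! hxu
    obtain ⟨n, hn, hnN⟩ := (hl.and_eventually (eventually_ge_atTop N)).exists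
    have h1 : (M.inv l).Sat (ρ.state n).2 := by
      have := (ρ.step n).isState
      rwa [TimedAutomaton.IsState, hn] at this
    have hlu : M.IsState (l, u) :=
      (Guard.ordConnected_sat _).out h1 (he ▸ hx.1) ⟨(hN n hnN).1.1.le, hxu.le⟩
    have h2 : x - u ∈ M.delays (l, u) := (TimedAutomaton.mem_delays hlu).2
      ⟨e, he, by rwa [add_tsub_cancel_of_le hxu.le]⟩
    have h3 := hf.delays_subset hM hv hτ hl hlu h2
    exact hxu.not_ge (tsub_eq_zero_iff_le.1 h3)
  obtain ⟨l₀, hl₀⟩ : ∃ l, ∃ᶠ n in atTop, (ρ.state n).1 = l :=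
    Filter.Frequently.exists_of_finite (Filter.Frequently.of_forall fun n => ⟨_, rfl⟩)
  have huK : u ∈ M.constPoints := by
    by_contra hK
    have h1 := hv.eventually ((TimedAutomaton.isOpen_region hK).mem_nhds (M.mem_region_self u))
    obtain ⟨n, hn, hn'⟩ := (hl₀.and_eventually h1).exists
    have hst := (ρ.step n).isState
    have hlu : M.IsState (l₀, u) := by
      rw [← TimedAutomaton.isState_congr l₀ hn', ← hn]; exact hst
    exact hK (mem_constPoints_of_delays_subset hlu (hf.delays_subset hM hv hτ hl₀ hlu)).1
  have hreglt : ∀ v ∈ M.region v₀, v < u := by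
    intro v hv'
    obtain ⟨c, hc, rfl⟩ := huK
    exact (hv' c hc).1.2 (hN N le_rfl).1.1
  -- The region is now the one just below `u`, and the closed set consists of all locations visited
  -- infinitely often.
  obtain ⟨B, hB, q, hq, hq'⟩ := TimedAutomaton.exists_isZenoBSCC (A := M.toTimedAutomaton)
    (v₀ := v₀) {l | ∃ᶠ n in atTop, (ρ.state n).1 = l} hl₀ ⟨u, fun v hv => (hreglt v hv).le⟩ (by
      intro l hl v hv' τ e s' hstep hthick
      have hs := hstep.isState
      obtain ⟨hsrc, hwe, rfl⟩ := (TimedAutomaton.step_iff hs).1 hstep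
      -- Firing at the constant `u` would be thin: the run itself fires from `l` inside the region
      -- below `u`, which gives a non-constant alternative.
      have hlt : v + τ < u := by
        refine lt_of_le_of_ne (hwin l hl e hsrc _ hwe) fun heq => ?_
        have hall := hthick (show v + τ ∈ M.constPoints from heq ▸ huK)
        obtain ⟨n, hn, hnN⟩ := (hl.and_eventually (eventually_ge_atTop N)).exists
        obtain ⟨h1, h2, -⟩ := (TimedAutomaton.step_iff (ρ.step n).isState).1 (ρ.step n)
        rw [← hclock n hnN] at h2
        have h3 : v ∈ M.window (ρ.edge n) := (TimedAutomaton.window_congr _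
          (TimedAutomaton.mem_region_trans (hmem (n + 1) (by omega))
            (TimedAutomaton.mem_region_symm hv'))).1 h2
        have h4 := hall 0 ((TimedAutomaton.mem_delays hs).2 ⟨_, h1.trans hn, by simpa using h3⟩)
        rw [add_zero] at h4
        exact hv₀K ((TimedAutomaton.mem_constPoints_of_mem_region hv').1 h4)
      have hvτ : v + τ ∈ M.region v₀ := by
        rcases le_total v₀ (v + τ) with h | h
        · exact hreg _ h hlt
        · exact (TimedAutomaton.ordConnected_region v₀).out hv' (M.mem_region_self v₀)
            ⟨le_self_add, h⟩
      have hwreg : ∀ x ∈ M.region v₀, x ∈ M.window e := fun x hx =>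
        (TimedAutomaton.window_congr e (TimedAutomaton.mem_region_trans hx
          (TimedAutomaton.mem_region_symm hvτ))).2 hwe
      have hG : MeasurableSet {x : (L × ℝ≥0) × (ℝ≥0 × E) | x.2.2 = e} :=
        (MeasurableSet.of_discrete (s := {e})).preimage (by fun_prop)
      have hfe := hf.edge_mem e ⟨_, M.minProb_pos e,
        (hl.and_eventually (eventually_ge_atTop N)).mono fun n hn => by
          obtain ⟨hnl, hnN⟩ := hn
          have hsn := (ρ.step n).isState
          have hle := M.minProb_mul_le_moveKernel hE.some hsn (e := e) hG
          have hd : ρ.delay n ∈ M.delays (ρ.state n) :=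
            Set.mem_iUnion.2 ⟨_, _, ρ.step n⟩
          have hdK : (ρ.state n).2 + ρ.delay n ∉ M.constPoints := by
            rw [← hclock n hnN]
            exact fun h => hv₀K ((TimedAutomaton.mem_constPoints_of_mem_region
              (hmem (n + 1) (by omega))).1 h)
          -- Almost every delay from `l` fires at a non-constant value that is at most `u`, hence
          -- inside the region. There `e` is enabled, since it is enabled at one value of the
          -- region.
          have h1 : M.μ (ρ.state n) {t | t ∈ M.delaysOf (ρ.state n) e ∧ (ρ.state n, (t, e)) ∈
              {x : (L × ℝ≥0) × (ℝ≥0 × E) | x.2.2 = e}} = 1 := by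
            rw [← measure_univ (μ := M.μ (ρ.state n))]
            refine measure_congr (eventuallyEq_univ.2 ?_)
            filter_upwards [M.ae_mem_delays hsn, M.ae_notMem_constPoints hsn hd hdK] with t ht htK
            obtain ⟨e', he', ht'⟩ := (TimedAutomaton.mem_delays hsn).1 ht
            refine ⟨(TimedAutomaton.mem_delaysOf hsn).2 ⟨hsrc.trans hnl.symm, hwreg _ ?_⟩, rfl⟩
            refine hreg _ ((hmono n hnN).trans le_self_add) (lt_of_le_of_ne
              (hwin l hl e' (he'.trans hnl) _ ht') fun h => htK (h ▸ huK))
          rwa [h1, mul_one] at hle⟩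
      -- By fairness `e` is taken after time `N`, when the run no longer resets the clock.
      have hreset : ¬ M.reset e := by
        obtain ⟨n, hn, hnN⟩ := (hfe.and_eventually (eventually_ge_atTop N)).exists
        exact hn ▸ (hN n hnN).1.2
      refine ⟨?_, ?_, fun h => absurd h hreset⟩
      · change ∃ᶠ n in atTop, (ρ.state n).1 = M.target e
        rw [Filter.frequently_atTop] at hfe ⊢
        intro a
        obtain ⟨b, hb, hb'⟩ := hfe a
        exact ⟨b + 1, by omega, by rw [(ρ.step b).target_eq, hb']⟩
      · simpa [TimedAutomaton.nextState, TimedAutomaton.clockAfter, hreset] using hvτ)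
  obtain ⟨n, hn, hnN⟩ := (hl₀.and_eventually (eventually_ge_atTop N)).exists
  refine ⟨B, hB, q, hq, n, ?_⟩
  have : M.toRegion (ρ.state n) = (l₀, M.region v₀) :=
    Prod.ext hn (TimedAutomaton.region_eq_of_mem (hmem n hnN))
  rw [this]
  exact hq'

/-- A fair thick Zeno run reaches a Zeno component. -/
theorem FairRun.exists_isZenoBSCC (hM : M.Dagger) (hf : FairRun ρ)
    (hthick : ∀ n, M.ThickStep (ρ.state n) (ρ.delay n)) (hz : ρ.Zeno) :
    ∃ B, M.IsZenoBSCC B ∧ ∃ q ∈ B, M.ThickReach (M.toRegion s) q := by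
  have hτ : Tendsto ρ.delay atTop (𝓝 0) := NNReal.tendsto_atTop_zero_of_summable hz
  obtain ⟨u, hv, h⟩ := exists_limit_of_summable (v := fun n => (ρ.state n).2)
    (R := fun n => M.reset (ρ.edge n))
    (fun n hn => by rw [(ρ.step n).clock_eq, TimedAutomaton.clockAfter, if_pos hn])
    (fun n hn => by rw [(ρ.step n).clock_eq, TimedAutomaton.clockAfter, if_neg hn]) hz
  have : ∃ B, M.IsZenoBSCC B ∧ ∃ q ∈ B, ∃ n, M.ThickReach (M.toRegion (ρ.state n)) q := by
    rcases h with h | h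
    · exact hf.exists_isZenoBSCC_of_frequently hM hv hτ h
    · exact hf.exists_isZenoBSCC_of_eventually hM hv hτ h
  obtain ⟨B, hB, q, hq, n, hn⟩ := this
  exact ⟨B, hB, q, hq, (thickReach_state hthick n).trans hn⟩

/-- If no Zeno component is reachable, then almost every run is a non-Zeno run. -/
theorem ae_not_zeno (hM : M.Dagger) (hs : M.IsState s)
    (h : ¬ ∃ B, M.IsZenoBSCC B ∧ ∃ q ∈ B, M.ThickReach (M.toRegion s) q) :
    ∀ᵐ x ∂(M.runLaw s), ∃ ρ : M.Run s, M.runSeq ρ = x ∧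
      (∀ n, M.ThickStep (ρ.state n) (ρ.delay n)) ∧ ¬ ρ.Zeno := by
  filter_upwards [ae_exists_fairRun hs] with x hx
  obtain ⟨ρ, h1, h2, h3⟩ := hx
  exact ⟨ρ, h1, h2, fun hz => h (h3.exists_isZenoBSCC hM h2 hz)⟩

/-! ### Visiting reachable vertices with positive probability -/

theorem measurableSet_toRegion_eq (q : L × Set ℝ≥0) :
    MeasurableSet {s : L × ℝ≥0 | M.toRegion s = q} := by
  have h : {s : L × ℝ≥0 | M.toRegion s = q} = {s | s.1 = q.1} ∩ {s | M.region s.2 = q.2} := by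
    ext s; exact Prod.ext_iff
  rw [h]
  refine .inter ((MeasurableSet.of_discrete (s := {q.1})).preimage measurable_fst) ?_
  by_cases hq : ∃ v, M.region v = q.2
  · obtain ⟨v, hv⟩ := hq
    have : {s : L × ℝ≥0 | M.region s.2 = q.2} = Prod.snd ⁻¹' M.region v := by
      ext s
      rw [← hv]
      exact ⟨TimedAutomaton.mem_region_of_eq, TimedAutomaton.region_eq_of_mem⟩
    rw [this]
    exact (M.measurableSet_region v).preimage measurable_snd
  · push Not at hq
    simp [hq]

/-- Every vertex that is reachable in the thick graph is visited with positive probability. -/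
theorem exists_runLaw_pos (hs : M.IsState s) {q : L × Set ℝ≥0}
    (hq : M.ThickReach (M.toRegion s) q) :
    ∃ n, 0 < M.runLaw s {x | M.toRegion (x n).1 = q} := by
  induction hq with
  | refl =>
    refine ⟨0, ?_⟩
    have : M.runLaw s {x | M.toRegion (x 0).1 = M.toRegion s} = 1 := by
      rw [← measure_univ (μ := M.runLaw s)]
      refine measure_congr (eventuallyEq_univ.2 ?_)
      filter_upwards [M.ae_runLaw hs] with x hx
      exact congrArg _ hx.1
    rw [this]
    exact one_pos
  | tail _ hadj ih =>
    obtain ⟨n, hn⟩ := ih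
    obtain ⟨f, hf, rfl, rfl⟩ := hadj
    obtain ⟨v, τ, v', hstep, hthick, hsrc, -, htgt⟩ := TimedAutomaton.RegionEdge.exists_thickStep hf
    refine ⟨n + 1, ?_⟩
    let G : Set ((L × ℝ≥0) × (ℝ≥0 × E)) :=
      {y | M.toRegion y.1 = f.src ∧ y.2.2 = f.edge ∧ y.1.2 + y.2.1 ∈ M.region (v + τ)}
    have hG : MeasurableSet G :=
      ((measurableSet_toRegion_eq f.src).preimage measurable_fst).inter
        (((MeasurableSet.of_discrete (s := {f.edge})).preimage (by fun_prop)).inter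
          ((M.measurableSet_region _).preimage (by fun_prop)))
    have hv := hstep.isState
    obtain ⟨hse, hwin, hnext⟩ := (TimedAutomaton.step_iff hv).1 hstep
    -- Thickness makes the delays into the guard region non-negligible from every state of the
    -- source region, and the edge is then enabled. Positivity needs no uniform lower bound here.
    have hpos : ∀ s', M.IsState s' → M.toRegion s' = f.src → 0 < M.moveKernel hE.some s' G := by
      rintro ⟨l, w⟩ hs' hs'f
      have hl : l = f.src.1 := congrArg Prod.fst hs'f
      subst hl
      have hw : w ∈ M.region v := TimedAutomaton.mem_region_of_eq
        ((congrArg Prod.snd hs'f).trans (congrArg Prod.snd hsrc))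
      obtain ⟨u, hu, hwu⟩ := TimedAutomaton.exists_delay_mem_region hw (le_add_right (le_refl v) (c := τ))
      have huw : w + (u - w) = u := add_tsub_cancel_of_le hwu
      have hu' : w + (u - w) ∈ M.region (v + τ) := by rwa [huw]
      have h1 := M.measure_region_pos hs' (t := u - w)
        ((TimedAutomaton.mem_delays_congr hv hs' hu').2 (Set.mem_iUnion.2 ⟨_, _, hstep⟩))
        ((TimedAutomaton.thickStep_congr hv hw hu').2 hthick)
      refine lt_of_lt_of_le (ENNReal.mul_pos (M.minProb_pos f.edge).ne' ?_)
        (M.minProb_mul_le_moveKernel hE.some hs' (e := f.edge) hG)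
      refine (h1.trans_le (measure_mono fun t ht => ?_)).ne'
      have ht' : w + t ∈ M.region (v + τ) := TimedAutomaton.mem_region_trans ht hu'
      exact ⟨(TimedAutomaton.mem_delaysOf hs').2 ⟨hse, (TimedAutomaton.window_congr _ ht').2 hwin⟩,
        hs'f, rfl, ht'⟩
    have hGpos : 0 < M.runLaw s {x | x n ∈ G} := by
      rw [M.runLaw_apply_eq_lintegral hs n hG]
      refine pos_iff_ne_zero.2 fun h0 => hn.ne' ?_
      have hmG : Measurable fun x : ℕ → (L × ℝ≥0) × (ℝ≥0 × E) => M.moveKernel hE.some (x n).1 G :=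
        (Kernel.measurable_coe _ hG).comp (by fun_prop)
      rw [lintegral_eq_zero_iff hmG] at h0
      refine measure_mono_null (t := {x | M.moveKernel hE.some (x n).1 G = 0}ᶜ ∪
        {x | M.IsState (x n).1}ᶜ) (fun x hx => ?_) (measure_union_null h0 ?_)
      · by_cases hst : M.IsState (x n).1
        · exact Or.inl (hpos _ hst hx).ne'
        · exact Or.inr hst
      · refine (M.ae_runLaw hs).mono fun x hx => ?_
        exact (hx.2 n).2.1.isState
    refine hGpos.trans_le (measure_mono_ae ?_)
    filter_upwards [M.ae_runLaw hs] with x hx hxG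
    obtain ⟨h1, h2, h3⟩ := hxG
    change M.toRegion (x (n + 1)).1 = f.tgt
    rw [(hx.2 n).1, htgt]
    refine Prod.ext ?_ ?_
    · change M.target (x n).2.2 = f.tgt.1
      rw [h2]
      exact (congrArg Prod.fst hnext).symm
    · change M.region (M.clockAfter (x n).2.2 _) = M.region v'
      rw [h2, show v' = M.clockAfter f.edge (v + τ) from congrArg Prod.snd hnext]
      exact TimedAutomaton.region_eq_of_mem (TimedAutomaton.clockAfter_mem_region _ h3)

/-- Left to right, the non-Zeno runs avoid, up to a null set, the event of positive probability that
a vertex of the Zeno component is visited at time `n`. Right to left, almost every sequence of moves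
comes from a fair thick run, which reaches a Zeno component if it is Zeno. -/
theorem almostSurelySatisfies_not_zeno_iff (hM : M.Dagger) (hs : M.IsState s) :
    M.AlmostSurelySatisfies s (fun ρ => ¬ ρ.Zeno) ↔
      ¬ ∃ B, M.IsZenoBSCC B ∧ ∃ q ∈ B, M.ThickReach (M.toRegion s) q := by
  constructor
  · rintro h ⟨B, hB, q, hqB, hq⟩
    obtain ⟨n, hn⟩ := exists_runLaw_pos hs hq
    have hK : MeasurableSet {x : ℕ → (L × ℝ≥0) × (ℝ≥0 × E) | M.toRegion (x n).1 = q} :=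
      (measurableSet_toRegion_eq q).preimage (measurable_fst.comp (measurable_pi_apply n))
    have hle : M.runLaw s (M.runSeq '' {ρ : M.Run s | ¬ ρ.Zeno}) ≤
        M.runLaw s {x | M.toRegion (x n).1 = q}ᶜ := by
      refine measure_mono_ae ?_
      filter_upwards [ae_exists_fairRun hs] with x hx
      obtain ⟨ρ, hρ, hthick, -⟩ := hx
      rintro ⟨ρ', hρ', rfl⟩ hx
      refine hρ' ?_
      have h1 : ρ'.delay = ρ.delay := by
        funext m
        exact (congrArg (fun y => (y m).2.1) hρ).symm
      have h2 : ρ'.state n = ρ.state n := (congrArg (fun y => (y n).1) hρ).symm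
      rw [TimedAutomaton.Run.Zeno, h1]
      refine hB.summable ρ.step hthick (m := n) ?_
      rw [← h2]
      have hx' : M.toRegion (ρ'.state n) = q := hx
      rwa [hx']
    rw [prob_compl_eq_one_sub hK] at hle
    have h1 : M.runLaw s (M.runSeq '' {ρ : M.Run s | ¬ ρ.Zeno}) = 1 := h
    rw [h1] at hle
    exact (ENNReal.sub_lt_self ENNReal.one_ne_top one_ne_zero hn.ne').not_ge hle
  · intro h
    change M.runLaw s _ = 1
    rw [← measure_univ (μ := M.runLaw s)]
    refine measure_congr (eventuallyEq_univ.2 ?_)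
    filter_upwards [ae_not_zeno hM hs h] with x hx
    obtain ⟨ρ, h1, -, h3⟩ := hx
    exact ⟨ρ, h3, h1⟩

/-- If no Zeno component is reachable, there is a thick non-Zeno run. -/
theorem exists_thick_not_zeno (hM : M.Dagger) (hs : M.IsState s)
    (h : ¬ ∃ B, M.IsZenoBSCC B ∧ ∃ q ∈ B, M.ThickReach (M.toRegion s) q) :
    ∃ ρ : M.Run s, (∀ n, M.ThickStep (ρ.state n) (ρ.delay n)) ∧ ¬ ρ.Zeno := by
  obtain ⟨x, ρ, -, h⟩ := (ae_not_zeno hM hs h).exists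
  exact ⟨ρ, h⟩

/-- If a Zeno component is reachable, there is a thick run that reaches it. -/
theorem exists_thick_reach (hs : M.IsState s) {q : L × Set ℝ≥0}
    (hq : M.ThickReach (M.toRegion s) q) :
    ∃ ρ : M.Run s, (∀ n, M.ThickStep (ρ.state n) (ρ.delay n)) ∧
      ∃ n, M.toRegion (ρ.state n) = q := by
  obtain ⟨n, hn⟩ := exists_runLaw_pos hs hq
  obtain ⟨x, hx, ρ, rfl, h, -⟩ :=
    ((frequently_ae_mem_iff.2 hn.ne').and_eventually (ae_exists_fairRun hs)).exists
  exact ⟨ρ, h, n, hx⟩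

end StochasticTimedAutomaton

/-! ### Paths and their clock values -/

namespace TimedAutomaton

variable {L E : Type*} (A : TimedAutomaton L E)

/-- The states reached from `s` along the edges `e` with the delays `τ`. -/
noncomputable def path (s : L × ℝ≥0) (e : ℕ → E) (τ : ℕ → ℝ≥0) : ℕ → L × ℝ≥0
  | 0 => s
  | n + 1 => A.nextState (path s e τ n) (τ n) (e n)

/-- The clock value at which the edge `e n` is taken. -/
noncomputable def firing (s : L × ℝ≥0) (e : ℕ → E) (τ : ℕ → ℝ≥0) (n : ℕ) : ℝ≥0 :=
  (A.path s e τ n).2 + τ n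

/-- The edges `e 0, …, e (n - 1)` can be taken from `s` with the delays `τ`. -/
def Admissible (s : L × ℝ≥0) (e : ℕ → E) (τ : ℕ → ℝ≥0) (n : ℕ) : Prop :=
  ∀ i < n, A.source (e i) = (A.path s e τ i).1 ∧ A.firing s e τ i ∈ A.window (e i)

variable {A} {s : L × ℝ≥0} {e e' : ℕ → E} {τ τ' : ℕ → ℝ≥0} {n : ℕ}

theorem path_succ (n : ℕ) :
    A.path s e τ (n + 1) = (A.target (e n), A.clockAfter (e n) (A.firing s e τ n)) := rfl

theorem path_congr (he : ∀ i < n, e i = e' i) (hτ : ∀ i < n, τ i = τ' i) :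
    A.path s e τ n = A.path s e' τ' n := by
  induction n with
  | zero => rfl
  | succ n ih =>
    rw [path, path, ih (fun i hi => he i (by omega)) (fun i hi => hτ i (by omega)), he n (by omega),
      hτ n (by omega)]

theorem firing_congr (he : ∀ i < n, e i = e' i) (hτ : ∀ i ≤ n, τ i = τ' i) :
    A.firing s e τ n = A.firing s e' τ' n := by
  rw [firing, firing, path_congr he fun i hi => hτ i hi.le, hτ n le_rfl]

theorem admissible_congr (he : ∀ i < n, e i = e' i) (hτ : ∀ i < n, τ i = τ' i) :
    A.Admissible s e τ n ↔ A.Admissible s e' τ' n := by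
  refine forall₂_congr fun i hi => ?_
  rw [path_congr (e' := e') (τ' := τ') (fun j hj => he j (by omega)) (fun j hj => hτ j (by omega)),
    firing_congr (e' := e') (τ' := τ') (fun j hj => he j (by omega)) (fun j hj => hτ j (by omega)),
    he i hi]

theorem Admissible.mono {m : ℕ} (h : A.Admissible s e τ n) (hm : m ≤ n) : A.Admissible s e τ m :=
  fun i hi => h i (hi.trans_le hm)

theorem path_fst (n : ℕ) : (A.path s e τ n).1 = (A.path s e τ' n).1 := by
  cases n <;> rfl

theorem Admissible.isState (hs : A.IsState s) (h : A.Admissible s e τ n) {i : ℕ} (hi : i ≤ n) :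
    A.IsState (A.path s e τ i) := by
  cases i with
  | zero => exact hs
  | succ i => exact (h i (by omega)).2.2.2

theorem Admissible.step (hs : A.IsState s) (h : A.Admissible s e τ n) {i : ℕ} (hi : i < n) :
    A.Step (A.path s e τ i) (τ i) (e i) (A.path s e τ (i + 1)) :=
  (step_iff (h.isState hs hi.le)).2 ⟨(h i hi).1, (h i hi).2, rfl⟩

theorem Run.path_eq (ρ : A.Run s) (n : ℕ) : A.path s ρ.edge ρ.delay n = ρ.state n := by
  induction n with
  | zero => exact ρ.start.symm
  | succ n ih =>
    rw [path, ih]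
    exact ((step_iff (ρ.step n).isState).1 (ρ.step n)).2.2.symm

theorem Run.firing_eq (ρ : A.Run s) (n : ℕ) :
    A.firing s ρ.edge ρ.delay n = (ρ.state n).2 + ρ.delay n := by
  rw [firing, ρ.path_eq]

theorem Run.admissible (ρ : A.Run s) (n : ℕ) : A.Admissible s ρ.edge ρ.delay n := by
  intro i _
  have h := (step_iff (ρ.step i).isState).1 (ρ.step i)
  rw [ρ.path_eq, ρ.firing_eq]
  exact ⟨h.1, h.2.1⟩

theorem clockAfter_dist_le (e : E) (u v : ℝ≥0) :
    dist (A.clockAfter e u) (A.clockAfter e v) ≤ dist u v := by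
  unfold clockAfter
  split_ifs <;> simp

theorem nnreal_dist_add_add_le (a b c d : ℝ≥0) : dist (a + b) (c + d) ≤ dist a c + dist b d :=
  dist_add_add_le (a : ℝ) b c d

theorem dist_path_le (n : ℕ) : dist (A.path s e τ n).2 (A.path s e τ' n).2 ≤
    ∑ i ∈ Finset.range n, dist (τ i) (τ' i) := by
  induction n with
  | zero => simp [path]
  | succ n ih =>
    rw [Finset.sum_range_succ]
    refine (clockAfter_dist_le _ _ _).trans ((nnreal_dist_add_add_le _ _ _ _).trans ?_)
    gcongr

theorem dist_firing_le (n : ℕ) : dist (A.firing s e τ n) (A.firing s e τ' n) ≤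
    ∑ i ∈ Finset.range (n + 1), dist (τ i) (τ' i) := by
  rw [Finset.sum_range_succ]
  refine (nnreal_dist_add_add_le _ _ _ _).trans ?_
  gcongr
  exact dist_path_le n

/-- Along fixed edges the resets occur at the same steps whatever the delays are, so the clock is an
affine function of the delays. As windows are order-connected, the admissible delays form a convex
set. -/
theorem path_add_mul {a b : ℝ≥0} (hab : a + b = 1) (n : ℕ) :
    (A.path s e (fun i => a * τ i + b * τ' i) n).2 =
      a * (A.path s e τ n).2 + b * (A.path s e τ' n).2 := by
  induction n with
  | zero => simp [path, ← add_mul, hab]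
  | succ n ih =>
    simp only [path, nextState, ih, clockAfter]
    split_ifs <;> ring

theorem firing_add_mul {a b : ℝ≥0} (hab : a + b = 1) (n : ℕ) :
    A.firing s e (fun i => a * τ i + b * τ' i) n =
      a * A.firing s e τ n + b * A.firing s e τ' n := by
  rw [firing, path_add_mul hab, firing, firing]
  ring

theorem Admissible.add_mul {a b : ℝ≥0} (hab : a + b = 1) (h : A.Admissible s e τ n)
    (h' : A.Admissible s e τ' n) : A.Admissible s e (fun i => a * τ i + b * τ' i) n := by
  refine fun i hi => ⟨(h i hi).1.trans (path_fst i), ?_⟩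
  rw [firing_add_mul hab]
  exact (ordConnected_window (e i)).convex (𝕜 := ℝ≥0) (h i hi).2 (h' i hi).2 zero_le zero_le hab

/-! ### Finite sequences of delays -/

/-- The extension of a finite sequence by zero. -/
def extend {n : ℕ} (τ : Fin n → ℝ≥0) (i : ℕ) : ℝ≥0 := if h : i < n then τ ⟨i, h⟩ else 0

theorem extend_of_lt {n : ℕ} (τ : Fin n → ℝ≥0) {i : ℕ} (h : i < n) : extend τ i = τ ⟨i, h⟩ :=
  dif_pos h

theorem extend_val {n : ℕ} (τ : Fin n → ℝ≥0) (i : Fin n) : extend τ i = τ i := by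
  simp [extend]

theorem continuous_extend (n i : ℕ) : Continuous fun τ : Fin n → ℝ≥0 => extend τ i := by
  unfold extend
  split_ifs
  · exact continuous_apply _
  · exact continuous_const

theorem mem_pol (hs : A.IsState s) {C : Set (Fin n → ℝ≥0)} {τ : Fin n → ℝ≥0} :
    τ ∈ A.pol s (fun i : Fin n => e i) C ↔ τ ∈ C ∧ A.Admissible s e (extend τ) n := by
  refine and_congr_right fun _ => ⟨?_, fun h => ?_⟩
  · rintro ⟨σ, h0, hσ⟩
    have hp : ∀ i : ℕ, ∀ hi : i < n + 1, A.path s e (extend τ) i = σ ⟨i, hi⟩ := by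
      intro i
      induction i with
      | zero => exact fun _ => h0.symm
      | succ i ih =>
        intro hi
        have h := hσ ⟨i, by omega⟩
        have h1 := ((step_iff h.isState).1 h).2.2
        rw [path, ih (by omega), extend_of_lt τ (by omega)]
        exact h1.symm
    intro i hi
    have h := hσ ⟨i, hi⟩
    have h1 := (step_iff h.isState).1 h
    rw [firing, hp i (by omega), extend_of_lt τ hi]
    exact ⟨h1.1, h1.2.1⟩
  · refine ⟨fun i => A.path s e (extend τ) i, rfl, fun i => ?_⟩
    have := h.step hs i.2
    rwa [extend_val] at this

theorem dist_extend_le {n : ℕ} (τ τ' : Fin n → ℝ≥0) (i : ℕ) :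
    dist (extend τ i) (extend τ' i) ≤ dist τ τ' := by
  unfold extend
  split_ifs
  · exact dist_le_pi_dist _ _ _
  · simp

/-- Each clock value depends on at most `m` delays, with coefficients `0` or `1`; hence the
Lipschitz constant `m`. -/
theorem lipschitzWith_firing (s : L × ℝ≥0) (e : ℕ → E) (m : ℕ) (p : Fin m → Prop)
    [DecidablePred p] :
    ∃ K, LipschitzWith K fun (τ : Fin m → ℝ≥0) (i : {i // p i}) =>
      (A.firing s e (extend τ) i.1 : ℝ) := by
  refine ⟨m, LipschitzWith.of_dist_le_mul fun τ τ' => ?_⟩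
  refine (dist_pi_le_iff (by positivity)).2 fun i => ?_
  refine (dist_firing_le (A := A) (s := s) (e := e) (i.1 : ℕ)).trans ?_
  refine (Finset.sum_le_sum fun j _ => dist_extend_le τ τ' j).trans ?_
  rw [Finset.sum_const, Finset.card_range, nsmul_eq_mul]
  gcongr
  exact_mod_cast i.1.2

/-- A set of delays in which the clock values with `p` can be prescribed in a box has at least
the dimension of the box. -/
theorem card_le_dimH {m : ℕ} {X : Set (Fin m → ℝ≥0)} (p : Fin m → Prop) [DecidablePred p]
    (w : Fin m → ℝ) {ε : ℝ} (hε : 0 < ε)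
    (h : ∀ y : Fin m → ℝ, (∀ i, |y i - w i| < ε) →
      ∃ τ ∈ X, ∀ i, p i → (A.firing s e (extend τ) i : ℝ) = y i) :
    (Fintype.card {i // p i} : ℝ≥0∞) ≤ dimH X := by
  -- The selected clock values are a Lipschitz function of the delays, which cannot raise the
  -- dimension, and their image of `X` contains a ball.
  obtain ⟨K, hK⟩ := lipschitzWith_firing (A := A) s e m p
  refine le_trans ?_ (hK.dimH_image_le X)
  have h1 : dimH (Metric.ball (fun i : {i // p i} => w i) ε) = Fintype.card {i // p i} := by
    rw [Real.dimH_ball_pi _ hε]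
  rw [← h1]
  refine dimH_mono fun y hy => ?_
  obtain ⟨τ, hτ, hτy⟩ := h (fun i => if hi : p i then y ⟨i, hi⟩ else w i) (by
    intro i
    split_ifs with hi
    · exact ((dist_pi_lt_iff hε).1 hy ⟨i, hi⟩)
    · simpa using hε)
  refine ⟨τ, hτ, funext fun i => ?_⟩
  simp only
  rw [hτy i.1 i.2, dif_pos i.2]

/-- A set of delays in which the clock values without `p` are fixed has at most the dimension given
by the number of the other clock values. -/
theorem dimH_le_card {m : ℕ} {X : Set (Fin m → ℝ≥0)} (p : Fin m → Prop) [DecidablePred p]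
    (c : Fin m → ℝ≥0) (h : ∀ τ ∈ X, ∀ i, ¬ p i → A.firing s e (extend τ) i = c i) :
    dimH X ≤ (Fintype.card {i // p i} : ℝ≥0∞) := by
  -- A delay is the difference of the clock value at which the edge is taken and the clock value
  -- before the delay. The latter is a 1-Lipschitz function of the previous such value, or is the
  -- initial clock. Each of the two contributes once, hence the constant `2`.
  have hanti : AntilipschitzWith 2 fun (τ : X) (i : {i // p i}) =>
      (A.firing s e (extend τ.1) i.1 : ℝ) := by
    refine AntilipschitzWith.of_le_mul_dist fun τ τ' => ?_
    set d := dist (fun (i : {i // p i}) => (A.firing s e (extend τ.1) i.1 : ℝ))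
      (fun (i : {i // p i}) => (A.firing s e (extend τ'.1) i.1 : ℝ)) with hd
    have hd0 : 0 ≤ d := dist_nonneg
    have hf : ∀ i < m, dist (A.firing s e (extend τ.1) i) (A.firing s e (extend τ'.1) i) ≤ d := by
      intro i hi
      by_cases hp : p ⟨i, hi⟩
      · exact dist_le_pi_dist (fun (i : {i // p i}) => (A.firing s e (extend τ.1) i.1 : ℝ))
          (fun (i : {i // p i}) => (A.firing s e (extend τ'.1) i.1 : ℝ)) ⟨_, hp⟩
      · rw [h τ.1 τ.2 ⟨i, hi⟩ hp, h τ'.1 τ'.2 ⟨i, hi⟩ hp, dist_self]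
        exact hd0
    refine (dist_pi_le_iff (by positivity)).2 fun i => ?_
    have hpath : dist (A.path s e (extend τ.1) i).2 (A.path s e (extend τ'.1) i).2 ≤ d := by
      obtain ⟨i, hi⟩ := i
      cases i with
      | zero => simpa [path] using hd0
      | succ i => exact (clockAfter_dist_le _ _ _).trans (hf i (by omega))
    have h1 := hf i i.2
    simp only [firing, extend_val, NNReal.dist_eq, NNReal.coe_add] at h1 hpath ⊢
    rw [abs_le] at *
    push_cast
    constructor <;> linarith
  have h2 := hanti.le_dimH_image Set.univ
  have h3 : dimH X = dimH (Set.univ : Set X) := by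
    rw [← (isometry_subtype_coe (s := X)).dimH_image]; simp
  rw [h3, ← Real.dimH_univ_pi]
  exact h2.trans (dimH_mono (Set.subset_univ _))

end TimedAutomaton

namespace TimedAutomaton

variable {L E : Type*} [Finite L] [Finite E] {A : TimedAutomaton L E} {s : L × ℝ≥0}
  {e : ℕ → E} {τ τ' : ℕ → ℝ≥0} {n : ℕ}

/-! ### Boxes and generic delays -/

/-- A common radius of balls around finitely many clock values: around non-constants they stay
inside the region, around constants they contain no other constant. -/
theorem exists_radius (A : TimedAutomaton L E) (u : ℕ → ℝ≥0) (n : ℕ) :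
    ∃ η : ℝ, 0 < η ∧ ∀ i < n, ∀ x : ℝ≥0, dist x (u i) < η →
      (u i ∉ A.constPoints → x ∈ A.region (u i)) ∧ (x ∈ A.constPoints → u i = x ∨ u i ∉ A.constPoints) := by
  have h : ∀ i, ∃ η : ℝ, 0 < η ∧ ∀ x : ℝ≥0, dist x (u i) < η →
      (u i ∉ A.constPoints → x ∈ A.region (u i)) ∧
        (x ∈ A.constPoints → u i = x ∨ u i ∉ A.constPoints) := by
    intro i
    by_cases hK : u i ∈ A.constPoints
    · have h1 : (A.constPoints \ {u i})ᶜ ∈ nhds (u i) :=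
        (A.finite_constPoints.sdiff).isClosed.isOpen_compl.mem_nhds (by simp)
      obtain ⟨η, hη, h2⟩ := Metric.mem_nhds_iff.1 h1
      refine ⟨η, hη, fun x hx => ⟨fun h => absurd hK h, fun hxK => ?_⟩⟩
      by_contra! h3
      exact h2 hx ⟨hxK, fun h => h3.1 h.symm⟩
    · obtain ⟨η, hη, h2⟩ := Metric.mem_nhds_iff.1 ((isOpen_region hK).mem_nhds (A.mem_region_self _))
      exact ⟨η, hη, fun x hx => ⟨fun _ => h2 hx, fun _ => Or.inr hK⟩⟩
  choose η hη h using h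
  induction n with
  | zero => exact ⟨1, one_pos, fun i hi => absurd hi (by omega)⟩
  | succ n ih =>
    obtain ⟨ζ, hζ, hζ'⟩ := ih
    refine ⟨min ζ (η n), lt_min hζ (hη n), fun i hi x hx => ?_⟩
    rcases Nat.lt_succ_iff_lt_or_eq.1 hi with h1 | rfl
    · exact hζ' i h1 x (hx.trans_le (min_le_left _ _))
    · exact h i x (hx.trans_le (min_le_right _ _))

/-- Near admissible delays, the non-constant clock values can be prescribed in a box. -/
theorem Admissible.exists_box (h : A.Admissible s e τ n) {δ : ℝ} (hδ : 0 < δ) :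
    ∃ (w : ℕ → ℝ) (ε : ℝ), 0 < ε ∧ ∀ y : ℕ → ℝ, (∀ i < n, |y i - w i| < ε) →
      ∃ τ', A.Admissible s e τ' n ∧ (∀ i < n, dist (τ' i) (τ i) < δ) ∧
        ∀ i < n, (A.firing s e τ i ∉ A.constPoints → (A.firing s e τ' i : ℝ) = y i) ∧
          (A.firing s e τ i ∈ A.constPoints → A.firing s e τ' i = A.firing s e τ i) := by
  classical
  obtain ⟨η, hη, hrad⟩ := exists_radius A (A.firing s e τ) n
  set u := A.firing s e τ with hu
  set ζ : ℝ := min η δ / (4 * (n + 2)) with hζ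
  have hm : 0 < min η δ := lt_min hη hδ
  have hζ0 : 0 < ζ := by positivity
  have hζn : ζ * (n + 2) = min η δ / 4 := by rw [hζ]; field_simp
  -- The non-constant clock values are shifted upwards by offsets that grow with `i`. Consecutive
  -- offsets differ by `ζ`, so deviations below `ζ / 2` preserve the order even where the original
  -- delay is `0`. All shifts stay below `min η δ / 2`.
  refine ⟨fun i => u i + ζ * (i + 1), ζ / 2, by positivity, fun y hy => ?_⟩
  let U : ℕ → ℝ≥0 := fun i => if u i ∈ A.constPoints then u i else (y i).toNNReal
  have hUK : ∀ i, u i ∈ A.constPoints → U i = u i := fun i hi => if_pos hi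
  have hyi : ∀ i < n, (u i : ℝ) + ζ * (i + 1) - ζ / 2 < y i ∧ y i < u i + ζ * (i + 1) + ζ / 2 := by
    intro i hi
    have := abs_lt.1 (hy i hi)
    constructor <;> linarith [this.1, this.2]
  have hUy : ∀ i < n, u i ∉ A.constPoints → (U i : ℝ) = y i := by
    intro i hi hK
    have h1 : (0 : ℝ) ≤ u i := (u i).2
    have h2 : (0 : ℝ) ≤ ζ * i := by positivity
    have h3 := (hyi i hi).1
    simp only [U, if_neg hK]
    exact Real.coe_toNNReal _ (by nlinarith)
  have hUlt : ∀ i < n, u i ∉ A.constPoints → u i < U i := by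
    intro i hi hK
    rw [← NNReal.coe_lt_coe, hUy i hi hK]
    have h2 : (0 : ℝ) ≤ ζ * i := by positivity
    nlinarith [(hyi i hi).1]
  have hUdist : ∀ i < n, dist (U i) (u i) < min η δ / 2 := by
    intro i hi
    by_cases hK : u i ∈ A.constPoints
    · rw [hUK i hK, dist_self]; positivity
    · have h1 := hyi i hi
      have h2 : (0 : ℝ) ≤ ζ * i := by positivity
      have h3 : ζ * (i + 1) ≤ ζ * n := by
        have : (i : ℝ) + 1 ≤ n := by exact_mod_cast hi
        gcongr
      rw [NNReal.dist_eq, hUy i hi hK, abs_lt]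
      constructor <;> nlinarith
  have hUreg : ∀ i < n, U i ∈ A.region (u i) := by
    intro i hi
    by_cases hK : u i ∈ A.constPoints
    · rw [hUK i hK]; exact A.mem_region_self _
    · refine (hrad i hi (U i) ((hUdist i hi).trans_le ?_)).1 hK
      linarith [min_le_left η δ]
  -- `U i` is the new clock value at which `e i` is taken and `V i` the new clock value before the
  -- delay. The delays `U i - V i` realise these values provided `V i ≤ U i`.
  let V : ℕ → ℝ≥0 := fun i => match i with
    | 0 => s.2
    | i + 1 => A.clockAfter (e i) (U i)
  have hV : ∀ i < n, dist (V i) (A.path s e τ i).2 < min η δ / 2 := by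
    intro i hi
    cases i with
    | zero => simp only [V, path, dist_self]; positivity
    | succ i => exact (clockAfter_dist_le _ _ _).trans_lt (hUdist i (by omega))
  have hVU : ∀ i < n, V i ≤ U i := by
    intro i hi
    cases i with
    | zero =>
      have h1 : s.2 ≤ u 0 := le_self_add
      by_cases hK : u 0 ∈ A.constPoints
      · exact h1.trans (hUK 0 hK).ge
      · exact h1.trans (hUlt 0 hi hK).le
    | succ i =>
      by_cases hr : A.reset (e i)
      · simp [V, clockAfter, hr]
      · simp only [V, clockAfter, hr, if_false]
        have h1 : u i ≤ u (i + 1) := by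
          have : u (i + 1) = A.clockAfter (e i) (u i) + τ (i + 1) := rfl
          rw [this, clockAfter, if_neg hr]
          exact le_self_add
        have hi' : i < n := by omega
        by_cases hK : u i ∈ A.constPoints
        · rw [hUK i hK]
          by_cases hK' : u (i + 1) ∈ A.constPoints
          · rwa [hUK _ hK']
          · exact h1.trans (hUlt _ hi hK').le
        · by_cases hK' : u (i + 1) ∈ A.constPoints
          · rw [hUK _ hK']
            -- From a non-constant value to a constant one there is strict room, and `U i`, being in
            -- the region of `u i`, stays below the constant.
            have h2 : u i < u (i + 1) := lt_of_le_of_ne h1 fun h => hK (h ▸ hK')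
            obtain ⟨c, hc, hc'⟩ := hK'
            rw [← hc'] at h2 ⊢
            exact ((hUreg i hi' c hc).1.2 h2).le
          · rw [← NNReal.coe_le_coe, hUy i hi' hK, hUy _ hi hK']
            have h2 := (hyi i hi').2
            have h3 := (hyi _ hi).1
            have h4 : (u i : ℝ) ≤ u (i + 1) := h1
            push_cast at h3
            nlinarith
  have hpath : ∀ i ≤ n, (A.path s e (fun i => U i - V i) i).2 = V i := by
    intro i hi
    induction i with
    | zero => rfl
    | succ i ih =>
      rw [path_succ, firing, ih (by omega), add_tsub_cancel_of_le (hVU i (by omega))]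
  have hfir : ∀ i < n, A.firing s e (fun i => U i - V i) i = U i := by
    intro i hi
    rw [firing, hpath i hi.le, add_tsub_cancel_of_le (hVU i hi)]
  refine ⟨fun i => U i - V i, fun i hi => ⟨(h i hi).1.trans (path_fst i), ?_⟩, fun i hi => ?_,
    fun i hi => ⟨fun hK => ?_, fun hK => ?_⟩⟩
  · rw [hfir i hi]
    exact (window_congr _ (hUreg i hi)).2 (h i hi).2
  · have h1 := hUdist i hi
    have h2 := hV i hi
    have h3 : (u i : ℝ) = (A.path s e τ i).2 + τ i := rfl
    rw [NNReal.dist_eq, abs_lt] at *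
    rw [NNReal.coe_sub (hVU i hi)]
    have := min_le_right η δ
    constructor <;> linarith
  · rw [hfir i hi]; exact hUy i hi hK
  · rw [hfir i hi]; exact hUK i hK

theorem continuous_firing_extend (s : L × ℝ≥0) (e : ℕ → E) (n i : ℕ) :
    Continuous fun τ : Fin n → ℝ≥0 => A.firing s e (extend τ) i := by
  rw [Metric.continuous_iff]
  intro τ ε hε
  refine ⟨ε / (i + 1), by positivity, fun τ' h => ?_⟩
  refine (dist_firing_le i).trans_lt ?_
  refine (Finset.sum_le_sum fun j _ => dist_extend_le τ' τ j).trans_lt ?_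
  rw [Finset.sum_const, Finset.card_range, nsmul_eq_mul]
  rw [lt_div_iff₀ (by positivity)] at h
  push_cast
  linarith

/-- A nonempty relatively open set of admissible delays contains delays for which the constant clock
values are constant on all admissible delays. -/
theorem exists_generic {O : Set (Fin n → ℝ≥0)} (hO : IsOpen O)
    (hne : ∃ τ ∈ O, A.Admissible s e (extend τ) n) :
    ∃ τ ∈ O, A.Admissible s e (extend τ) n ∧
      ∀ i < n, A.firing s e (extend τ) i ∈ A.constPoints →
        ∀ τ' : Fin n → ℝ≥0, A.Admissible s e (extend τ') n →
          A.firing s e (extend τ') i = A.firing s e (extend τ) i := by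
  classical
  let N : (Fin n → ℝ≥0) → ℕ := fun τ =>
    (Finset.univ.filter fun i : Fin n => A.firing s e (extend τ) i ∈ A.constPoints).card
  -- Choose admissible delays in `O` with the fewest constant clock values, and move slightly from
  -- them towards arbitrary admissible `τ'`. For small `b` no value becomes newly constant, so by
  -- minimality every constant value stays put, and affinity gives the same value at `τ'`.
  obtain ⟨τ, ⟨hτO, hτ⟩, hmin⟩ := WellFounded.has_min (measure N).wf
    {τ | τ ∈ O ∧ A.Admissible s e (extend τ) n} hne
  refine ⟨τ, hτO, hτ, fun i hi hK τ' hτ' => ?_⟩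
  let g : ℝ≥0 → Fin n → ℝ≥0 := fun b j => (1 - b) * τ j + b * τ' j
  have hg : Continuous g := by fun_prop
  have hg0 : g 0 = τ := by funext j; simp [g]
  have hgext : ∀ b, extend (g b) = fun j => (1 - b) * extend τ j + b * extend τ' j := by
    intro b; funext j
    simp only [extend]
    split_ifs <;> simp [g]
  have h1 : ∀ᶠ b in nhds (0 : ℝ≥0), g b ∈ O :=
    (hg.tendsto 0).eventually (by rw [hg0]; exact hO.mem_nhds hτO)
  have h2 : ∀ᶠ b in nhds (0 : ℝ≥0), ∀ j : Fin n,
      A.firing s e (extend (g b)) j ∈ A.constPoints →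
        A.firing s e (extend (g b)) j = A.firing s e (extend τ) j := by
    refine Filter.eventually_all.2 fun j => ?_
    have hc : Continuous fun b => A.firing s e (extend (g b)) j :=
      (continuous_firing_extend s e n j).comp hg
    have ho : (A.constPoints \ {A.firing s e (extend τ) j})ᶜ ∈ nhds (A.firing s e (extend (g 0)) j) :=
      (A.finite_constPoints.sdiff).isClosed.isOpen_compl.mem_nhds (by simp [hg0])
    filter_upwards [(hc.tendsto 0).eventually ho] with b hb hbK
    by_contra hne
    exact hb ⟨hbK, hne⟩
  have h3 : ∀ᶠ b in nhdsWithin (0 : ℝ≥0) (Set.Ioi 0), b < 1 :=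
    Filter.Eventually.filter_mono nhdsWithin_le_nhds (gt_mem_nhds one_pos)
  obtain ⟨b, hb1, hbO, hbK, hb0⟩ := (h3.and ((h1.filter_mono nhdsWithin_le_nhds).and
    ((h2.filter_mono nhdsWithin_le_nhds).and self_mem_nhdsWithin))).exists
  have hab : (1 - b) + b = 1 := tsub_add_cancel_of_le hb1.le
  have hadm : A.Admissible s e (extend (g b)) n := by
    rw [hgext]; exact hτ.add_mul hab hτ'
  have hsub : (Finset.univ.filter fun i : Fin n => A.firing s e (extend (g b)) i ∈ A.constPoints) ⊆
      Finset.univ.filter fun i : Fin n => A.firing s e (extend τ) i ∈ A.constPoints := by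
    intro j hj
    simp only [Finset.mem_filter, Finset.mem_univ, true_and] at hj ⊢
    rw [← hbK j hj]
    exact hj
  have heq := Finset.eq_of_subset_of_card_le hsub (not_lt.1 (hmin (g b) ⟨hbO, hadm⟩))
  have hiK : A.firing s e (extend (g b)) i ∈ A.constPoints := by
    have : (⟨i, hi⟩ : Fin n) ∈ Finset.univ.filter
        fun i : Fin n => A.firing s e (extend τ) i ∈ A.constPoints := by simpa using hK
    rw [← heq] at this
    simpa using this
  have h4 := hbK ⟨i, hi⟩ hiK
  simp only [hgext, firing_add_mul hab] at h4
  have h5 : b * A.firing s e (extend τ') i = b * A.firing s e (extend τ) i := by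
    have h6 : (1 - b) * A.firing s e (extend τ) i + b * A.firing s e (extend τ) i =
      A.firing s e (extend τ) i := by rw [← add_mul, hab, one_mul]
    exact add_left_cancel (h4.trans h6.symm)
  exact mul_left_cancel₀ (ne_of_gt hb0) h5

end TimedAutomaton

namespace TimedAutomaton

/-! ### Thick constrained paths -/

variable {L E : Type*} {A : TimedAutomaton L E} {s : L × ℝ≥0} {e : ℕ → E} {n : ℕ}

theorem mem_projPol_iff (hs : A.IsState s) {C : Set (Fin n → ℝ≥0)} {k : ℕ} (hk : k ≤ n)
    {σ : Fin k → ℝ≥0} : σ ∈ A.projPol s (fun i : Fin n => e i) C k hk ↔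
      ∃ τ ∈ C, A.Admissible s e (extend τ) n ∧ ∀ i < k, extend σ i = extend τ i := by
  constructor
  · rintro ⟨τ, hτ, rfl⟩
    rw [mem_pol hs] at hτ
    refine ⟨τ, hτ.1, hτ.2, fun i hi => ?_⟩
    rw [extend_of_lt _ hi, extend_of_lt _ (hi.trans_le hk)]
    rfl
  · rintro ⟨τ, h1, h2, h3⟩
    refine ⟨τ, (mem_pol hs).2 ⟨h1, h2⟩, funext fun i => ?_⟩
    have := h3 i i.2
    rw [extend_val, extend_of_lt _ (i.2.trans_le hk)] at this
    exact this.symm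

/-- The delays of the first `k` edges of a constrained path. -/
def prefixes (A : TimedAutomaton L E) (s : L × ℝ≥0) (e : ℕ → E) (C : Set (Fin n → ℝ≥0)) (k : ℕ) :
    Set (Fin k → ℝ≥0) :=
  {σ | ∃ τ ∈ C, A.Admissible s e (extend τ) n ∧ ∀ i < k, extend σ i = extend τ i}

/-- The delays of the first `k` edges of a constrained path, followed by an arbitrary edge. -/
def continuations (A : TimedAutomaton L E) (s : L × ℝ≥0) (e : ℕ → E) (C : Set (Fin n → ℝ≥0))
    (k : ℕ) : Set (Fin (k + 1) → ℝ≥0) :=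
  {σ | ∃ e₁, A.Admissible s (Function.update e k e₁) (extend σ) (k + 1) ∧
    ∃ τ ∈ C, A.Admissible s e (extend τ) n ∧ ∀ i < k, extend σ i = extend τ i}

/-- The constraint on `k + 1` delays already contains admissibility of the first `k + 1` edges, so
the sets in `PathThin` reduce to these. Edges become a sequence over `ℕ`, which avoids casts between
`Fin` types. -/
theorem not_pathThin_iff (hs : A.IsState s) {C : Set (Fin n → ℝ≥0)} :
    ¬ A.PathThin s (fun i : Fin n => e i) C ↔
      ∀ k < n, dimH (A.continuations s e C k) ≤ dimH (A.prefixes s e C (k + 1)) := by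
  have hX : ∀ k (hk : k + 1 ≤ n), A.pol s (fun i : Fin (k + 1) => e (Fin.castLE hk i))
      (A.projPol s (fun i : Fin n => e i) C (k + 1) hk) = A.prefixes s e C (k + 1) := by
    intro k hk
    ext σ
    rw [show (fun i : Fin (k + 1) => e (Fin.castLE hk i)) = fun i : Fin (k + 1) => e i from rfl,
      mem_pol hs, mem_projPol_iff hs]
    refine ⟨fun h => h.1, fun h => ⟨h, ?_⟩⟩
    obtain ⟨τ, -, h2, h3⟩ := h
    exact (admissible_congr (fun _ _ => rfl) fun i hi => (h3 i hi)).2 (h2.mono hk)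
  have hY : ∀ k (hk : k + 1 ≤ n), (⋃ e₁ : E, A.pol s
        (Fin.snoc (α := fun _ => E) (fun i : Fin k => e (Fin.castLE (Nat.le_of_succ_le hk) i)) e₁)
        {τ : Fin (k + 1) → ℝ≥0 | (fun i : Fin k => τ i.castSucc) ∈
          A.projPol s (fun i : Fin n => e i) C k (Nat.le_of_succ_le hk)}) =
      A.continuations s e C k := by
    intro k hk
    ext σ
    have hsnoc : ∀ e₁ : E, (Fin.snoc (α := fun _ => E)
        (fun i : Fin k => e (Fin.castLE (Nat.le_of_succ_le hk) i)) e₁ : Fin (k + 1) → E) =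
        fun i : Fin (k + 1) => Function.update e k e₁ i := by
      intro e₁
      funext i
      refine Fin.lastCases ?_ (fun i => ?_) i
      · simp
      · rw [Fin.snoc_castSucc, Function.update_of_ne]
        · rfl
        · exact i.2.ne
    have hext : ∀ i < k, extend (fun i : Fin k => σ i.castSucc) i = extend σ i := by
      intro i hi
      rw [extend_of_lt _ hi, extend_of_lt _ (by omega)]
      rfl
    simp only [Set.mem_iUnion, hsnoc, mem_pol hs, continuations, Set.mem_ofPred_eq,
      mem_projPol_iff hs]
    refine exists_congr fun e₁ => ?_
    rw [and_comm]
    refine and_congr_right fun _ => exists_congr fun τ => and_congr_right fun _ =>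
      and_congr_right fun _ => forall₂_congr fun i hi => ?_
    rw [hext i hi]
  unfold PathThin
  push Not
  constructor
  · intro h k hk
    have := h k hk
    rwa [hX k hk, hY k hk] at this
  · intro h k hk
    rw [hX k hk, hY k hk]
    exact h k hk

variable [Finite L] [Finite E]

/-- A thick constrained path contains delays all of which are thick. -/
theorem exists_thick_of_not_pathThin (hs : A.IsState s) {C O O' : Set (Fin n → ℝ≥0)}
    (hC : ¬ A.PathThin s (fun i : Fin n => e i) C) (hO : IsOpen O) (hO' : IsOpen O')
    (hCO : A.pol s (fun i : Fin n => e i) C = O ∩ A.pol s (fun i : Fin n => e i) Set.univ)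
    (hne : ∃ τ ∈ O ∩ O', A.Admissible s e (extend τ) n) :
    ∃ τ ∈ O ∩ O', A.Admissible s e (extend τ) n ∧
      ∀ k < n, A.ThickStep (A.path s e (extend τ) k) (extend τ k) := by
  classical
  rw [not_pathThin_iff hs] at hC
  have hmemC : ∀ τ ∈ O, A.Admissible s e (extend τ) n → τ ∈ C := by
    intro τ hτ hτ'
    have : τ ∈ A.pol s (fun i : Fin n => e i) C := by
      rw [hCO]; exact ⟨hτ, (mem_pol hs).2 ⟨trivial, hτ'⟩⟩
    exact ((mem_pol hs).1 this).1
  obtain ⟨τ, hτO, hτ, hgen⟩ := exists_generic (hO.inter hO') hne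
  refine ⟨τ, hτO, hτ, fun k hk hK t ht => ?_⟩
  by_contra hthin
  refine (hC k hk).not_gt ?_
  -- If step `k` were thin, the prefixes would have dimension at most the number of non-constant
  -- values up to `k`, since genericity pins the constant ones. Following the first `k` edges by an
  -- edge for the non-constant alternative `t` frees the value at `k` as well, and gives the
  -- continuations a larger dimension.
  set u := A.firing s e (extend τ) with hu
  have hupper : dimH (A.prefixes s e C (k + 1)) ≤
      (Fintype.card {i : Fin (k + 1) // u i ∉ A.constPoints} : ℝ≥0∞) := by
    refine dimH_le_card (A := A) (s := s) (e := e) (fun i : Fin (k + 1) => u i ∉ A.constPoints)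
      (fun i => u i) fun σ hσ i hi => ?_
    obtain ⟨τ', -, h2, h3⟩ := hσ
    rw [firing_congr (e' := e) (τ' := extend τ') (fun _ _ => rfl) fun j hj => h3 j (by omega)]
    exact hgen i (by omega) (not_not.1 hi) τ' h2
  have hst := hτ.isState hs hk.le
  obtain ⟨e₁, he₁, hwin⟩ := (mem_delays hst).1 ht
  obtain ⟨η, hη, hrad⟩ := exists_radius A (fun _ => (A.path s e (extend τ) k).2 + t) 1
  obtain ⟨δ₀, hδ₀, hball⟩ := Metric.isOpen_iff.1 (hO.inter hO') τ hτO
  have hδ : 0 < min δ₀ (η / (8 * (k + 1))) := lt_min hδ₀ (by positivity)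
  obtain ⟨w, ε, hε, hbox⟩ := hτ.exists_box hδ
  -- The last value ranges around `v + t + η / 2` with radius at most `η / 4`, where `v` is the
  -- clock before step `k`. Perturbing the earlier delays moves `v` by at most `η / 8`, so the last
  -- delay stays nonnegative and the value stays in the region of `v + t`.
  have hlower : (Fintype.card {i : Fin (k + 1) // u i ∉ A.constPoints ∨ i = Fin.last k} : ℝ≥0∞) ≤
      dimH (A.continuations s e C k) := by
    refine card_le_dimH (A := A) (s := s) (e := e)
      (fun i : Fin (k + 1) => u i ∉ A.constPoints ∨ i = Fin.last k)
      (fun i => if (i : ℕ) < k then w i else (A.path s e (extend τ) k).2 + t + η / 2)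
      (lt_min hε (by positivity : 0 < η / 4)) fun y hy => ?_
    obtain ⟨τ₁, h1, h2, h3⟩ := hbox (fun i => if h : i < k then y ⟨i, by omega⟩ else w i) (by
      intro i _
      by_cases hik : i < k
      · have := hy ⟨i, by omega⟩
        simp only [hik, if_true] at this
        simp only [hik, dif_pos]
        exact this.trans_le (min_le_left _ _)
      · simpa [hik] using hε)
    have hyk := hy (Fin.last k)
    simp only [Fin.val_last, lt_self_iff_false, if_false] at hyk
    have hyk' := abs_lt.1 (hyk.trans_le (min_le_right _ _))
    set v := (A.path s e (extend τ) k).2 with hv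
    set v₁ := (A.path s e τ₁ k).2 with hv₁
    have hvv : dist v₁ v ≤ η / 8 := by
      refine (dist_path_le k).trans ?_
      calc ∑ i ∈ Finset.range k, dist (τ₁ i) (extend τ i)
          ≤ ∑ i ∈ Finset.range k, η / (8 * (k + 1)) := by
            refine Finset.sum_le_sum fun i hi => ?_
            exact ((h2 i ((Finset.mem_range.1 hi).trans hk)).trans_le (min_le_right _ _)).le
        _ = k * (η / (8 * (k + 1))) := by simp
        _ ≤ η / 8 := by
          rw [mul_div_assoc', div_le_div_iff₀ (by positivity) (by positivity)]
          nlinarith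
    rw [NNReal.dist_eq, abs_le] at hvv
    have hv0 : (0 : ℝ) ≤ v := v.2
    have ht0 : (0 : ℝ) ≤ t := t.2
    let x : ℝ≥0 := (y (Fin.last k)).toNNReal
    have hx : (x : ℝ) = y (Fin.last k) := Real.coe_toNNReal _ (by linarith)
    have hvx : v₁ ≤ x := by
      rw [← NNReal.coe_le_coe, hx]; linarith
    have hxreg : x ∈ A.region (v + t) := by
      refine (hrad 0 one_pos x ?_).1 hthin
      rw [NNReal.dist_eq, hx, abs_lt]
      push_cast
      constructor <;> linarith
    let σ : Fin (k + 1) → ℝ≥0 := fun i => if (i : ℕ) < k then τ₁ i else x - v₁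
    have hσ : ∀ i < k, extend σ i = τ₁ i := by
      intro i hi
      rw [extend_of_lt _ (by omega : i < k + 1)]
      exact if_pos hi
    have hσk : extend σ k = x - v₁ := by
      rw [extend_of_lt _ (by omega : k < k + 1)]
      exact if_neg (lt_irrefl k)
    have hpk : A.path s e (extend σ) k = A.path s e τ₁ k := path_congr (fun _ _ => rfl) hσ
    have hfk : A.firing s e (extend σ) k = x := by
      rw [firing, hpk, hσk]
      exact add_tsub_cancel_of_le hvx
    have hupd : ∀ i < k, Function.update e k e₁ i = e i := fun i hi =>
      Function.update_of_ne hi.ne _ _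
    have hadm₁ : A.Admissible s e (extend fun i : Fin n => τ₁ i) n :=
      (admissible_congr (fun _ _ => rfl) fun i hi => extend_of_lt _ hi).2 h1
    refine ⟨σ, ⟨e₁, ?_, fun i => τ₁ i, hmemC _ ?_ hadm₁, hadm₁, ?_⟩, ?_⟩
    · intro i hi
      have hpi : A.path s (Function.update e k e₁) (extend σ) i = A.path s e (extend σ) i :=
        path_congr (fun j hj => hupd j (by omega)) fun _ _ => rfl
      rw [firing, hpi]
      rcases Nat.lt_succ_iff_lt_or_eq.1 hi with h | rfl
      · rw [hupd i h, path_congr (e' := e) (τ' := τ₁) (fun _ _ => rfl) (fun j hj => hσ j (by omega)),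
          hσ i h]
        exact h1 i (by omega)
      · rw [Function.update_self]
        refine ⟨he₁.trans (path_fst _), ?_⟩
        change A.firing s e (extend σ) i ∈ _
        rw [hfk]
        exact (window_congr _ hxreg).2 hwin
    · refine (hball ?_).1
      rw [Metric.mem_ball, dist_pi_lt_iff hδ₀]
      intro i
      have := (h2 i i.2).trans_le (min_le_left _ _)
      rwa [extend_val] at this
    · intro i hi
      rw [hσ i hi, extend_of_lt _ (hi.trans hk)]
    · intro i hi
      rcases Nat.lt_succ_iff_lt_or_eq.1 i.2 with h | h
      · have hiK : u i ∉ A.constPoints := by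
          refine hi.resolve_right fun h' => ?_
          rw [h'] at h
          exact lt_irrefl k h
        have h4 := (h3 i (by omega)).1 hiK
        rw [firing_congr (e' := e) (τ' := τ₁) (fun _ _ => rfl) fun j hj => hσ j (by omega), h4]
        simp [h]
      · rw [show i = Fin.last k from Fin.ext h, Fin.val_last, hfk, hx]
  refine hupper.trans_lt (lt_of_lt_of_le ?_ hlower)
  rw [Nat.cast_lt, Fintype.card_subtype, Fintype.card_subtype]
  refine Finset.card_lt_card ((Finset.ssubset_iff_of_subset fun i hi => ?_).2
    ⟨Fin.last k, by simp, ?_⟩)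
  · simp only [Finset.mem_filter, Finset.mem_univ, true_and] at hi ⊢
    exact Or.inl hi
  · simpa using (show u k ∈ A.constPoints from hK)

/-- Along thick steps, nearby admissible delays pass through the same regions. -/
theorem firing_mem_region (hs : A.IsState s) {τ τ' : ℕ → ℝ≥0} (h : A.Admissible s e τ n)
    (h' : A.Admissible s e τ' n) (hthick : ∀ k < n, A.ThickStep (A.path s e τ k) (τ k))
    (hnear : ∀ k < n, A.firing s e τ k ∉ A.constPoints →
      A.firing s e τ' k ∈ A.region (A.firing s e τ k))
    (hnear' : ∀ k < n, A.firing s e τ k ∈ A.constPoints →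
      A.firing s e τ' k ∈ A.constPoints → A.firing s e τ' k = A.firing s e τ k)
    {k : ℕ} (hk : k < n) : A.firing s e τ' k ∈ A.region (A.firing s e τ k) := by
  induction k with
  | zero =>
    by_cases hK : A.firing s e τ 0 ∈ A.constPoints
    · have hd : τ' 0 ∈ A.delays s := (mem_delays hs).2 ⟨e 0, h' 0 hk⟩
      rw [hnear' 0 hk hK (hthick 0 hk hK _ hd)]
      exact A.mem_region_self _
    · exact hnear 0 hk hK
  | succ k ih =>
    by_cases hK : A.firing s e τ (k + 1) ∈ A.constPoints
    · have hst := h.isState hs hk.le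
      have hst' := h'.isState hs hk.le
      have hreg : (A.path s e τ' (k + 1)).2 ∈ A.region (A.path s e τ (k + 1)).2 :=
        clockAfter_mem_region _ (ih (by omega))
      have hl : (A.path s e τ' (k + 1)).1 = (A.path s e τ (k + 1)).1 := path_fst _
      obtain ⟨x, hx, hle⟩ := exists_delay_mem_region (mem_region_symm hreg)
        (le_add_right (le_refl _) (c := τ' (k + 1)))
      have hd : τ' (k + 1) ∈ A.delays (A.path s e τ' (k + 1)) :=
        (mem_delays hst').2 ⟨e (k + 1), h' (k + 1) hk⟩
      have hst₁ : A.IsState ((A.path s e τ (k + 1)).1, (A.path s e τ' (k + 1)).2) := by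
        rw [← hl]; exact hst'
      have hd₁ : τ' (k + 1) ∈ A.delays ((A.path s e τ (k + 1)).1, (A.path s e τ' (k + 1)).2) := by
        rw [← hl]; exact hd
      have hd₂ := (mem_delays_congr hst₁ hst (τ' := x - (A.path s e τ (k + 1)).2)
        (by
          change (A.path s e τ (k + 1)).2 + (x - (A.path s e τ (k + 1)).2) ∈ _
          rwa [add_tsub_cancel_of_le hle])).2 hd₁
      have h1 := hthick (k + 1) hk hK _ hd₂
      rw [add_tsub_cancel_of_le hle] at h1
      rw [hnear' (k + 1) hk hK ((mem_constPoints_of_mem_region hx).1 h1)]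
      exact A.mem_region_self _
    · exact hnear (k + 1) hk hK

theorem path_mem_region {τ τ' : ℕ → ℝ≥0}
    (h : ∀ k < n, A.firing s e τ' k ∈ A.region (A.firing s e τ k)) {k : ℕ} (hk : k ≤ n) :
    (A.path s e τ' k).2 ∈ A.region (A.path s e τ k).2 := by
  cases k with
  | zero => exact A.mem_region_self _
  | succ k => exact clockAfter_mem_region _ (h k hk)

/-- A neighbourhood of thick delays that stays within the regions is a thick constrained path. -/
theorem not_pathThin_of_thick (hs : A.IsState s) {τ : ℕ → ℝ≥0} (h : A.Admissible s e τ n)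
    (hthick : ∀ k < n, A.ThickStep (A.path s e τ k) (τ k)) {C : Set (Fin n → ℝ≥0)} {ε : ℝ}
    (hε : 0 < ε) (hC : ∀ σ : Fin n → ℝ≥0, (∀ i : Fin n, dist (σ i) (τ i) < ε) → σ ∈ C)
    (hreg : ∀ σ ∈ C, A.Admissible s e (extend σ) n →
      ∀ k < n, A.firing s e (extend σ) k ∈ A.region (A.firing s e τ k)) :
    ¬ A.PathThin s (fun i : Fin n => e i) C := by
  classical
  rw [not_pathThin_iff hs]
  intro k hk
  set u := A.firing s e τ with hu
  -- Both sides are compared with the number of non-constant values among the first `k + 1`.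
  have hlower : (Fintype.card {i : Fin (k + 1) // u i ∉ A.constPoints} : ℝ≥0∞) ≤
      dimH (A.prefixes s e C (k + 1)) := by
    obtain ⟨w, ζ, hζ, hbox⟩ := h.exists_box hε
    refine card_le_dimH (A := A) (s := s) (e := e) (fun i : Fin (k + 1) => u i ∉ A.constPoints)
      (fun i => w i) hζ fun y hy => ?_
    obtain ⟨τ₁, h1, h2, h3⟩ := hbox (fun i => if h : i < k + 1 then y ⟨i, h⟩ else w i) (by
      intro i _
      split_ifs with hi
      · exact hy ⟨i, hi⟩
      · simpa using hζ)
    have hext : ∀ i < k + 1, extend (fun i : Fin (k + 1) => τ₁ i) i = τ₁ i := fun i hi =>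
      extend_of_lt _ hi
    refine ⟨fun i => τ₁ i, ⟨fun i => τ₁ i, hC _ fun i => h2 i i.2, ?_, fun i hi => ?_⟩, ?_⟩
    · exact (admissible_congr (fun _ _ => rfl) fun i hi => extend_of_lt _ hi).2 h1
    · rw [hext i hi, extend_of_lt _ (by omega : i < n)]
    · intro i hi
      rw [firing_congr (e' := e) (τ' := τ₁) (fun _ _ => rfl) fun j hj => hext j (by omega),
        (h3 i (by omega)).1 hi, dif_pos i.2]
  refine le_trans ?_ hlower
  have hfix : ∀ σ ∈ A.continuations s e C k, ∀ i < k, u i ∈ A.constPoints →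
      A.firing s e (extend σ) i = u i := by
    rintro σ ⟨e₁, -, τ', hτ'C, hτ', hσ⟩ i hi hK
    rw [firing_congr (e' := e) (τ' := extend τ') (fun _ _ => rfl) fun j hj => hσ j (by omega)]
    exact eq_of_mem_region hK (hreg τ' hτ'C hτ' i (by omega))
  by_cases hK : u k ∈ A.constPoints
  · have hsub : A.continuations s e C k ⊆ ⋃ c ∈ A.constPoints,
        {σ | σ ∈ A.continuations s e C k ∧ A.firing s e (extend σ) k = c} := by
      intro σ hσ
      refine Set.mem_biUnion (x := A.firing s e (extend σ) k) ?_ ⟨hσ, rfl⟩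
      obtain ⟨e₁, hadm, τ', hτ'C, hτ', hσ'⟩ := hσ
      have hp : A.path s e (extend σ) k = A.path s e (extend τ') k := path_congr (fun _ _ => rfl) hσ'
      have hp' : A.path s (Function.update e k e₁) (extend σ) k = A.path s e (extend σ) k :=
        path_congr (fun i hi => Function.update_of_ne hi.ne _ _) fun _ _ => rfl
      have hst := h.isState hs hk.le
      have hst' := hτ'.isState hs hk.le
      have hk' := hadm k (by omega)
      rw [firing, hp', hp] at hk'
      have hd : extend σ k ∈ A.delays (A.path s e (extend τ') k) := (mem_delays hst').2 ⟨_, hk'⟩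
      have hregk := path_mem_region (hreg τ' hτ'C hτ') hk.le
      have hl : (A.path s e (extend τ') k).1 = (A.path s e τ k).1 := path_fst _
      obtain ⟨x, hx, hle⟩ := exists_delay_mem_region (mem_region_symm hregk)
        (le_add_right (le_refl _) (c := extend σ k))
      have hst₁ : A.IsState ((A.path s e τ k).1, (A.path s e (extend τ') k).2) := by
        rw [← hl]; exact hst'
      have hd₁ : extend σ k ∈ A.delays ((A.path s e τ k).1, (A.path s e (extend τ') k).2) := by
        rw [← hl]; exact hd
      have hd₂ := (mem_delays_congr hst₁ hst (τ' := x - (A.path s e τ k).2)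
        (by rwa [add_tsub_cancel_of_le hle])).2 hd₁
      have h1 := hthick k hk hK _ hd₂
      rw [add_tsub_cancel_of_le hle] at h1
      rw [firing, hp]
      exact (mem_constPoints_of_mem_region hx).1 h1
    refine (dimH_mono hsub).trans ?_
    rw [dimH_bUnion A.finite_constPoints.countable]
    refine iSup₂_le fun c _ => ?_
    refine dimH_le_card (A := A) (s := s) (e := e) (fun i : Fin (k + 1) => u i ∉ A.constPoints)
      (fun i => if (i : ℕ) < k then u i else c) fun σ hσ i hi => ?_
    split_ifs with hik
    · exact hfix σ hσ.1 i hik (not_not.1 hi)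
    · rw [show (i : ℕ) = k by omega]; exact hσ.2
  · refine dimH_le_card (A := A) (s := s) (e := e) (fun i : Fin (k + 1) => u i ∉ A.constPoints)
      (fun i => u i) fun σ hσ i hi => ?_
    have hik : (i : ℕ) < k := by
      refine lt_of_le_of_ne (by omega) fun h => ?_
      rw [h] at hi
      exact hi hK
    exact hfix σ hσ i hik (not_not.1 hi)

end TimedAutomaton

namespace TimedAutomaton

open Filter Topology

/-! ### Neighbourhoods of thick runs -/

variable {L E : Type*} {A : TimedAutomaton L E} {s : L × ℝ≥0} {e : ℕ → E} {τ τ' : ℕ → ℝ≥0}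
  {n m : ℕ} {ε δ : ℝ}

theorem exists_run_of_admissible (hs : A.IsState s) (h : ∀ n, A.Admissible s e τ n) :
    ∃ ρ : A.Run s, ρ.edge = e ∧ ρ.delay = τ :=
  ⟨⟨A.path s e τ, τ, e, rfl, fun n => (h (n + 1)).step hs n.lt_succ_self⟩, rfl, rfl⟩

/-- A run from the end of a path can be prefixed with this path. -/
theorem Admissible.exists_append (hs : A.IsState s) (h : A.Admissible s e τ n)
    (ρ' : A.Run (A.path s e τ n)) :
    ∃ ρ : A.Run s, (∀ i < n, ρ.edge i = e i ∧ ρ.delay i = τ i) ∧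
      (∀ i ≤ n, ρ.state i = A.path s e τ i) ∧
      ∀ i, ρ.state (n + i) = ρ'.state i ∧ ρ.delay (n + i) = ρ'.delay i := by
  have h1 : ∀ i, (if n + i ≤ n then A.path s e τ (n + i) else ρ'.state (n + i - n)) =
      ρ'.state i := by
    intro i
    cases i with
    | zero => simp [ρ'.start]
    | succ i => rw [if_neg (by omega), add_tsub_cancel_left]
  refine ⟨⟨fun i => if i ≤ n then A.path s e τ i else ρ'.state (i - n),
    fun i => if i < n then τ i else ρ'.delay (i - n),
    fun i => if i < n then e i else ρ'.edge (i - n), by simp [path], fun i => ?_⟩,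
    fun i hi => ⟨if_pos hi, if_pos hi⟩, fun i hi => if_pos hi, fun i => ⟨h1 i, ?_⟩⟩
  · by_cases hi : i < n
    · rw [if_pos hi.le, if_pos hi, if_pos hi, if_pos (Nat.succ_le_of_lt hi)]
      exact h.step hs hi
    · obtain ⟨j, rfl⟩ := Nat.exists_eq_add_of_le (not_lt.1 hi)
      rw [h1, if_neg hi, if_neg hi, add_tsub_cancel_left, add_assoc, h1]
      exact ρ'.step j
  · simp

/-- All steps of the run are thick. -/
def Run.Thick (ρ : A.Run s) : Prop := ∀ n, A.ThickStep (ρ.state n) (ρ.delay n)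

/-- The runs whose first `n` edges are those of `ρ` and whose first `n` delays are `ε`-close to those
of `ρ`. -/
def Run.nbhd (ρ : A.Run s) (n : ℕ) (ε : ℝ) : Set (A.Run s) :=
  {ρ' | ∀ i < n, ρ'.edge i = ρ.edge i ∧ dist (ρ'.delay i) (ρ.delay i) < ε}

theorem Run.self_mem_nbhd (ρ : A.Run s) (n : ℕ) (hε : 0 < ε) : ρ ∈ ρ.nbhd n ε :=
  fun _ _ => ⟨rfl, by rwa [dist_self]⟩

theorem Run.nbhd_subset_nbhd (ρ : A.Run s) (hn : n ≤ m) (hε : ε ≤ δ) :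
    ρ.nbhd m ε ⊆ ρ.nbhd n δ :=
  fun _ h i hi => ⟨(h i (hi.trans_le hn)).1, (h i (hi.trans_le hn)).2.trans_le hε⟩

/-- Delays `ε`-close to the first `n` delays of `ρ` do not leave regions of non-constants and do not
change one constant to another. -/
def Run.IsRadius (ρ : A.Run s) (n : ℕ) (ε : ℝ) : Prop :=
  ∀ τ : ℕ → ℝ≥0, (∀ i < n, dist (τ i) (ρ.delay i) < ε) → ∀ i < n,
    (A.firing s ρ.edge ρ.delay i ∉ A.constPoints →
      A.firing s ρ.edge τ i ∈ A.region (A.firing s ρ.edge ρ.delay i)) ∧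
    (A.firing s ρ.edge ρ.delay i ∈ A.constPoints → A.firing s ρ.edge τ i ∈ A.constPoints →
      A.firing s ρ.edge τ i = A.firing s ρ.edge ρ.delay i)

variable {ρ ρ' : A.Run s}

theorem Run.IsRadius.mono (h : ρ.IsRadius n δ) (hε : ε ≤ δ) : ρ.IsRadius n ε :=
  fun τ hτ => h τ fun i hi => (hτ i hi).trans_le hε

theorem Run.path_eq_of_mem_nbhd (h : ρ' ∈ ρ.nbhd n ε) {i : ℕ} (hi : i ≤ n) :
    A.path s ρ.edge ρ'.delay i = ρ'.state i := by
  rw [← ρ'.path_eq]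
  exact path_congr (fun j hj => (h j (by omega)).1.symm) fun _ _ => rfl

theorem Run.admissible_of_mem_nbhd (h : ρ' ∈ ρ.nbhd n ε) :
    A.Admissible s ρ.edge ρ'.delay n :=
  (admissible_congr (fun i hi => (h i hi).1) fun _ _ => rfl).1 (ρ'.admissible n)

variable [Finite L] [Finite E]

theorem Run.exists_isRadius (ρ : A.Run s) (n : ℕ) : ∃ ε > 0, ρ.IsRadius n ε := by
  obtain ⟨η, hη, h⟩ := exists_radius A (A.firing s ρ.edge ρ.delay) n
  refine ⟨η / (n + 1), by positivity, fun τ hτ i hi => ?_⟩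
  have hd : dist (A.firing s ρ.edge τ i) (A.firing s ρ.edge ρ.delay i) < η := by
    refine (dist_firing_le i).trans_lt ?_
    calc ∑ j ∈ Finset.range (i + 1), dist (τ j) (ρ.delay j)
        ≤ ∑ j ∈ Finset.range (i + 1), η / (n + 1) := Finset.sum_le_sum fun j hj =>
          (hτ j ((Finset.mem_range.1 hj).trans_le hi)).le
      _ = (i + 1) * (η / (n + 1)) := by simp
      _ < η := by
        have : (i : ℝ) + 1 ≤ n := by exact_mod_cast hi
        rw [mul_div_assoc', div_lt_iff₀ (by positivity)]
        nlinarith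
  have h1 := h i hi _ hd
  exact ⟨h1.1, fun hK hK' => (h1.2 hK').elim Eq.symm fun h => absurd hK h⟩

theorem Run.Thick.path (h : ρ.Thick) (n : ℕ) :
    A.ThickStep (A.path s ρ.edge ρ.delay n) (ρ.delay n) := by
  rw [ρ.path_eq]; exact h n

theorem Run.IsRadius.firing_mem_region (hs : A.IsState s) (hρ : ρ.Thick) (h : ρ.IsRadius n ε)
    (hτ : ∀ i < n, dist (τ i) (ρ.delay i) < ε) (hadm : A.Admissible s ρ.edge τ n) {i : ℕ}
    (hi : i < n) : A.firing s ρ.edge τ i ∈ A.region (A.firing s ρ.edge ρ.delay i) :=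
  TimedAutomaton.firing_mem_region hs (ρ.admissible n) hadm (fun k _ => hρ.path k)
    (fun k hk => (h τ hτ k hk).1) (fun k hk => (h τ hτ k hk).2) hi

/-- The neighbourhood is a cylinder over an open ball of delays. Within the radius all admissible
delays pass through the regions of `ρ`, so the constrained path is thick and the cylinder is a basic
open set. -/
theorem Run.IsRadius.isOpen_nbhd (hs : A.IsState s) (hρ : ρ.Thick) (h : ρ.IsRadius n ε)
    (hε : 0 < ε) : IsOpen (ρ.nbhd n ε) := by
  set C : Set (Fin n → ℝ≥0) := Metric.ball (fun i => ρ.delay i) ε with hC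
  have hmem : ∀ σ : Fin n → ℝ≥0, σ ∈ C ↔ ∀ i : Fin n, dist (σ i) (ρ.delay i) < ε :=
    fun σ => dist_pi_lt_iff hε
  refine TopologicalSpace.isOpen_generateFrom_of_mem ⟨n, fun i => ρ.edge i, C, ?_,
    Metric.isOpen_ball.measurableSet, ⟨C, Metric.isOpen_ball, ?_⟩, ?_⟩
  · refine not_pathThin_of_thick hs (ρ.admissible n) (fun k _ => hρ.path k) hε
      (fun σ hσ => (hmem σ).2 hσ) fun σ hσ hadm k hk => h.firing_mem_region hs hρ ?_ hadm hk
    intro i hi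
    rw [extend_of_lt _ hi]
    exact (hmem σ).1 hσ ⟨i, hi⟩
  · ext σ
    exact ⟨fun hσ => ⟨hσ.1, trivial, hσ.2⟩, fun hσ => ⟨hσ.1, hσ.2.2⟩⟩
  · ext ρ'
    refine ⟨fun h => ⟨fun i => (h i i.2).1, (hmem _).2 fun i => (h i i.2).2⟩, fun h i hi => ?_⟩
    exact ⟨h.1 ⟨i, hi⟩, (hmem _).1 h.2 ⟨i, hi⟩⟩

theorem Run.IsRadius.toRegion_eq (hs : A.IsState s) (hρ : ρ.Thick) (h : ρ.IsRadius n ε)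
    (hρ' : ρ' ∈ ρ.nbhd n ε) : A.toRegion (ρ'.state n) = A.toRegion (ρ.state n) := by
  have h1 := path_mem_region (fun k hk => h.firing_mem_region hs hρ (fun i hi => (hρ' i hi).2)
    (Run.admissible_of_mem_nbhd hρ') hk) le_rfl
  have h2 : (A.path s ρ.edge ρ'.delay n).1 = (A.path s ρ.edge ρ.delay n).1 := path_fst n
  rw [Run.path_eq_of_mem_nbhd hρ' le_rfl, ρ.path_eq] at h1 h2
  exact Prod.ext h2 (region_eq_of_mem h1)

/-- Delays that pass through the same regions as a thick run are admissible and thick. -/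
theorem Run.Thick.admissible_of_firing_mem_region (hs : A.IsState s) (hρ : ρ.Thick)
    (h : ∀ i < n, A.firing s ρ.edge τ i ∈ A.region (A.firing s ρ.edge ρ.delay i)) :
    A.Admissible s ρ.edge τ n ∧ ∀ i < n, A.ThickStep (A.path s ρ.edge τ i) (τ i) := by
  refine ⟨fun i hi => ⟨(ρ.admissible n i hi).1.trans (path_fst i),
    (window_congr _ (h i hi)).2 (ρ.admissible n i hi).2⟩, fun i hi => ?_⟩
  have h1 := path_mem_region h hi.le
  have h2 : (A.path s ρ.edge τ i).1 = (A.path s ρ.edge ρ.delay i).1 := path_fst i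
  have h3 := (thickStep_congr ((ρ.admissible n).isState hs hi.le) h1 (h i hi)).2 (hρ.path i)
  rwa [← h2] at h3

theorem continuous_firing (s : L × ℝ≥0) (e : ℕ → E) (n : ℕ) :
    Continuous fun τ : ℕ → ℝ≥0 => A.firing s e τ n := by
  have hclock : ∀ e, Continuous (A.clockAfter e) := by
    intro e
    unfold clockAfter
    split_ifs
    · exact continuous_const
    · exact continuous_id
  induction n with
  | zero =>
    change Continuous fun τ : ℕ → ℝ≥0 => s.2 + τ 0
    fun_prop
  | succ n ih =>
    change Continuous fun τ : ℕ → ℝ≥0 => A.clockAfter (e n) (A.firing s e τ n) + τ (n + 1)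
    exact ((hclock _).comp ih).add (by fun_prop)

end TimedAutomaton

namespace StochasticTimedAutomaton

open Filter Topology
open TimedAutomaton (Admissible path_congr firing_congr admissible_congr extend extend_of_lt mem_pol
  continuous_extend exists_thick_of_not_pathThin exists_run_of_admissible continuous_firing
  eq_of_mem_region)

variable {L E : Type*} [Fintype L] [MeasurableSpace L] [DiscreteMeasurableSpace L] [Fintype E]
  [MeasurableSpace E] [DiscreteMeasurableSpace E] {M : StochasticTimedAutomaton L E}
  [hE : Nonempty E] {s : L × ℝ≥0}

/-! ### The topology on runs -/

/-- The delays of an actual run are admissible, so on runs the Borel constraint `C` can be replaced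
by the open set `O`. -/
theorem mem_cyl_iff (hs : M.IsState s) {n : ℕ} {e : ℕ → E} {C O : Set (Fin n → ℝ≥0)}
    (hCO : M.pol s (fun i : Fin n => e i) C = O ∩ M.pol s (fun i : Fin n => e i) Set.univ)
    {ρ : M.Run s} (hρ : ∀ i < n, ρ.edge i = e i) :
    ρ ∈ M.cyl s (fun i : Fin n => e i) C ↔ (fun i : Fin n => ρ.delay i) ∈ O := by
  have hadm : M.Admissible s e (extend fun i : Fin n => ρ.delay i) n :=
    (admissible_congr hρ fun i hi =>
      (extend_of_lt (fun i : Fin n => ρ.delay i) hi).symm).1 (ρ.admissible n)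
  have h1 : (fun i : Fin n => ρ.delay i) ∈ M.pol s (fun i : Fin n => e i) C ↔
      (fun i : Fin n => ρ.delay i) ∈ O := by
    rw [hCO]
    exact ⟨fun h => h.1, fun h => ⟨h, (mem_pol hs).2 ⟨trivial, hadm⟩⟩⟩
  rw [← h1, mem_pol hs]
  exact ⟨fun h => ⟨h.2, hadm⟩, fun h => ⟨fun i => hρ i i.2, h.1⟩⟩

/-- Nonempty open sets of runs contain neighbourhoods of thick runs. -/
theorem exists_nbhd_subset (hs : M.IsState s) {V : Set (M.Run s)} (hV : IsOpen V)
    (hne : V.Nonempty) : ∃ ρ : M.Run s, ρ.Thick ∧ ∃ n, ∃ ε > 0, ρ.nbhd n ε ⊆ V := by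
  obtain ⟨ρ₀, hρ₀⟩ := hne
  obtain ⟨W, ⟨f, ⟨hfin, hf⟩, rfl⟩, hρ₀W, hWV⟩ :=
    (TopologicalSpace.isTopologicalBasis_of_subbasis
      (rfl : TimedAutomaton.runTopology M.toTimedAutomaton s = _)).exists_subset_of_mem_open hρ₀ hV
  rcases f.eq_empty_or_nonempty with rfl | hfne
  · obtain ⟨ρ, hρ⟩ := exists_thick_run hs
    refine ⟨ρ, hρ, 0, 1, one_pos, fun _ _ => hWV ?_⟩
    simp
  have hf' : ∀ U : f, ∃ (n : ℕ) (e : Fin n → E) (C : Set (Fin n → ℝ≥0)),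
      ¬ M.PathThin s e C ∧ MeasurableSet C ∧
      (∃ O : Set (Fin n → ℝ≥0), IsOpen O ∧ M.pol s e C = O ∩ M.pol s e Set.univ) ∧
      U.1 = M.cyl s e C := fun U => hf U.2
  choose N e C hthin hmeas hCO hU using hf'
  choose O hO hpol using hCO
  have hedge : ∀ U, e U = fun i : Fin (N U) => ρ₀.edge i := by
    intro U
    have h := hρ₀W U.1 U.2
    rw [hU U] at h
    exact funext fun i => (h.1 i).symm
  simp only [hedge] at hthin hpol hU
  have := hfin.to_subtype
  have := hfne.to_subtype
  -- All cylinders in the finite intersection contain `ρ₀` and so prescribe prefixes of its edges.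
  -- The longest one carries all constraints; the shorter ones become open conditions `O'` on its
  -- delays.
  obtain ⟨U₀, hU₀⟩ := Finite.exists_max N
  have hmem : ∀ U (ρ : M.Run s), (∀ i < N U₀, ρ.edge i = ρ₀.edge i) →
      (ρ ∈ U.1 ↔ (fun i : Fin (N U) => ρ.delay i) ∈ O U) := by
    intro U ρ hρ
    have := mem_cyl_iff hs (hpol U) fun i hi => hρ i (hi.trans_le (hU₀ U))
    rwa [← hU U] at this
  let O' : Set (Fin (N U₀) → ℝ≥0) := ⋂ U, {σ | (fun i : Fin (N U) => extend σ i) ∈ O U}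
  have hO' : IsOpen O' := isOpen_iInter_of_finite fun U =>
    (hO U).preimage (continuous_pi fun i => continuous_extend _ _)
  have hmem' : ∀ ρ : M.Run s, (∀ i < N U₀, ρ.edge i = ρ₀.edge i) →
      ((fun i : Fin (N U₀) => ρ.delay i) ∈ O' ↔ ρ ∈ ⋂₀ f) := by
    intro ρ hρ
    simp only [O', Set.mem_iInter, Set.mem_sInter]
    refine ⟨fun h U hUf => (hmem ⟨U, hUf⟩ ρ hρ).2 ?_, fun h U => ?_⟩
    · convert h ⟨U, hUf⟩ using 0
      simp only [Set.mem_ofPred_eq]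
      refine iff_of_eq (congrArg (· ∈ O _) (funext fun i => ?_))
      rw [extend_of_lt _ (i.2.trans_le (hU₀ _))]
    · have := (hmem U ρ hρ).1 (h U.1 U.2)
      convert this using 0
      simp only [Set.mem_ofPred_eq]
      refine iff_of_eq (congrArg (· ∈ O _) (funext fun i => ?_))
      rw [extend_of_lt _ (i.2.trans_le (hU₀ _))]
  obtain ⟨τ, hτO, hadm, hthick⟩ := exists_thick_of_not_pathThin hs (hthin U₀) (hO U₀) hO' (hpol U₀)
    ⟨fun i => ρ₀.delay i, ⟨(hmem U₀ ρ₀ fun _ _ => rfl).1 (hρ₀W _ U₀.2),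
      (hmem' ρ₀ fun _ _ => rfl).2 hρ₀W⟩,
      (admissible_congr (fun _ _ => rfl) fun i hi =>
        (extend_of_lt (fun i : Fin (N U₀) => ρ₀.delay i) hi).symm).1 (ρ₀.admissible _)⟩
  -- The finite thick path is continued by any thick run from its end state.
  obtain ⟨ρ₁, hρ₁⟩ := exists_thick_run (hadm.isState hs le_rfl)
  obtain ⟨ρ, h1, h2, h3⟩ := hadm.exists_append hs ρ₁
  obtain ⟨ε, hε, hball⟩ := Metric.isOpen_iff.1 hO' τ hτO.2
  refine ⟨ρ, fun i => ?_, N U₀, ε, hε, fun ρ' hρ' => hWV ((hmem' ρ' fun i hi => ?_).1 (hball ?_))⟩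
  · rcases lt_or_ge i (N U₀) with hi | hi
    · rw [h2 i hi.le, (h1 i hi).2]
      exact hthick i hi
    · obtain ⟨j, rfl⟩ := Nat.exists_eq_add_of_le hi
      rw [(h3 j).1, (h3 j).2]
      exact hρ₁ j
  · rw [(hρ' i hi).1, (h1 i hi).1]
  · rw [Metric.mem_ball, dist_pi_lt_iff hε]
    intro i
    have := (hρ' i i.2).2
    rwa [(h1 i i.2).2, extend_of_lt _ i.2] at this

/-- Nonempty open sets of runs contain arbitrarily small neighbourhoods of thick runs. -/
theorem exists_small_nbhd_subset (hs : M.IsState s) {V : Set (M.Run s)} (hV : IsOpen V)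
    (hne : V.Nonempty) (m : ℕ) {δ : ℝ} (hδ : 0 < δ) :
    ∃ ρ : M.Run s, ρ.Thick ∧ ∃ n, ∃ ε > 0, ρ.IsRadius n ε ∧ m ≤ n ∧ ε ≤ δ ∧ ρ.nbhd n ε ⊆ V := by
  obtain ⟨ρ, hρ, n, ε, hε, hsub⟩ := exists_nbhd_subset hs hV hne
  obtain ⟨ε', hε', hr⟩ := ρ.exists_isRadius (max n m)
  exact ⟨ρ, hρ, max n m, min ε' (min ε δ), by positivity, hr.mono (min_le_left _ _),
    le_max_right _ _, (min_le_right _ _).trans (min_le_right _ _),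
    (ρ.nbhd_subset_nbhd (le_max_left _ _) ((min_le_right _ _).trans (min_le_left _ _))).trans hsub⟩

/-- A decreasing sequence of neighbourhoods of thick runs has a thick run in common. -/
theorem exists_thick_mem_nbhd (hs : M.IsState s) {ρ : ℕ → M.Run s} {n : ℕ → ℕ} {ε : ℕ → ℝ}
    (hρ : ∀ k, (ρ k).Thick) (hε : ∀ k, 0 < ε k) (hr : ∀ k, (ρ k).IsRadius (n k) (ε k))
    (hn : ∀ k, k ≤ n k) (hlim : Tendsto ε atTop (𝓝 0))
    (hsub : ∀ k, (ρ (k + 1)).nbhd (n (k + 1)) (ε (k + 1)) ⊆ (ρ k).nbhd (n k) (ε k / 2)) :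
    ∃ ρ' : M.Run s, ρ'.Thick ∧ ∀ k, ρ' ∈ (ρ k).nbhd (n k) (ε k) := by
  have hanti : Antitone fun k => (ρ k).nbhd (n k) (ε k) := antitone_nat_of_succ_le fun k =>
    (hsub k).trans ((ρ k).nbhd_subset_nbhd le_rfl (half_le_self (hε k).le))
  have hmem : ∀ k j, k ≤ j → ρ j ∈ (ρ k).nbhd (n k) (ε k / 2) := by
    intro k j hkj
    rcases hkj.eq_or_lt with rfl | h
    · exact (ρ k).self_mem_nbhd _ (half_pos (hε k))
    · exact hsub k (hanti (Nat.succ_le_of_lt h) ((ρ j).self_mem_nbhd _ (hε j)))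
  have hcauchy : ∀ i, ∃ t, Tendsto (fun k => (ρ k).delay i) atTop (𝓝 t) := by
    intro i
    have h : CauchySeq fun k => (ρ (k + (i + 1))).delay i := by
      refine cauchySeq_of_le_tendsto_0' (fun k => ε (k + (i + 1))) (fun k j hkj => ?_)
        ((tendsto_add_atTop_iff_nat (i + 1)).2 hlim)
      have h1 := (hmem (k + (i + 1)) (j + (i + 1)) (by omega) i
        (by have := hn (k + (i + 1)); omega)).2
      rw [dist_comm]
      exact h1.le.trans (half_le_self (hε _).le)
    obtain ⟨t, ht⟩ := cauchySeq_tendsto_of_complete h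
    exact ⟨t, (tendsto_add_atTop_iff_nat (i + 1)).1 ht⟩
  choose t ht using hcauchy
  -- Closeness of later runs is only known to be at most `ε k / 2` in the limit; the factor `1 / 2`
  -- in `hsub` restores the strict inequality.
  have hclose : ∀ k, ∀ i < n k, dist (t i) ((ρ k).delay i) < ε k := by
    intro k i hi
    refine lt_of_le_of_lt ?_ (half_lt_self (hε k))
    refine le_of_tendsto ((ht i).dist tendsto_const_nhds) ?_
    filter_upwards [eventually_ge_atTop k] with j hj
    exact (hmem k j hj i hi).2.le
  have hedge : ∀ k, ∀ i < n k, (ρ k).edge i = (ρ (i + 1)).edge i := by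
    intro k i hi
    rw [← (hmem k _ (le_max_left k (i + 1)) i hi).1,
      (hmem (i + 1) _ (le_max_right k (i + 1)) i (hn (i + 1))).1]
  -- Regions of non-constants are handled by the radius. At a constant, all later runs have exactly
  -- this value, so the limit has it too. Hence the limit passes through the regions of thick runs,
  -- which makes it admissible and thick.
  have hreg : ∀ k, ∀ i < n k, M.firing s (ρ k).edge t i ∈
      M.region (M.firing s (ρ k).edge (ρ k).delay i) := by
    intro k i hi
    by_cases hK : M.firing s (ρ k).edge (ρ k).delay i ∈ M.constPoints
    · have h1 : ∀ j, k ≤ j → M.firing s (ρ k).edge (ρ j).delay i =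
          M.firing s (ρ k).edge (ρ k).delay i := by
        intro j hj
        have h2 := (ρ k).nbhd_subset_nbhd le_rfl (half_le_self (hε k).le) (hmem k j hj)
        exact eq_of_mem_region hK ((hr k).firing_mem_region hs (hρ k) (fun i hi => (h2 i hi).2)
          (TimedAutomaton.Run.admissible_of_mem_nbhd h2) hi)
      have h3 : Tendsto (fun j => M.firing s (ρ k).edge (ρ j).delay i) atTop
          (𝓝 (M.firing s (ρ k).edge t i)) :=
        ((continuous_firing s (ρ k).edge i).tendsto t).comp (tendsto_pi_nhds.2 ht)
      have h4 := tendsto_const_nhds.congr' (f₁ := fun _ => M.firing s (ρ k).edge (ρ k).delay i)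
        (by filter_upwards [eventually_ge_atTop k] with j hj using (h1 j hj).symm)
      rw [tendsto_nhds_unique h3 h4]
      exact M.mem_region_self _
    · exact ((hr k) t (hclose k) i hi).1 hK
  set e : ℕ → E := fun i => (ρ (i + 1)).edge i
  have hadm : ∀ k, M.Admissible s e t k ∧ ∀ i < k, M.ThickStep (M.path s e t i) (t i) := by
    intro k
    obtain ⟨h1, h2⟩ := (hρ k).admissible_of_firing_mem_region hs (hreg k)
    refine ⟨((admissible_congr (hedge k) fun _ _ => rfl).1 h1).mono (hn k), fun i hi => ?_⟩
    have hi' := hi.trans_le (hn k)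
    have := h2 i hi'
    rwa [path_congr (fun j hj => hedge k j (hj.trans hi')) fun _ _ => rfl] at this
  obtain ⟨ρ', rfl', hdel⟩ := exists_run_of_admissible hs fun k => (hadm k).1
  refine ⟨ρ', fun i => ?_, fun k i hi => ?_⟩
  · rw [← ρ'.path_eq, rfl', hdel]
    exact (hadm (i + 1)).2 i i.lt_succ_self
  · rw [rfl', hdel]
    exact ⟨(hedge k i hi).symm, hclose k i hi⟩

/-- The thick runs in countably many dense open sets are dense. -/
theorem exists_thick_mem_iInter (hs : M.IsState s) {V : Set (M.Run s)} (hV : IsOpen V)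
    (hne : V.Nonempty) {U : ℕ → Set (M.Run s)} (hU : ∀ k, IsOpen (U k)) (hd : ∀ k, Dense (U k)) :
    ∃ ρ ∈ V, ρ.Thick ∧ ∀ k, ρ ∈ U k := by
  -- Baire's argument with neighbourhoods of thick runs in place of balls: stage `k + 1` lies in the
  -- half-size neighbourhood of stage `k` and in `U k`, prescribes at least `k + 1` steps and has
  -- radius at most `1 / (k + 1)`.
  let Stage := {x : M.Run s × ℕ × ℝ // x.1.Thick ∧ 0 < x.2.2 ∧ x.1.IsRadius x.2.1 x.2.2}
  have hstep : ∀ (k : ℕ) (x : Stage), ∃ y : Stage,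
      y.1.1.nbhd y.1.2.1 y.1.2.2 ⊆ x.1.1.nbhd x.1.2.1 (x.1.2.2 / 2) ∩ U k ∧
        k + 1 ≤ y.1.2.1 ∧ y.1.2.2 ≤ 1 / (k + 1) := by
    rintro k ⟨⟨ρ, n, ε⟩, h1, h2, h3⟩
    have hopen := (h3.mono (half_le_self h2.le)).isOpen_nbhd hs h1 (half_pos h2)
    obtain ⟨ρ', hρ', n', ε', hε', hr, hn, hle, hsub⟩ := exists_small_nbhd_subset hs
      (hopen.inter (hU k)) ((hd k).inter_open_nonempty _ hopen ⟨ρ, ρ.self_mem_nbhd _ (half_pos h2)⟩)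
      (k + 1) (Nat.one_div_pos_of_nat (α := ℝ) (n := k))
    exact ⟨⟨⟨ρ', n', ε'⟩, hρ', hε', hr⟩, hsub, hn, hle⟩
  choose next hnext hn hle using hstep
  obtain ⟨ρ₀, hρ₀, n₀, ε₀, hε₀, hr₀, -, -, hsub₀⟩ := exists_small_nbhd_subset hs hV hne 0 one_pos
  let x : ℕ → Stage := fun k => Nat.rec ⟨⟨ρ₀, n₀, ε₀⟩, hρ₀, hε₀, hr₀⟩ next k
  obtain ⟨ρ, hρ, hmem⟩ := exists_thick_mem_nbhd hs (ρ := fun k => (x k).1.1)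
    (n := fun k => (x k).1.2.1) (ε := fun k => (x k).1.2.2) (fun k => (x k).2.1)
    (fun k => (x k).2.2.1) (fun k => (x k).2.2.2)
    (fun k => by
      cases k with
      | zero => exact Nat.zero_le _
      | succ k => exact hn k (x k))
    ((tendsto_add_atTop_iff_nat 1).1 (squeeze_zero (fun k => (x (k + 1)).2.2.1.le)
      (fun k => hle k (x k)) tendsto_one_div_add_atTop_nhds_zero_nat))
    (fun k => (hnext k (x k)).trans Set.inter_subset_left)
  exact ⟨ρ, hsub₀ (hmem 0), hρ, fun k => (hnext k (x k) (hmem (k + 1))).2⟩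

/-! ### Large sets of non-Zeno runs -/

theorem largelySatisfies_not_zeno (hM : M.Dagger) (hs : M.IsState s)
    (h : ¬ ∃ B, M.IsZenoBSCC B ∧ ∃ q ∈ B, M.ThickReach (M.toRegion s) q) :
    M.LargelySatisfies s (fun ρ => ¬ ρ.Zeno) := by
  -- A run lying in every `W N` has unbounded partial sums, hence is non-Zeno. It remains to see
  -- that each `W N` has dense interior: a thick prefix in a given open set is continued by a thick
  -- non-Zeno run, which exists because (c) is inherited by reachable states.
  let W : ℕ → Set (M.Run s) := fun N => {ρ | ∃ m, (N : ℝ≥0) < ∑ i ∈ Finset.range m, ρ.delay i}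
  have hW : ∀ N, Dense (interior (W N)) := by
    intro N
    rw [dense_iff_inter_open]
    intro V hV hne
    obtain ⟨ρ, hρ, n, ε, hε, hsub⟩ := exists_nbhd_subset hs hV hne
    have hadm := ρ.admissible n
    obtain ⟨ρ₁, hρ₁, hz⟩ := exists_thick_not_zeno hM (hadm.isState hs le_rfl) (by
      rintro ⟨B, hB, q, hq, hreach⟩
      rw [ρ.path_eq] at hreach
      exact h ⟨B, hB, q, hq, (thickReach_state hρ n).trans hreach⟩)
    obtain ⟨ρ', h1, h2, h3⟩ := hadm.exists_append hs ρ₁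
    have hthick : ρ'.Thick := by
      intro i
      rcases lt_or_ge i n with hi | hi
      · rw [h2 i hi.le, (h1 i hi).2]
        exact hρ.path i
      · obtain ⟨j, rfl⟩ := Nat.exists_eq_add_of_le hi
        rw [(h3 j).1, (h3 j).2]
        exact hρ₁ j
    have hz' : ¬ Summable ρ'.delay := by
      refine fun hsum => hz ((NNReal.summable_nat_add _ hsum n).congr fun i => ?_)
      rw [add_comm, (h3 i).2]
    obtain ⟨m, hm⟩ := ((NNReal.not_summable_iff_tendsto_nat_atTop.1 hz').eventually_ge_atTop
      ((N : ℝ≥0) + 1)).exists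
    obtain ⟨η, hη, hr⟩ := ρ'.exists_isRadius m
    -- Changing each of `m` delays by less than `1 / (m + 1)` loses less than `1` in total, so the
    -- sum stays above `N` after starting from at least `N + 1`.
    refine ⟨ρ', hsub fun i hi => ⟨(h1 i hi).1, by rwa [(h1 i hi).2, dist_self]⟩,
      mem_interior.2 ⟨ρ'.nbhd m (min η (1 / (m + 1))), fun ρ₂ hρ₂ => ⟨m, ?_⟩,
        (hr.mono (min_le_left _ _)).isOpen_nbhd hs hthick (by positivity),
        ρ'.self_mem_nbhd _ (by positivity)⟩⟩
    have h4 : ∀ i ∈ Finset.range m, (ρ'.delay i : ℝ) - 1 / (m + 1) ≤ ρ₂.delay i := by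
      intro i hi
      have := (hρ₂ i (Finset.mem_range.1 hi)).2.trans_le (min_le_right _ _)
      rw [NNReal.dist_eq, abs_lt] at this
      linarith [this.1]
    have h5 := Finset.sum_le_sum h4
    rw [Finset.sum_sub_distrib, Finset.sum_const, Finset.card_range, nsmul_eq_mul] at h5
    have h6 : (m : ℝ) * (1 / (m + 1)) < 1 := by
      rw [mul_one_div, div_lt_one (by positivity)]
      linarith
    have h7 : (N : ℝ) + 1 ≤ ∑ i ∈ Finset.range m, (ρ'.delay i : ℝ) := by exact_mod_cast hm
    rw [← NNReal.coe_lt_coe]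
    push_cast
    linarith
  rw [TimedAutomaton.LargelySatisfies, IsMeagre, compl_compl]
  refine mem_of_superset (countable_iInter_mem.2 fun N =>
    residual_of_dense_open isOpen_interior (hW N)) fun ρ hρ hz => ?_
  obtain ⟨N, hN⟩ := exists_nat_gt (∑' i, ρ.delay i)
  obtain ⟨m, hm⟩ := interior_subset (Set.mem_iInter.1 hρ N)
  exact (hm.trans_le (hz.sum_le_tsum _ fun _ _ => zero_le)).not_gt hN

/-- All thick runs close to a thick run that reaches the component reach it too, hence are Zeno. But
a residual set contains a thick run in every nonempty open set. -/
theorem not_exists_zenoBSCC_of_largelySatisfies (hs : M.IsState s)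
    (h : M.LargelySatisfies s (fun ρ => ¬ ρ.Zeno)) :
    ¬ ∃ B, M.IsZenoBSCC B ∧ ∃ q ∈ B, M.ThickReach (M.toRegion s) q := by
  rintro ⟨B, hB, q, hq, hreach⟩
  rw [TimedAutomaton.LargelySatisfies, IsMeagre, compl_compl, mem_residual_iff] at h
  obtain ⟨S, hopen, hdense, hS, hsub⟩ := h
  -- Adding `Set.univ` makes the countable family nonempty, so that it can be enumerated by `ℕ`.
  obtain ⟨U, hU⟩ := (hS.insert Set.univ).exists_eq_range (Set.insert_nonempty _ _)
  have hmemU : ∀ k, U k ∈ insert Set.univ S := fun k => hU ▸ Set.mem_range_self k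
  obtain ⟨ρ₀, hρ₀, n, rfl⟩ := exists_thick_reach hs hreach
  obtain ⟨ε, hε, hr⟩ := ρ₀.exists_isRadius n
  obtain ⟨ρ, hρV, hρ, hρU⟩ := exists_thick_mem_iInter hs (hr.isOpen_nbhd hs hρ₀ hε)
    ⟨ρ₀, ρ₀.self_mem_nbhd n hε⟩
    (fun k => (hmemU k).elim (fun h => h ▸ isOpen_univ) (hopen _))
    (fun k => (hmemU k).elim (fun h => h ▸ dense_univ) (hdense _))
  refine hsub (Set.mem_sInter.2 fun T hT => ?_) (hB.summable ρ.step hρ (m := n) ?_)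
  · have hT' : T ∈ Set.range U := hU ▸ Set.mem_insert_of_mem _ hT
    obtain ⟨k, rfl⟩ := hT'
    exact hρU k
  · rw [hr.toRegion_eq hs hρ₀ hρV]
    exact hq

end StochasticTimedAutomaton

/-! ### The equivalence of the three conditions -/

theorem mainTheorem8 {L E : Type*} [Fintype L] [MeasurableSpace L] [DiscreteMeasurableSpace L]
    [Fintype E] [MeasurableSpace E] [DiscreteMeasurableSpace E]
    (M : StochasticTimedAutomaton L E) (hM : M.Dagger) (s : L × ℝ≥0) (hs : M.IsState s) :
    [M.AlmostSurelySatisfies s (fun ρ => ¬ ρ.Zeno),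
      M.LargelySatisfies s (fun ρ => ¬ ρ.Zeno),
      ¬ ∃ B, M.IsZenoBSCC B ∧ ∃ q ∈ B, M.ThickReach (M.toRegion s) q].TFAE := by
  obtain ⟨t, ht⟩ := M.nonBlocking s hs
  obtain ⟨e, -⟩ := Set.mem_iUnion.1 ht
  have : Nonempty E := ⟨e⟩
  tfae_have 1 ↔ 3 := StochasticTimedAutomaton.almostSurelySatisfies_not_zeno_iff hM hs
  tfae_have 3 → 2 := StochasticTimedAutomaton.largelySatisfies_not_zeno hM hs
  tfae_have 2 → 3 := StochasticTimedAutomaton.not_exists_zenoBSCC_of_largelySatisfies hs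
  tfae_finish
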